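/- **Theorem.** Let $\Phi=(V,R,V^\vee,R^\vee)$ be a reduced crystallographic real root system, with $R$ spanning $V$ and $R^\vee$ spanning $V^\vee$, Weyl group $W\subset GL(V)$, a basis $F$ of simple roots, positive roots $R^+$, and a $W$-invariant inner product $\langle\,,\rangle$ on $V$. Let $\underline k=(\underline k_\alpha)_{\alpha\in R}$ be indeterminates with $\underline k_\alpha=\underline k_{\beta}$ exactly when $\alpha,\beta$ are $W$-conjugate, and put $A=\mathbb C[\underline k]$. Let $\mathbb H_A$ be the generic graded affine Hecke algebra: the associative unital $A$-algebra generated by the $\mathbb C$-algebra $S(V_{\mathbb C})$ and the group $W$, subject to $$s_\alpha\cdot p=s_\alpha(p)\cdot s_\alpha+\underline k_\alpha\,\frac{p-s_\alpha(p)}{\alpha}\qquad(\alpha\in F,\ p\in S(V_{\mathbb C})),$$ so that $\mathbb H_A=S(V_{\mathbb C})\otimes A[W]$ as an $(S(V_{\mathbb C}),A[W])$-bimodule. Let $C(V)$ be the Clifford algebra with relations $\omega\omega'+\omega'\omega=-2\langle\omega,\omega'\rangle$, with its parity automorphism $\epsilon$, its even/odd decomposition, and its anti-automorphism ${}^t$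 with $\omega^t=-\omega$ for $\omega\in V$. Let $\widetilde W$ be the group of units $a\in C(V)^\times$ with $a^t=a^{-1}$ for which there is $p(a)\in W$ with $\epsilon(a)\,\omega\, a^{-1}=p(a)(\omega)$ for all $\omega\in V$; write $\mathbf z\in\widetilde W$ for the element $-1$. Let $\rho:A[\widetilde W]\to\mathbb H_A\otimes C(V)$ be the $A$-algebra homomorphism with $\rho(\tilde w)=p(\tilde w)\otimes\tilde w$; it kills $1+\mathbf z$. For $\xi\in V$ put $\tilde\xi=\xi-\frac12\sum_{\beta\in R^+}\underline k_\beta(\xi,\beta^\vee)s_\beta\in\mathbb H_A$, and let $\mathcal D=\sum_i\tilde\xi_i\otimes\xi^i\in\mathbb H_A\otimes C(V)$ be the Dirac element, where $\{\xi_i\}$, $\{\xi^i\}$ are any dual bases of $V$ with respect to $\langle\,,\rangle$. Then for every $z\in Z(\mathbb H_A)$ there exist $a\in\mathbb H_A\otimes C(V)_{\mathsf{odd}}$ and an element $\zeta(z)$ of the center $A[\widetilde W]^{\widetilde W}$ of $A[\widetilde W]$ such that $$z\otimes1=\rho(\zeta(z))+\mathcal D a+a\mathcal D,$$ and $\zeta(z)$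 is unique modulo the ideal $(1+\mathbf z)A[\widetilde W]$: if a central $c\in A[\widetilde W]$ satisfies $z\otimes 1=\rho(c)+\mathcal D a'+a'\mathcal D$ for some $a'\in\mathbb H_A\otimes C(V)_{\mathsf{odd}}$, then $c-\zeta(z)\in(1+\mathbf z)A[\widetilde W]$. Moreover, the elements $\zeta(z)$ can be chosen so that $z\mapsto\zeta(z)$ is a homomorphism of unital $A$-algebras $\zeta:Z(\mathbb H_A)\to A[\widetilde W]^{\widetilde W}$; in particular the induced map $Z(\mathbb H_A)\to A[\widetilde W]/(1+\mathbf z)$ is a uniquely determined homomorphism of $A$-algebras. -/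

import Mathlib

open scoped TensorProduct

noncomputable section

namespace GradedHecke

section RootSystem

variable {ι V V' : Type*} [AddCommGroup V] [Module ℝ V] [AddCommGroup V'] [Module ℝ V']
variable (P : RootPairing ι ℝ V V')

/-- The Weyl group `W`, as the subgroup of `GL(V)` generated by the reflections in the roots. -/
def weyl : Subgroup (V ≃ₗ[ℝ] V) := Subgroup.closure (Set.range P.reflection)

/-- The reflection `s_α`, as an element of `W`. -/
def refl (i : ι) : weyl P := ⟨P.reflection i, Subgroup.subset_closure ⟨i, rfl⟩⟩

/-- Two roots are equivalent when they are conjugate under `W`. -/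
def conjSetoid : Setoid ι where
  r i j := ∃ w : weyl P, w.1 (P.root i) = P.root j
  iseqv :=
    { refl := fun _ => ⟨1, rfl⟩
      symm := fun {i j} ⟨w, h⟩ => ⟨w⁻¹, by
        rw [← h]
        exact w.1.symm_apply_apply _⟩
      trans := fun {i j l} ⟨w, h⟩ ⟨u, h'⟩ => ⟨u * w, by
        rw [← h', ← h]
        rfl⟩ }

/-- Every root is conjugate to a simple root, so indeterminates indexed by the conjugacy classes
of all roots are the same thing as indeterminates indexed by the simple roots up to conjugacy. -/
theorem exists_simple_conj [Finite ι] [P.IsCrystallographic] [P.IsReduced] (b : P.Base) (i : ι) :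
    ∃ j ∈ b.support, (conjSetoid P).r i j := by
  refine b.induction_reflect i (p := fun i => ∃ j ∈ b.support, (conjSetoid P).r i j) ?_ ?_ ?_
  · rintro i ⟨j, hj, hij⟩
    refine ⟨j, hj, (conjSetoid P).iseqv.trans ?_ hij⟩
    refine ⟨refl P i, ?_⟩
    change P.reflection i (P.root (P.reflectionPerm i i)) = P.root i
    simp
  · intro i hi
    exact ⟨i, hi, (conjSetoid P).iseqv.refl i⟩
  · rintro i l ⟨j, hj, hij⟩ _
    refine ⟨j, hj, (conjSetoid P).iseqv.trans ?_ hij⟩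
    refine ⟨refl P l, ?_⟩
    change P.reflection l (P.root (P.reflectionPerm l i)) = P.root i
    simp

/-- The ring `A = ℂ[k]`, with one indeterminate for each conjugacy class of roots. -/
abbrev ParamRing : Type _ := MvPolynomial (Quotient (conjSetoid P)) ℂ

/-- The indeterminate `k_α`. -/
def k (i : ι) : ParamRing P := MvPolynomial.X (Quotient.mk (conjSetoid P) i)

variable (V) in
/-- The symmetric algebra `S(V_ℂ)` of the complexification of `V`. -/
abbrev Sym : Type _ := SymmetricAlgebra ℂ (ℂ ⊗[ℝ] V)

/-- The inclusion of `V` in `S(V_ℂ)`. -/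
def vec (v : V) : Sym V := SymmetricAlgebra.ι ℂ (ℂ ⊗[ℝ] V) (1 ⊗ₜ v)

/-- The action of `GL(V)` on `S(V_ℂ)` by algebra automorphisms. -/
def symAct (w : V ≃ₗ[ℝ] V) : Sym V →ₐ[ℂ] Sym V :=
  SymmetricAlgebra.lift
    (SymmetricAlgebra.ι ℂ (ℂ ⊗[ℝ] V) ∘ₗ LinearMap.baseChange ℂ (w : V →ₗ[ℝ] V))

variable {P}

/-- The generator of the free `A`-algebra attached to `p ∈ S(V_ℂ)`. -/
abbrev genP (p : Sym V) : FreeAlgebra (ParamRing P) (Sym V ⊕ weyl P) :=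
  FreeAlgebra.ι _ (Sum.inl p)

/-- The generator of the free `A`-algebra attached to `w ∈ W`. -/
abbrev genW (w : weyl P) : FreeAlgebra (ParamRing P) (Sym V ⊕ weyl P) :=
  FreeAlgebra.ι _ (Sum.inr w)

/-- The defining relations of the generic graded Hecke algebra: those of the `ℂ`-algebra `S(V_ℂ)`,
those of the group `W`, and `s_α p = s_α(p) s_α + k_α Δ_α(p)` for `α` simple, where
`q = Δ_α(p) = (p - s_α(p)) / α` is expressed by `α q = p - s_α(p)`. -/
inductive Rel (b : P.Base) :
    FreeAlgebra (ParamRing P) (Sym V ⊕ weyl P) →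
      FreeAlgebra (ParamRing P) (Sym V ⊕ weyl P) → Prop
  | add (p q : Sym V) : Rel b (genP (p + q)) (genP p + genP q)
  | mul (p q : Sym V) : Rel b (genP (p * q)) (genP p * genP q)
  | scalar (c : ℂ) : Rel b (genP (algebraMap ℂ (Sym V) c))
      (algebraMap (ParamRing P) _ (MvPolynomial.C c))
  | one : Rel b (genW 1) 1
  | group (w u : weyl P) : Rel b (genW (w * u)) (genW w * genW u)
  | cross (i : ι) (hi : i ∈ b.support) (p q : Sym V)
      (hq : vec (P.root i) * q = p - symAct (P.reflection i) p) :
      Rel b (genW (refl P i) * genP p)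
        (genP (symAct (P.reflection i) p) * genW (refl P i) + k P i • genP q)

/-- The generic graded affine Hecke algebra `H_A`. -/
def Hecke (b : P.Base) : Type _ := RingQuot (Rel b)

variable (b : P.Base)

instance : Ring (Hecke b) := inferInstanceAs (Ring (RingQuot (Rel b)))

instance : Algebra (ParamRing P) (Hecke b) :=
  inferInstanceAs (Algebra (ParamRing P) (RingQuot (Rel b)))

instance : Algebra ℂ (Hecke b) := inferInstanceAs (Algebra ℂ (RingQuot (Rel b)))

instance : Algebra ℝ (Hecke b) := inferInstanceAs (Algebra ℝ (RingQuot (Rel b)))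

instance : IsScalarTower ℂ (ParamRing P) (Hecke b) :=
  inferInstanceAs (IsScalarTower ℂ (ParamRing P) (RingQuot (Rel b)))

instance : IsScalarTower ℝ (ParamRing P) (Hecke b) :=
  inferInstanceAs (IsScalarTower ℝ (ParamRing P) (RingQuot (Rel b)))

/-- The quotient map from the free algebra. -/
def Hecke.mk : FreeAlgebra (ParamRing P) (Sym V ⊕ weyl P) →ₐ[ParamRing P] Hecke b :=
  RingQuot.mkAlgHom (ParamRing P) (Rel b)

theorem Hecke.mk_rel {x y : FreeAlgebra (ParamRing P) (Sym V ⊕ weyl P)} (h : Rel b x y) :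
    Hecke.mk b x = Hecke.mk b y :=
  RingQuot.mkAlgHom_rel (ParamRing P) h

/-- The homomorphism from `W` to the multiplicative monoid of `H_A`. -/
def Hecke.ofW : weyl P →* Hecke b where
  toFun w := Hecke.mk b (genW w)
  map_one' := by rw [Hecke.mk_rel b Rel.one, map_one]
  map_mul' w u := by rw [Hecke.mk_rel b (Rel.group w u), map_mul]

/-- The map from `V` to `H_A`. -/
def Hecke.ofV (v : V) : Hecke b := Hecke.mk b (genP (vec v))

open Classical in
/-- `T_ξ = 1/2 ∑_{β > 0} k_β (ξ, β^∨) s_β`. -/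
def Hecke.T [Fintype ι] (v : V) : Hecke b :=
  (1 / 2 : ℝ) • ∑ i : ι with b.IsPos i,
    P.toLinearMap v (P.coroot i) • k P i • Hecke.ofW b (refl P i)

/-- `ξ - T_ξ`. -/
def Hecke.tilde [Fintype ι] (v : V) : Hecke b :=
  Hecke.ofV b v - Hecke.T b v

end RootSystem

section Pin

variable {ι V V' : Type*} [NormedAddCommGroup V] [InnerProductSpace ℝ V]
  [AddCommGroup V'] [Module ℝ V']
variable (P : RootPairing ι ℝ V V')

variable (V) in
/-- The quadratic form `v ↦ -⟨v, v⟩`. -/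
def negForm : QuadraticForm ℝ V := -LinearMap.BilinMap.toQuadraticMap (innerₗ V)

variable (V) in
/-- The Clifford algebra `C(V)`, with `v v' + v' v = -2 ⟨v, v'⟩`. -/
abbrev Cliff : Type _ := CliffordAlgebra (negForm V)

variable (V) in
/-- The inclusion of `V` in `C(V)`. -/
abbrev cl : V →ₗ[ℝ] Cliff V := CliffordAlgebra.ι (negForm V)

/-- `ε(a) v a⁻¹ = w(v)` for all `v ∈ V`, that is, `p(a) = w`. -/
def Covers (a : (Cliff V)ˣ) (w : weyl P) : Prop :=
  ∀ v : V, CliffordAlgebra.involute (a : Cliff V) * cl V v * ((a⁻¹ : (Cliff V)ˣ) : Cliff V) =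
    cl V (w.1 v)

theorem cl_injective : Function.Injective (cl V) := fun x y h => by
  have h' := congrArg (CliffordAlgebra.equivExterior (negForm V)) h
  simpa [CliffordAlgebra.equivExterior, CliffordAlgebra.changeForm_ι] using h'

theorem Covers.unique {a : (Cliff V)ˣ} {w u : weyl P} (hw : Covers P a w) (hu : Covers P a u) :
    w = u :=
  Subtype.ext (LinearEquiv.ext fun v => cl_injective ((hw v).symm.trans (hu v)))

theorem Covers.one : Covers P (1 : (Cliff V)ˣ) 1 := fun v => by simp

theorem Covers.neg_one : Covers P (-1 : (Cliff V)ˣ) 1 := fun v => by simp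

theorem Covers.mul {a c : (Cliff V)ˣ} {w u : weyl P} (hw : Covers P a w) (hu : Covers P c u) :
    Covers P (a * c) (w * u) := fun v => by
  have h := hw (u.1 v)
  rw [← hu v] at h
  simpa [mul_assoc] using h

theorem Covers.inv {a : (Cliff V)ˣ} {w : weyl P} (hw : Covers P a w) : Covers P a⁻¹ w⁻¹ :=
  fun v => by
  have h := hw ((w⁻¹ : weyl P).1 v)
  have h1 : w.1 ((w⁻¹ : weyl P).1 v) = v := w.1.apply_symm_apply v
  have h2 : CliffordAlgebra.involute ((a⁻¹ : (Cliff V)ˣ) : Cliff V) *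
      CliffordAlgebra.involute (a : Cliff V) = 1 := by
    rw [← map_mul]
    simp
  rw [h1] at h
  rw [← h, ← mul_assoc, ← mul_assoc, h2]
  simp [mul_assoc]

/-- The pin cover `W̃ = p⁻¹(W)` of the Weyl group: the units `a` of `C(V)` with `aᵗ = a⁻¹` and
`p(a) ∈ W`. The transpose, with `vᵗ = -v` for `v ∈ V`, is the `star` of the Clifford algebra. -/
def pinCover : Subgroup (Cliff V)ˣ where
  carrier := {a | star a = a⁻¹ ∧ ∃ w : weyl P, Covers P a w}
  one_mem' := ⟨by simp, 1, Covers.one P⟩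
  mul_mem' := by
    rintro a c ⟨ha, w, hw⟩ ⟨hc, u, hu⟩
    exact ⟨by rw [star_mul, ha, hc, mul_inv_rev], w * u, hw.mul P hu⟩
  inv_mem' := by
    rintro a ⟨ha, w, hw⟩
    exact ⟨by rw [star_inv, ha], w⁻¹, hw.inv P⟩

/-- The projection `p : W̃ → W`. -/
def proj : pinCover P →* weyl P where
  toFun a := a.2.2.choose
  map_one' := Covers.unique P (1 : pinCover P).2.2.choose_spec (Covers.one P)
  map_mul' a c := Covers.unique P (a * c).2.2.choose_spec
    (Covers.mul P a.2.2.choose_spec c.2.2.choose_spec)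

/-- The element `-1` of `W̃`, which generates the kernel of `p`. -/
def negOne : pinCover P := ⟨-1, by ext; simp, 1, Covers.neg_one P⟩

variable {P} (b : P.Base)

/-- The algebra `H_A ⊗ C(V)`. -/
abbrev HeckeCliff : Type _ := Hecke b ⊗[ℝ] Cliff V

/-- The diagonal homomorphism `ρ : A[W̃] → H_A ⊗ C(V)`, `ρ(a) = p(a) ⊗ a` for `a ∈ W̃`. -/
def rho : MonoidAlgebra (ParamRing P) (pinCover P) →ₐ[ParamRing P] HeckeCliff b :=
  MonoidAlgebra.lift (ParamRing P) (HeckeCliff b) (pinCover P)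
    { toFun := fun a => Hecke.ofW b (proj P a) ⊗ₜ[ℝ] ((a : (Cliff V)ˣ) : Cliff V)
      map_one' := by simp [Algebra.TensorProduct.one_def]
      map_mul' := fun a c => by simp }

/-- The subspace `H_A ⊗ C(V)_odd` of `H_A ⊗ C(V)`. -/
def oddPart : Submodule ℝ (HeckeCliff b) :=
  LinearMap.range (LinearMap.lTensor (Hecke b) (CliffordAlgebra.evenOdd (negForm V) 1).subtype)

/-- The Dirac element `∑ i, (ξ_i - T_{ξ_i}) ⊗ ξ^i` formed with two families of vectors. -/
def dirac [Fintype ι] {κ : Type*} [Fintype κ] (e e' : κ → V) :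
    HeckeCliff b :=
  ∑ i, Hecke.tilde b (e i) ⊗ₜ[ℝ] cl V (e' i)

end Pin

end GradedHecke

end

set_option linter.unusedSectionVars false

noncomputable section

/-! The argument is a Dirac cohomology computation. Put d(x) = D x − ε(x) D on H_A ⊗ C(V), with ε
the parity of the Clifford factor. The elements ξ − T_ξ satisfy w (ξ − T_ξ) = (w(ξ) − T_{w(ξ)}) w,
because ξ and T_ξ have the same defect in the cross relation (`Hecke.refl_mul_T`). Hence ε(ρ(a)) D =
D ρ(a) for a in the pin cover, so d is right linear over ρ(A[W̃]) and kills ρ(A[W̃]).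

Write D = P − G with P = ∑ ξ_i ⊗ ξ^i and G in ρ(A[W̃]) (`dirac_eq`). Each term of G is odd, so D
anticommutes with G and D² = P² − G², where P² is central. On even invariants, and on odd elements
invariant up to the parity sign, D² therefore commutes with everything needed and d² = 0. Averaging
over the finite group W̃ projects onto these two spaces and intertwines d, so a primitive can always
be chosen invariant.

The cohomology is found by filtering H_A by degree in V. The PBW theorem, proved here through an
explicit representation on functions W → A ⊗ S(V), makes H_A ⊗ C(V) a free module with one copy of A
⊗ S(V) ⊗ C(V) for each w. In each copy the symbol of d is −2 times the Koszul differential, since G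
does not raise the degree. The Koszul complex is exact except for the scalars in bidegree zero
(`koszul_exact`, `koszul_exact_zero`). Descending on the degree, every even invariant cocycle is
ρ(c) + d(a) (`exists_eq_rho_add_diff`), and ρ(c) = d(a) with c central forces ρ(c) = 0
(`rho_eq_zero_of_eq_diff`).

For central z, the element z ⊗ 1 is even, invariant and commutes with D, hence is a cocycle; this
gives ζ(z) and its uniqueness modulo ker ρ. The kernel of ρ consists of elements fixed by the
central element −1 of W̃ (`negOne_mul_eq_of_rho_eq_zero`), so c is unique if −1 is required to act
on it by −1. Uniqueness makes this choice additive, A-linear and multiplicative, but it sends 1 to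
the idempotent (1 − z)/2, where z now denotes that element −1. On the other summand, which ρ kills,
any character of the centre may be used; the trivial character of H_A restores the unit. -/

namespace GradedHecke

/-! ### Weyl group combinatorics: simple reflections, positive roots, inversions -/

section Roots

variable {ι V V' : Type*} [AddCommGroup V] [Module ℝ V] [AddCommGroup V'] [Module ℝ V']
variable {P : RootPairing ι ℝ V V'}

theorem refl_mul_self (i : ι) : refl P i * refl P i = 1 :=
  Subtype.ext <| LinearEquiv.ext fun v => P.reflection_same i v

theorem refl_inv (i : ι) : (refl P i)⁻¹ = refl P i :=
  inv_eq_of_mul_eq_one_right (refl_mul_self i)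

theorem refl_reflectionPerm (i j : ι) :
    refl P (P.reflectionPerm i j) = refl P i * refl P j * refl P i :=
  Subtype.ext <| by
    change P.reflection _ = P.reflection i * P.reflection j * P.reflection i
    rw [P.reflection_reflectionPerm]

theorem refl_reflectionPerm_self (i : ι) : refl P (P.reflectionPerm i i) = refl P i := by
  rw [refl_reflectionPerm, refl_mul_self, one_mul]

theorem k_reflectionPerm (i j : ι) : k P (P.reflectionPerm i j) = k P j := by
  unfold k
  congr 1
  refine Quotient.sound ⟨refl P i, ?_⟩
  change P.reflection i (P.root (P.reflectionPerm i j)) = P.root j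
  simp

theorem pairing_reflection (i j : ι) (v : V) :
    P.toLinearMap (P.reflection i v) (P.coroot j) =
      P.toLinearMap v (P.coroot (P.reflectionPerm i j)) :=
  P.coroot'_reflection v

theorem pairing_reflectionPerm_self (i : ι) (v : V) :
    P.toLinearMap v (P.coroot (P.reflectionPerm i i)) = -P.toLinearMap v (P.coroot i) := by
  simp

theorem refl_apply (i : ι) (v : V) :
    (refl P i).1 v = v - P.toLinearMap v (P.coroot i) • P.root i :=
  P.reflection_apply i v

section Base

variable [Fintype ι] [P.IsCrystallographic] [P.IsReduced] (b : P.Base)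

theorem weyl_le_closure_simple :
    weyl P ≤ Subgroup.closure (P.reflection '' b.support) := by
  refine (Subgroup.closure_le _).2 ?_
  rintro _ ⟨i, rfl⟩
  refine b.induction_reflect i
    (p := fun i => P.reflection i ∈ Subgroup.closure (P.reflection '' b.support)) ?_ ?_ ?_
  · intro i hi
    rw [P.reflection_reflectionPerm]
    exact mul_mem (mul_mem hi hi) hi
  · intro i hi
    exact Subgroup.subset_closure ⟨i, hi, rfl⟩
  · intro i j hi hj
    have hj' := Subgroup.subset_closure (Set.mem_image_of_mem P.reflection hj)
    rw [P.reflection_reflectionPerm]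
    exact mul_mem (mul_mem hj' hi) hj'

/-- Induction on words in the simple reflections. -/
theorem weyl_induction {p : weyl P → Prop} (one : p 1)
    (step : ∀ i ∈ b.support, ∀ w, p w → p (refl P i * w)) (w : weyl P) : p w := by
  have key : ∀ g ∈ Subgroup.closure (P.reflection '' b.support),
      ∀ h : g ∈ weyl P, p ⟨g, h⟩ := by
    intro g hg
    have one' : ∀ h : (1 : V ≃ₗ[ℝ] V) ∈ weyl P, p ⟨1, h⟩ := fun _ => one
    have step' : ∀ i ∈ b.support, ∀ y : V ≃ₗ[ℝ] V, (∀ h : y ∈ weyl P, p ⟨y, h⟩) →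
        ∀ h : P.reflection i * y ∈ weyl P, p ⟨P.reflection i * y, h⟩ := by
      intro i hi y ih h
      have hy : y ∈ weyl P := by
        have := mul_mem (inv_mem (refl P i).2) h
        rwa [show (refl P i).1 = P.reflection i from rfl, inv_mul_cancel_left] at this
      exact step i hi ⟨y, hy⟩ (ih hy)
    induction hg using Subgroup.closure_induction_left with
    | one => exact one'
    | mul_left x hx y _ ih =>
      obtain ⟨i, hi, rfl⟩ := hx
      exact step' i hi y ih
    | inv_mul_cancel x hx y _ ih =>
      obtain ⟨i, hi, rfl⟩ := hx
      rw [P.reflection_inv]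
      exact step' i hi y ih
  exact key w.1 (weyl_le_closure_simple b w.2) w.2

theorem weyl_root (b : P.Base) (w : weyl P) (i : ι) : ∃ j, w.1 (P.root i) = P.root j := by
  refine weyl_induction b (p := fun w => ∃ j, w.1 (P.root i) = P.root j) ⟨i, rfl⟩ ?_ w
  rintro l - w ⟨j, hj⟩
  exact ⟨P.reflectionPerm l j, by
    rw [P.root_reflectionPerm, ← hj]
    rfl⟩

theorem finite_weyl (b : P.Base) [P.IsRootSystem] : Finite (weyl P) := by
  choose f hf using weyl_root (P := P) b
  refine Finite.of_injective f fun w u h => Subtype.ext <| LinearEquiv.toLinearMap_injective ?_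
  refine LinearMap.ext_on (s := Set.range P.root) RootPairing.IsRootSystem.span_root_eq_top ?_
  rintro _ ⟨i, rfl⟩
  change w.1 _ = u.1 _
  rw [hf, hf, h]

/-- The positive roots. -/
def posRoots : Finset ι := by
  classical
  exact Finset.univ.filter b.IsPos

theorem mem_posRoots {i : ι} : i ∈ posRoots b ↔ b.IsPos i := by
  simp [posRoots]

theorem isPos_reflectionPerm_self (i : ι) : b.IsPos (P.reflectionPerm i i) ↔ ¬ b.IsPos i :=
  RootPairing.Base.IsPos.neg_iff_not b i

/-- A simple reflection permutes the positive roots other than its own. -/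
theorem sum_posRoots_reflectionPerm {M : Type*} [AddCommGroup M] {α : ι} (hα : α ∈ b.support)
    (g : ι → M) :
    ∑ i ∈ posRoots b, g (P.reflectionPerm α i) =
      ∑ i ∈ posRoots b, g i + g (P.reflectionPerm α α) - g α := by
  classical
  have hmem : α ∈ posRoots b := (mem_posRoots b).2 (RootPairing.Base.isPos_of_mem_support hα)
  have hmaps : ∀ i ∈ (posRoots b).erase α, P.reflectionPerm α i ∈ (posRoots b).erase α := by
    intro i hi
    rw [Finset.mem_erase, mem_posRoots] at hi ⊢
    refine ⟨fun h => ?_, hi.2.reflectionPerm hα hi.1⟩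
    have hi' : i = P.reflectionPerm α α := by
      have := congrArg (P.reflectionPerm α) h
      rwa [P.reflectionPerm_self] at this
    have h2 := hi.2
    rw [hi', isPos_reflectionPerm_self] at h2
    exact h2 ((mem_posRoots b).1 hmem)
  have herase : ∑ i ∈ (posRoots b).erase α, g (P.reflectionPerm α i) =
      ∑ i ∈ (posRoots b).erase α, g i :=
    Finset.sum_nbij' (P.reflectionPerm α) (P.reflectionPerm α) hmaps hmaps
      (fun i _ => P.reflectionPerm_self α i) (fun i _ => P.reflectionPerm_self α i) fun _ _ => rfl
  rw [← Finset.add_sum_erase _ _ hmem, ← Finset.add_sum_erase _ g hmem, herase]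
  abel

/-- `w⁻¹` sends the root `i` to a negative root. -/
def Inverts (w : weyl P) (i : ι) : Prop := ∃ j, b.IsPos j ∧ w.1 (P.root j) = -P.root i

theorem not_inverts_one {i : ι} (hi : b.IsPos i) : ¬ Inverts b 1 i := by
  rintro ⟨j, hj, h⟩
  have : j = P.reflectionPerm i i := P.root.injective <| by
    rw [P.root_reflectionPerm, P.reflection_apply_self, ← h]
    rfl
  rw [this, isPos_reflectionPerm_self] at hj
  exact hj hi

theorem inverts_refl_mul (w : weyl P) (i j : ι) :
    Inverts b (refl P j * w) i ↔ Inverts b w (P.reflectionPerm j i) := by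
  refine exists_congr fun l => and_congr_right fun _ => ?_
  change P.reflection j (w.1 (P.root l)) = _ ↔ _
  rw [P.root_reflectionPerm]
  constructor
  · intro h
    rw [← P.reflection_same j (w.1 (P.root l)), h, map_neg]
  · intro h
    rw [h, map_neg, P.reflection_same]

theorem inverts_reflectionPerm_self (w : weyl P) (i : ι) :
    Inverts b w (P.reflectionPerm i i) ↔ ¬ Inverts b w i := by
  obtain ⟨l, hl⟩ := weyl_root b w⁻¹ i
  have hl' : w.1 (P.root l) = P.root i := by
    rw [← hl]
    exact w.1.apply_symm_apply _
  have h1 : Inverts b w (P.reflectionPerm i i) ↔ b.IsPos l := by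
    constructor
    · rintro ⟨j, hj, h⟩
      rw [P.root_reflectionPerm, P.reflection_apply_self, neg_neg, ← hl'] at h
      rwa [← P.root.injective (w.1.injective h)]
    · intro h
      refine ⟨l, h, ?_⟩
      rw [P.root_reflectionPerm, P.reflection_apply_self, neg_neg, hl']
  have h2 : Inverts b w i ↔ b.IsPos (P.reflectionPerm l l) := by
    constructor
    · rintro ⟨j, hj, h⟩
      have : j = P.reflectionPerm l l := P.root.injective <| w.1.injective <| by
        rw [h, P.root_reflectionPerm, P.reflection_apply_self, map_neg, hl']
      rwa [← this]
    · intro h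
      refine ⟨_, h, ?_⟩
      rw [P.root_reflectionPerm, P.reflection_apply_self, map_neg, hl']
  rw [h1, h2, isPos_reflectionPerm_self, not_not]

end Base
end Roots

/-! ### The graded Hecke algebra: cross relations, equivariance of ξ − T_ξ, trivial character -/

section HeckeBasic

variable {ι V V' : Type*} [AddCommGroup V] [Module ℝ V] [AddCommGroup V'] [Module ℝ V']
variable {P : RootPairing ι ℝ V V'} (b : P.Base)

variable (V) in
/-- The inclusion of `V` in `S(V_ℂ)`, as a linear map. -/
def vecₗ : V →ₗ[ℝ] Sym V :=
  (SymmetricAlgebra.ι ℂ (ℂ ⊗[ℝ] V)).restrictScalars ℝ ∘ₗ TensorProduct.mk ℝ ℂ V 1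

theorem vecₗ_apply (v : V) : vecₗ V v = vec v := rfl

theorem symAct_vec (w : V ≃ₗ[ℝ] V) (v : V) : symAct w (vec v) = vec (w v) := by
  simp [symAct, vec]

theorem Hecke.algebraMap_complex (c : ℂ) :
    algebraMap ℂ (Hecke b) c = algebraMap (ParamRing P) (Hecke b) (MvPolynomial.C c) := by
  rw [IsScalarTower.algebraMap_apply ℂ (ParamRing P) (Hecke b)]
  rfl

/-- The homomorphism from `S(V_ℂ)` to `H_A`. -/
def Hecke.ofSym : Sym V →ₐ[ℂ] Hecke b where
  toFun p := Hecke.mk b (genP p)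
  map_one' := by simpa using Hecke.mk_rel b (Rel.scalar 1)
  map_zero' := by simpa using Hecke.mk_rel b (Rel.scalar 0)
  map_add' p q := by rw [Hecke.mk_rel b (Rel.add p q), map_add]
  map_mul' p q := by rw [Hecke.mk_rel b (Rel.mul p q), map_mul]
  commutes' c := by
    rw [Hecke.mk_rel b (Rel.scalar c), AlgHom.commutes, Hecke.algebraMap_complex]

theorem Hecke.ofSym_apply (p : Sym V) : Hecke.ofSym b p = Hecke.mk b (genP p) := rfl

theorem Hecke.ofSym_vec (v : V) : Hecke.ofSym b (vec v) = Hecke.ofV b v := rfl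

/-- The inclusion of `V` in `H_A`, as a linear map. -/
def Hecke.ofVₗ : V →ₗ[ℝ] Hecke b :=
  ((Hecke.ofSym b).toLinearMap.restrictScalars ℝ) ∘ₗ vecₗ V

theorem Hecke.ofVₗ_apply (v : V) : Hecke.ofVₗ b v = Hecke.ofV b v := rfl

theorem Hecke.ofV_comm (v u : V) :
    Hecke.ofV b v * Hecke.ofV b u = Hecke.ofV b u * Hecke.ofV b v := by
  rw [← Hecke.ofSym_vec, ← Hecke.ofSym_vec, ← map_mul, mul_comm, map_mul]

/-- In degree one the quotient Δ_α(v) is the scalar (v, α^∨); this is the witness that turns the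
defining relation into its linear form. -/
theorem vec_mul_algebraMap_pairing (i : ι) (v : V) :
    vec (P.root i) * algebraMap ℂ (Sym V) (P.toLinearMap v (P.coroot i) : ℝ) =
      vec v - symAct (P.reflection i) (vec v) := by
  rw [symAct_vec, P.reflection_apply, ← vecₗ_apply, ← vecₗ_apply, ← vecₗ_apply, map_sub, map_smul,
    sub_sub_cancel, mul_comm, ← Algebra.smul_def]
  exact algebraMap_smul ℂ (P.toLinearMap v (P.coroot i)) (vecₗ V (P.root i))

theorem Hecke.refl_mul_ofV {i : ι} (hi : i ∈ b.support) (v : V) :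
    Hecke.ofW b (refl P i) * Hecke.ofV b v =
      Hecke.ofV b ((refl P i).1 v) * Hecke.ofW b (refl P i) +
        P.toLinearMap v (P.coroot i) • k P i • (1 : Hecke b) := by
  have h := Hecke.mk_rel b (Rel.cross i hi (vec v) _ (vec_mul_algebraMap_pairing i v))
  rw [map_add, map_mul, map_mul, map_smul, ← Hecke.ofSym_apply, ← Hecke.ofSym_apply,
    ← Hecke.ofSym_apply, AlgHom.commutes, symAct_vec] at h
  refine h.trans ?_
  congr 1
  rw [smul_comm, Algebra.smul_def ((P.toLinearMap v) (P.coroot i)), mul_one,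
    IsScalarTower.algebraMap_apply ℝ (ParamRing P) (Hecke b), Hecke.algebraMap_complex]
  rfl

section Finite

variable [Fintype ι]

theorem Hecke.T_eq (v : V) :
    Hecke.T b v = (1 / 2 : ℝ) • ∑ i ∈ posRoots b,
      P.toLinearMap v (P.coroot i) • k P i • Hecke.ofW b (refl P i) := by
  unfold Hecke.T posRoots
  rfl

/-- `T_ξ` as a linear function of `ξ`. -/
def Hecke.Tₗ : V →ₗ[ℝ] Hecke b :=
  (1 / 2 : ℝ) • ∑ i ∈ posRoots b,
    (P.toLinearMap.flip (P.coroot i)).smulRight (k P i • Hecke.ofW b (refl P i))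

theorem Hecke.Tₗ_apply (v : V) : Hecke.Tₗ b v = Hecke.T b v := by
  simp [Hecke.Tₗ, Hecke.T_eq]

/-- `ξ - T_ξ` as a linear function of `ξ`. -/
def Hecke.tildeₗ : V →ₗ[ℝ] Hecke b := Hecke.ofVₗ b - Hecke.Tₗ b

theorem Hecke.tildeₗ_apply (v : V) : Hecke.tildeₗ b v = Hecke.tilde b v := by
  simp [Hecke.tildeₗ, Hecke.tilde, Hecke.Tₗ_apply, Hecke.ofVₗ_apply]

variable [P.IsCrystallographic] [P.IsReduced]

/-- Conjugation by s_α permutes the positive roots other than α, while the α term changes sign. The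
defect is twice ½ (v, α^∨) k_α, exactly that of `Hecke.refl_mul_ofV`, so it cancels in v − T_v. -/
theorem Hecke.refl_mul_T {α : ι} (hα : α ∈ b.support) (v : V) :
    Hecke.ofW b (refl P α) * Hecke.T b v =
      Hecke.T b ((refl P α).1 v) * Hecke.ofW b (refl P α) +
        P.toLinearMap v (P.coroot α) • k P α • (1 : Hecke b) := by
  set g : ι → Hecke b := fun i =>
    P.toLinearMap ((refl P α).1 v) (P.coroot i) • k P i •
      (Hecke.ofW b (refl P i) * Hecke.ofW b (refl P α)) with hg
  have h1 : Hecke.ofW b (refl P α) * Hecke.T b v =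
      (1 / 2 : ℝ) • ∑ i ∈ posRoots b, g (P.reflectionPerm α i) := by
    rw [Hecke.T_eq, mul_smul_comm, Finset.mul_sum]
    congr 1
    refine Finset.sum_congr rfl fun i _ => ?_
    rw [hg, mul_smul_comm, mul_smul_comm]
    simp only
    rw [k_reflectionPerm, refl_reflectionPerm, ← map_mul, ← map_mul, mul_assoc, mul_assoc,
      refl_mul_self, mul_one,
      show (refl P α).1 v = P.reflection α v from rfl, pairing_reflection, P.reflectionPerm_self]
  have h2 : Hecke.T b ((refl P α).1 v) * Hecke.ofW b (refl P α) =
      (1 / 2 : ℝ) • ∑ i ∈ posRoots b, g i := by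
    rw [Hecke.T_eq, smul_mul_assoc, Finset.sum_mul]
    simp only [smul_mul_assoc, hg]
  have h3 : g α = -(P.toLinearMap v (P.coroot α) • k P α • (1 : Hecke b)) := by
    rw [hg]
    simp only
    rw [← map_mul, refl_mul_self, map_one, show (refl P α).1 v = P.reflection α v from rfl,
      pairing_reflection, pairing_reflectionPerm_self, neg_smul]
  have h4 : g (P.reflectionPerm α α) = P.toLinearMap v (P.coroot α) • k P α • (1 : Hecke b) := by
    rw [hg]
    simp only
    rw [refl_reflectionPerm_self, k_reflectionPerm, ← map_mul, refl_mul_self, map_one,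
      show (refl P α).1 v = P.reflection α v from rfl,
      pairing_reflection, P.reflectionPerm_self]
  rw [h1, h2, sum_posRoots_reflectionPerm b hα, h3, h4, sub_neg_eq_add, add_assoc, smul_add]
  congr 1
  rw [← two_smul ℝ, smul_smul]
  norm_num

/-- The elements `ξ - T_ξ` are permuted by `W` in the natural way. -/
theorem Hecke.ofW_mul_tilde (w : weyl P) (v : V) :
    Hecke.ofW b w * Hecke.tilde b v = Hecke.tilde b (w.1 v) * Hecke.ofW b w := by
  refine weyl_induction b (p := fun w => ∀ v, Hecke.ofW b w * Hecke.tilde b v =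
    Hecke.tilde b (w.1 v) * Hecke.ofW b w) ?_ ?_ w v
  · intro v
    rw [map_one, one_mul, mul_one]
    rfl
  · intro i hi w ih v
    rw [map_mul, mul_assoc, ih, ← mul_assoc, ← mul_assoc]
    congr 1
    change _ = Hecke.tilde b ((refl P i).1 (w.1 v)) * _
    unfold Hecke.tilde
    rw [mul_sub, sub_mul, Hecke.refl_mul_ofV b hi, Hecke.refl_mul_T b hi]
    abel

end Finite

/-- A subalgebra containing the generators is everything. -/
theorem Hecke.induction {p : Hecke b → Prop} (hA : ∀ a, p (algebraMap (ParamRing P) _ a))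
    (hS : ∀ q, p (Hecke.ofSym b q)) (hW : ∀ w, p (Hecke.ofW b w))
    (add : ∀ x y, p x → p y → p (x + y)) (mul : ∀ x y, p x → p y → p (x * y)) (x : Hecke b) :
    p x := by
  obtain ⟨y, rfl⟩ := RingQuot.mkAlgHom_surjective (ParamRing P) (Rel b) x
  change p (Hecke.mk b y)
  induction y using FreeAlgebra.induction with
  | grade0 a =>
    rw [AlgHom.commutes]
    exact hA a
  | grade1 x =>
    cases x with
    | inl q => exact hS q
    | inr w => exact hW w
  | mul x y hx hy =>
    rw [map_mul]
    exact mul _ _ hx hy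
  | add x y hx hy =>
    rw [map_add]
    exact add _ _ hx hy

/-- Invariant polynomials are central. -/
theorem Hecke.commute_ofSym [Fintype ι] [P.IsCrystallographic] [P.IsReduced] {p : Sym V}
    (hp : ∀ i ∈ b.support, symAct (P.reflection i) p = p) (x : Hecke b) :
    Commute (Hecke.ofSym b p) x := by
  refine Hecke.induction b (p := fun x => Commute (Hecke.ofSym b p) x) ?_ ?_ ?_ ?_ ?_ x
  · exact fun a => (Algebra.commutes a _).symm
  · intro q
    exact (Commute.all p q).map (Hecke.ofSym b)
  · intro w
    refine weyl_induction b (p := fun w => Commute (Hecke.ofSym b p) (Hecke.ofW b w)) ?_ ?_ w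
    · rw [map_one]
      exact Commute.one_right _
    · intro i hi w hw
      rw [map_mul]
      refine Commute.mul_right ?_ hw
      have h := Hecke.mk_rel b (Rel.cross i hi p 0 (by rw [hp i hi, mul_zero, sub_self]))
      rw [map_add, map_mul, map_mul, map_smul, ← Hecke.ofSym_apply, ← Hecke.ofSym_apply,
        ← Hecke.ofSym_apply, map_zero, smul_zero, add_zero, hp i hi] at h
      exact h.symm
  · exact fun x y hx hy => hx.add_right hy
  · exact fun x y hx hy => hx.mul_right hy

section TrivialCharacter

variable [P.IsRootSystem]

/-- The linear functional on `V` taking the value `k_α` at each simple root `α`. -/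
def trivialWeight : V →ₗ[ℝ] ParamRing P :=
  b.toWeightBasis.constr ℝ fun i => k P i.1

theorem trivialWeight_root {i : ι} (hi : i ∈ b.support) : trivialWeight b (P.root i) = k P i := by
  have h := b.toWeightBasis.constr_basis ℝ (fun i : b.support => k P i.1) ⟨i, hi⟩
  rwa [b.toWeightBasis_apply] at h

/-- The extension of `trivialWeight` to the symmetric algebra. -/
def trivialSym : Sym V →ₐ[ℂ] ParamRing P :=
  SymmetricAlgebra.lift ((trivialWeight b).liftBaseChange ℂ)

theorem trivialSym_root {i : ι} (hi : i ∈ b.support) : trivialSym b (vec (P.root i)) = k P i := by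
  simp [trivialSym, vec, trivialWeight_root b hi]

/-- The trivial character of `H_A`. -/
def trivialCharacter : Hecke b →ₐ[ParamRing P] ParamRing P :=
  RingQuot.liftAlgHom (ParamRing P) ⟨FreeAlgebra.lift (ParamRing P)
    (Sum.elim (fun p => trivialSym b p) fun _ => 1), by
      intro x y h
      induction h with
      | add p q => simp
      | mul p q => simp
      | scalar c => simp
      | one => simp
      | group w u => simp
      | cross i hi p q hq =>
        -- With s_α ↦ 1 and α ↦ k_α, the relation asks that p − s_α(p) and k_α q have the same
        -- image, which is the image of α q = p − s_α(p).
        have h := congrArg (trivialSym b) hq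
        rw [map_mul, trivialSym_root b hi, map_sub] at h
        simp [h]⟩

end TrivialCharacter

end HeckeBasic

/-- A linear map with commuting values extends to the symmetric algebra. -/
theorem exists_algHom_symmetricAlgebra {R M B : Type*} [CommRing R] [AddCommMonoid M] [Module R M]
    [Ring B] [Algebra R B] (f : M →ₗ[R] B) (hf : ∀ x y, f x * f y = f y * f x) :
    ∃ F : SymmetricAlgebra R M →ₐ[R] B, ∀ x, F (SymmetricAlgebra.ι R M x) = f x := by
  -- The target need not be commutative, so the universal property is applied to the subalgebra
  -- generated by the image of f.
  have hcomm : IsMulCommutative (Algebra.adjoin R (Set.range f)) :=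
    Algebra.isMulCommutative_adjoin R (by
      rintro _ ⟨x, rfl⟩ _ ⟨y, rfl⟩
      exact hf x y)
  let : CommRing (Algebra.adjoin R (Set.range f)) :=
    { (inferInstance : Ring (Algebra.adjoin R (Set.range f))) with mul_comm := hcomm.1.1 }
  let g : M →ₗ[R] Algebra.adjoin R (Set.range f) :=
    f.codRestrict (Subalgebra.toSubmodule (Algebra.adjoin R (Set.range f)))
      fun x => Algebra.subset_adjoin ⟨x, rfl⟩
  refine ⟨(Algebra.adjoin R (Set.range f)).val.comp (SymmetricAlgebra.lift g), fun x => ?_⟩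
  rw [AlgHom.comp_apply, SymmetricAlgebra.lift_ι_apply]
  rfl

/-! ### The polynomial model of A ⊗ S(V) and its degree filtration -/

section Poly

variable {ι κ V V' : Type*} [AddCommGroup V] [Module ℝ V] [AddCommGroup V'] [Module ℝ V']
variable (P : RootPairing ι ℝ V V') (e : Module.Basis κ ℝ V)

/-- The polynomial ring over `A` in the coordinates of a basis of `V`, a model of
`A ⊗ S(V_ℂ)`. -/
abbrev Poly (κ : Type*) : Type _ := MvPolynomial κ (ParamRing P)

/-- The linear form attached to a vector. -/
def lin : V →ₗ[ℝ] Poly P κ := e.constr ℝ MvPolynomial.X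

theorem lin_basis (i : κ) : lin P e (e i) = MvPolynomial.X i := e.constr_basis ℝ _ i

theorem lin_isHomogeneous (v : V) : (lin P e v).IsHomogeneous 1 := by
  unfold lin
  rw [e.constr_apply]
  refine MvPolynomial.IsHomogeneous.sum _ _ _ fun i _ => ?_
  change ((e.repr v i) • (MvPolynomial.X i : Poly P κ)).IsHomogeneous 1
  rw [← algebraMap_smul (ParamRing P), MvPolynomial.smul_eq_C_mul]
  exact (MvPolynomial.isHomogeneous_X _ i).C_mul _

/-- The action of `GL(V)` on polynomials. -/
def polyAct (w : V ≃ₗ[ℝ] V) : Poly P κ →ₐ[ParamRing P] Poly P κ :=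
  MvPolynomial.aeval fun i => lin P e (w (e i))

theorem polyAct_lin (w : V ≃ₗ[ℝ] V) (v : V) : polyAct P e w (lin P e v) = lin P e (w v) := by
  have : ((polyAct P e w).toLinearMap.restrictScalars ℝ) ∘ₗ lin P e = lin P e ∘ₗ w.toLinearMap := by
    refine e.ext fun i => ?_
    simp [lin_basis, polyAct]
  exact LinearMap.congr_fun this v

theorem polyAct_polyAct (w u : V ≃ₗ[ℝ] V) (p : Poly P κ) :
    polyAct P e w (polyAct P e u p) = polyAct P e (w * u) p := by
  have : (polyAct P e w).comp (polyAct P e u) = polyAct P e (w * u) := by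
    refine MvPolynomial.algHom_ext fun i => ?_
    rw [AlgHom.comp_apply, ← lin_basis P e, polyAct_lin, polyAct_lin, polyAct_lin]
    rfl
  exact AlgHom.congr_fun this p

theorem polyAct_one (p : Poly P κ) : polyAct P e 1 p = p := by
  have : polyAct P e 1 = AlgHom.id _ _ := by
    refine MvPolynomial.algHom_ext fun i => ?_
    rw [← lin_basis P e, polyAct_lin]
    rfl
  exact AlgHom.congr_fun this p

theorem homogeneousComponent_polyAct (w : V ≃ₗ[ℝ] V) (n : ℕ) (p : Poly P κ) :
    MvPolynomial.homogeneousComponent n (polyAct P e w p) =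
      polyAct P e w (MvPolynomial.homogeneousComponent n p) := by
  conv_lhs => rw [← MvPolynomial.sum_homogeneousComponent p, map_sum, map_sum]
  have hom : ∀ i, (polyAct P e w (MvPolynomial.homogeneousComponent i p)).IsHomogeneous i := by
    intro i
    have := (MvPolynomial.homogeneousComponent_isHomogeneous i p).aeval
      (fun i => lin P e (w (e i))) (n := 1) fun i => lin_isHomogeneous P e _
    rwa [one_mul] at this
  have hs : ∀ i, MvPolynomial.homogeneousComponent n
      (polyAct P e w (MvPolynomial.homogeneousComponent i p)) =
      if i = n then polyAct P e w (MvPolynomial.homogeneousComponent n p) else 0 := by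
    intro i
    rw [MvPolynomial.homogeneousComponent_of_mem (hom i)]
    split_ifs with h h' h'
    · rw [h]
    · exact absurd h.symm h'
    · exact absurd h'.symm h
    · rfl
  simp only [hs]
  rw [Finset.sum_ite_eq']
  split_ifs with h
  · rfl
  · rw [Finset.mem_range, not_lt, Nat.succ_le_iff] at h
    rw [MvPolynomial.homogeneousComponent_eq_zero _ _ h, map_zero]

/-- The polynomials of degree less than `n`. -/
def degLT (κ : Type*) (n : ℕ) : Submodule (ParamRing P) (Poly P κ) :=
  ⨅ m ≥ n, LinearMap.ker (MvPolynomial.homogeneousComponent m)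

theorem mem_degLT {n : ℕ} {p : Poly P κ} :
    p ∈ degLT P κ n ↔ ∀ m ≥ n, MvPolynomial.homogeneousComponent m p = 0 := by
  simp [degLT, Submodule.mem_iInf]

theorem degLT_mono {m n : ℕ} (h : m ≤ n) : degLT P κ m ≤ degLT P κ n := fun _ hp =>
  (mem_degLT P).2 fun l hl => (mem_degLT P).1 hp l (h.trans hl)

theorem eq_zero_of_mem_degLT_zero {p : Poly P κ} (hp : p ∈ degLT P κ 0) : p = 0 := by
  rw [← MvPolynomial.sum_homogeneousComponent p]
  exact Finset.sum_eq_zero fun i _ => (mem_degLT P).1 hp i i.zero_le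

theorem exists_mem_degLT (p : Poly P κ) : ∃ n, p ∈ degLT P κ n :=
  ⟨p.totalDegree + 1, (mem_degLT P).2 fun _ hm =>
    MvPolynomial.homogeneousComponent_eq_zero _ _ (Nat.lt_of_succ_le hm)⟩

theorem homogeneousComponent_mul_of_isHomogeneous_one {R : Type*} [CommRing R]
    {l : MvPolynomial κ R} (hl : l.IsHomogeneous 1) (n : ℕ) (p : MvPolynomial κ R) :
    MvPolynomial.homogeneousComponent (n + 1) (l * p) =
      l * MvPolynomial.homogeneousComponent n p := by
  conv_lhs => rw [← MvPolynomial.sum_homogeneousComponent p, Finset.mul_sum, map_sum]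
  have hs : ∀ i, MvPolynomial.homogeneousComponent (n + 1)
      (l * MvPolynomial.homogeneousComponent i p) =
      if i = n then l * MvPolynomial.homogeneousComponent n p else 0 := by
    intro i
    rw [MvPolynomial.homogeneousComponent_of_mem (n := 1 + i)
      (hl.mul (MvPolynomial.homogeneousComponent_isHomogeneous i p))]
    split_ifs with h h' h'
    · rw [h']
    · omega
    · omega
    · rfl
  simp only [hs]
  rw [Finset.sum_ite_eq']
  split_ifs with h
  · rfl
  · rw [Finset.mem_range, not_lt, Nat.succ_le_iff] at h
    rw [MvPolynomial.homogeneousComponent_eq_zero _ _ h, mul_zero]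

theorem lin_mul_mem_degLT (v : V) {n : ℕ} {p : Poly P κ} (hp : p ∈ degLT P κ n) :
    lin P e v * p ∈ degLT P κ (n + 1) := by
  rw [mem_degLT] at hp ⊢
  intro m hm
  obtain ⟨m, rfl⟩ : ∃ l, m = l + 1 := ⟨m - 1, by omega⟩
  rw [homogeneousComponent_mul_of_isHomogeneous_one (lin_isHomogeneous P e v),
    hp m (by omega), mul_zero]

theorem polyAct_mem_degLT_iff (w : V ≃ₗ[ℝ] V) {n : ℕ} {p : Poly P κ} :
    polyAct P e w p ∈ degLT P κ n ↔ p ∈ degLT P κ n := by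
  have h : ∀ (w : V ≃ₗ[ℝ] V) {p : Poly P κ}, p ∈ degLT P κ n → polyAct P e w p ∈ degLT P κ n := by
    intro w p hp
    rw [mem_degLT] at hp ⊢
    intro m hm
    rw [homogeneousComponent_polyAct, hp m hm, map_zero]
  refine ⟨fun hp => ?_, h w⟩
  have := h w⁻¹ hp
  rwa [polyAct_polyAct, inv_mul_cancel, polyAct_one] at this

end Poly

/-! ### An action of V and W on functions W → A ⊗ S(V) -/

section Representation

variable {ι κ V V' : Type*} [AddCommGroup V] [Module ℝ V] [AddCommGroup V'] [Module ℝ V']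
variable {P : RootPairing ι ℝ V V'} (b : P.Base) (e : Module.Basis κ ℝ V)

variable (P) in
/-- The space of functions on `W` with values in the polynomial ring. -/
abbrev FunRep (κ : Type*) : Type _ := weyl P → Poly P κ

variable (P) in
/-- The action of `W` on functions by left translation. -/
def transl (κ : Type*) : weyl P →* Module.End (ParamRing P) (FunRep P κ) where
  toFun u := LinearMap.funLeft (ParamRing P) (Poly P κ) fun w => u⁻¹ * w
  map_one' := by
    ext f w : 2
    simp [LinearMap.funLeft]
  map_mul' u u' := by
    ext f w : 2
    simp [LinearMap.funLeft, mul_assoc]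

theorem transl_apply (u : weyl P) (f : FunRep P κ) (w : weyl P) :
    transl P κ u f w = f (u⁻¹ * w) := rfl

variable [Fintype ι]

open Classical in
/-- The operator by which a vector acts on functions on `W`. -/
def actV : V →ₗ[ℝ] Module.End (ParamRing P) (FunRep P κ) where
  toFun v :=
    { toFun := fun f w => lin P e ((w⁻¹ : weyl P).1 v) * f w +
        ∑ i ∈ posRoots b, if Inverts b w i then
          P.toLinearMap v (P.coroot i) • k P i • f (refl P i * w) else 0
      map_add' := fun f g => by
        ext1 w
        simp only [Pi.add_apply, mul_add, smul_add]
        rw [add_add_add_comm, ← Finset.sum_add_distrib]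
        congr 1
        refine Finset.sum_congr rfl fun i _ => ?_
        split_ifs <;> simp
      map_smul' := fun a f => by
        ext1 w
        simp only [Pi.smul_apply, smul_add, RingHom.id_apply, Finset.smul_sum, mul_smul_comm]
        congr 1
        refine Finset.sum_congr rfl fun i _ => ?_
        split_ifs
        · rw [smul_comm (k P i) a, smul_comm _ a]
        · simp }
  map_add' v u := by
    refine LinearMap.ext fun f => funext fun w => ?_
    simp only [LinearMap.coe_mk, AddHom.coe_mk, LinearMap.add_apply, Pi.add_apply, map_add, add_mul]
    rw [add_add_add_comm, ← Finset.sum_add_distrib]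
    congr 1
    refine Finset.sum_congr rfl fun i _ => ?_
    split_ifs <;> simp [add_smul]
  map_smul' r v := by
    refine LinearMap.ext fun f => funext fun w => ?_
    simp only [LinearMap.coe_mk, AddHom.coe_mk, LinearMap.smul_apply, Pi.smul_apply, map_smul,
      smul_mul_assoc, smul_add, Finset.smul_sum, RingHom.id_apply]
    congr 1
    refine Finset.sum_congr rfl fun i _ => ?_
    split_ifs <;> simp [smul_smul]

open Classical in
theorem actV_apply (v : V) (f : FunRep P κ) (w : weyl P) :
    actV b e v f w = lin P e ((w⁻¹ : weyl P).1 v) * f w +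
        ∑ i ∈ posRoots b, if Inverts b w i then
          P.toLinearMap v (P.coroot i) • k P i • f (refl P i * w) else 0 := rfl

variable [P.IsCrystallographic] [P.IsReduced]

/-- No positive root is inverted by 1. The formula for `actV` is the one forced on the coinduced
module Hom_S(H_A, S), with f w in the role of the value at w⁻¹: its extra terms come from moving v
to the left past w⁻¹. -/
theorem actV_apply_one (v : V) (f : FunRep P κ) : actV b e v f 1 = lin P e v * f 1 := by
  rw [actV_apply, Finset.sum_eq_zero, add_zero]
  · rfl
  · intro i hi
    rw [if_neg (not_inverts_one b ((mem_posRoots b).1 hi))]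

/-- The cross relation for the operators. As for T_v, reindexing by s_α leaves only boundary terms
at ±α. -/
theorem refl_mul_actV {α : ι} (hα : α ∈ b.support) (v : V) :
    transl P κ (refl P α) * actV b e v = actV b e ((refl P α).1 v) * transl P κ (refl P α) +
      P.toLinearMap v (P.coroot α) • k P α • (1 : Module.End (ParamRing P) (FunRep P κ)) := by
  classical
  refine LinearMap.ext fun f => funext fun w => ?_
  simp only [Module.End.mul_apply, LinearMap.add_apply, LinearMap.smul_apply, Module.End.one_apply,
    Pi.add_apply, Pi.smul_apply, transl_apply, refl_inv, actV_apply]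
  set g : ι → Poly P κ := fun i => if Inverts b w i then
    P.toLinearMap ((refl P α).1 v) (P.coroot i) • k P i • f (refl P α * (refl P i * w)) else 0
    with hg
  have h1 : ∀ i, (if Inverts b (refl P α * w) i then
      P.toLinearMap v (P.coroot i) • k P i • f (refl P i * (refl P α * w)) else 0) =
      g (P.reflectionPerm α i) := by
    intro i
    rw [hg]
    simp only [inverts_refl_mul]
    rw [k_reflectionPerm, refl_reflectionPerm, show (refl P α).1 v = P.reflection α v from rfl,
      pairing_reflection, P.reflectionPerm_self]
    simp only [← mul_assoc, refl_mul_self, one_mul]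
  -- Exactly one of α and −α is inverted by w, so exactly one of the two terms survives, and either
  -- one contributes the same value with the same sign.
  have h2 : g (P.reflectionPerm α α) - g α = P.toLinearMap v (P.coroot α) • k P α • f w := by
    rw [hg]
    simp only [inverts_reflectionPerm_self, refl_reflectionPerm_self, k_reflectionPerm]
    rw [show (refl P α).1 v = P.reflection α v from rfl,
      pairing_reflection, pairing_reflection, P.reflectionPerm_self, pairing_reflectionPerm_self,
      ← mul_assoc, refl_mul_self, one_mul]
    split_ifs <;> simp
  simp only [h1]
  rw [sum_posRoots_reflectionPerm b hα, add_sub_assoc, h2, ← add_assoc]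
  congr 3

/-- At w = 1 both operators are multiplications. The cross relation transports the value at s_i w to
values at w of s_i(v) and s_i(u), with correction terms symmetric in v and u, so commutation spreads
along words in simple reflections. -/
theorem actV_comm (v u : V) : actV b e v * actV b e u = actV b e u * actV b e v := by
  have key : ∀ w : weyl P, ∀ v u : V, ∀ f : FunRep P κ,
      (actV b e v (actV b e u f)) w = (actV b e u (actV b e v f)) w := by
    intro w
    refine weyl_induction b (p := fun w => ∀ v u : V, ∀ f : FunRep P κ,
      (actV b e v (actV b e u f)) w = (actV b e u (actV b e v f)) w) ?_ ?_ w
    · intro v u f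
      simp only [actV_apply_one]
      ring
    · intro i hi w ih v u f
      have hswap : ∀ v u : V, actV b e v (actV b e u f) (refl P i * w) =
          actV b e ((refl P i).1 v) (actV b e ((refl P i).1 u) (transl P κ (refl P i) f)) w +
          (P.toLinearMap u (P.coroot i) • k P i • actV b e ((refl P i).1 v) f w +
          P.toLinearMap v (P.coroot i) • k P i • actV b e u f w) := by
        intro v u
        have h1 := congrFun (LinearMap.congr_fun (refl_mul_actV b e hi v) (actV b e u f)) w
        have h2 := LinearMap.congr_fun (refl_mul_actV b e hi u) f
        simp only [Module.End.mul_apply, LinearMap.add_apply, LinearMap.smul_apply,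
          Module.End.one_apply, Pi.add_apply, Pi.smul_apply] at h1 h2
        rw [transl_apply, refl_inv, h2, map_add] at h1
        rw [h1]
        simp only [Pi.add_apply, LinearMap.map_smul_of_tower, Pi.smul_apply, map_smul]
        abel
      rw [hswap v u, hswap u v, ih]
      refine congrArg₂ (· + ·) rfl ?_
      have hlin : ∀ v, actV b e ((refl P i).1 v) f w =
          actV b e v f w - P.toLinearMap v (P.coroot i) • actV b e (P.root i) f w := by
        intro v
        rw [refl_apply, map_sub, map_smul]
        rfl
      have halg : ∀ (r s : ℝ) (x y z : Poly P κ),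
          r • k P i • (x - s • z) + s • k P i • y = s • k P i • (y - r • z) + r • k P i • x := by
        intro r s x y z
        rw [smul_sub, smul_sub, smul_sub, smul_sub, smul_comm (k P i) s z, smul_comm (k P i) r z,
          smul_comm r s]
        abel
      rw [hlin, hlin]
      exact halg _ _ _ _ _
  exact LinearMap.ext fun f => funext fun w => key w v u f

end Representation

/-- A commuting family of elements defines a homomorphism from the polynomial ring. -/
theorem exists_algHom_mvPolynomial {R σ B : Type*} [CommRing R] [Ring B] [Algebra R B]
    (f : σ → B) (hf : ∀ i j, f i * f j = f j * f i) :
    ∃ F : MvPolynomial σ R →ₐ[R] B, ∀ i, F (MvPolynomial.X i) = f i := by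
  have hcomm : ∀ x y : σ →₀ R, Finsupp.linearCombination R f x * Finsupp.linearCombination R f y =
      Finsupp.linearCombination R f y * Finsupp.linearCombination R f x := by
    intro x y
    induction x using Finsupp.induction_linear with
    | zero => simp
    | add x x' hx hx' => rw [map_add, add_mul, mul_add, hx, hx']
    | single i r =>
      induction y using Finsupp.induction_linear with
      | zero => simp
      | add y y' hy hy' => rw [map_add, add_mul, mul_add, hy, hy']
      | single j s => simp [hf i j, smul_comm r s]
  obtain ⟨F, hF⟩ := exists_algHom_symmetricAlgebra (Finsupp.linearCombination R f) hcomm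
  refine ⟨F.comp (SymmetricAlgebra.equivMvPolynomial
    (Finsupp.basisSingleOne (R := R) (ι := σ))).symm.toAlgHom, fun i => ?_⟩
  change F ((SymmetricAlgebra.equivMvPolynomial _).symm (MvPolynomial.X i)) = f i
  rw [SymmetricAlgebra.equivMvPolynomial_symm_X, hF]
  simp

section Degree

variable {ι κ V V' : Type*} [AddCommGroup V] [Module ℝ V] [AddCommGroup V'] [Module ℝ V']
variable (P : RootPairing ι ℝ V V')

/-- Induction for polynomials of bounded degree. -/
theorem degLT_induction {motive : ℕ → Poly P κ → Prop}
    (const : ∀ a, motive 0 (MvPolynomial.C a))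
    (X_mul : ∀ n i p, motive n p → motive (n + 1) (MvPolynomial.X i * p))
    (mono : ∀ n p, motive n p → motive (n + 1) p)
    (add : ∀ n p q, motive n p → motive n q → motive n (p + q))
    {n : ℕ} {p : Poly P κ} (hp : p ∈ degLT P κ (n + 1)) : motive n p := by
  have hmono : ∀ {m n : ℕ}, m ≤ n → ∀ p, motive m p → motive n p := by
    intro m n h p hp
    induction h with
    | refl => exact hp
    | step _ ih => exact mono _ _ ih
  have hmon : ∀ n (s : κ →₀ ℕ) (a : ParamRing P), s.degree = n →
      motive n (MvPolynomial.monomial s a) := by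
    intro n
    induction n with
    | zero =>
      intro s a hs
      rw [(Finsupp.degree_eq_zero_iff s).1 hs]
      exact const a
    | succ n ih =>
      intro s a hs
      have hne : s ≠ 0 := by
        rintro rfl
        simp at hs
      obtain ⟨i, hi⟩ := Finsupp.support_nonempty_iff.2 hne
      have hle : Finsupp.single i 1 ≤ s := by
        rw [Finsupp.single_le_iff]
        exact Nat.one_le_iff_ne_zero.2 (Finsupp.mem_support_iff.1 hi)
      have hs' : s = Finsupp.single i 1 + (s - Finsupp.single i 1) :=
        (add_tsub_cancel_of_le hle).symm
      have hd : (s - Finsupp.single i 1).degree = n := by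
        have := congrArg Finsupp.degree hs'
        rw [map_add, hs, Finsupp.degree_single] at this
        omega
      have : MvPolynomial.monomial s a =
          MvPolynomial.X i * MvPolynomial.monomial (s - Finsupp.single i 1) a := by
        rw [MvPolynomial.X, MvPolynomial.monomial_mul, one_mul, ← hs']
      rw [this]
      exact X_mul n i _ (ih _ a hd)
  rw [p.as_sum]
  refine Finset.sum_induction _ (motive n) (add n) (hmono n.zero_le 0 ?_) ?_
  · simpa using const 0
  · intro s hs
    refine hmono ?_ _ (hmon s.degree s _ rfl)
    by_contra hlt
    have h0 := (mem_degLT P).1 hp s.degree (by omega)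
    have := congrArg (MvPolynomial.coeff s) h0
    rw [MvPolynomial.coeff_homogeneousComponent, if_pos rfl, MvPolynomial.coeff_zero] at this
    exact MvPolynomial.mem_support_iff.1 hs this

end Degree

/-! ### The representation of H_A and the linear independence half of PBW -/

section Representation

variable {ι κ V V' : Type*} [AddCommGroup V] [Module ℝ V] [AddCommGroup V'] [Module ℝ V']
variable {P : RootPairing ι ℝ V V'} (b : P.Base) (e : Module.Basis κ ℝ V)
variable [Fintype ι] [P.IsCrystallographic] [P.IsReduced]

theorem exists_symRep : ∃ F : Sym V →ₐ[ℂ] Module.End (ParamRing P) (FunRep P κ),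
    ∀ v, F (vec v) = actV b e v := by
  have hcomm : ∀ x y : ℂ ⊗[ℝ] V,
      (actV b e).liftBaseChange ℂ x * (actV b e).liftBaseChange ℂ y =
      (actV b e).liftBaseChange ℂ y * (actV b e).liftBaseChange ℂ x := by
    intro x y
    induction x using TensorProduct.induction_on with
    | zero => simp
    | add x x' hx hx' => rw [map_add, add_mul, mul_add, hx, hx']
    | tmul c v =>
      induction y using TensorProduct.induction_on with
      | zero => simp
      | add y y' hy hy' => rw [map_add, add_mul, mul_add, hy, hy']
      | tmul d u =>
        rw [LinearMap.liftBaseChange_tmul, LinearMap.liftBaseChange_tmul, smul_mul_smul_comm,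
          smul_mul_smul_comm, mul_comm c, actV_comm]
  let f : ℂ ⊗[ℝ] V →ₗ[ℂ] Module.End (ParamRing P) (FunRep P κ) := (actV b e).liftBaseChange ℂ
  obtain ⟨F, hF⟩ := exists_algHom_symmetricAlgebra (R := ℂ) (M := ℂ ⊗[ℝ] V)
    (B := Module.End (ParamRing P) (FunRep P κ)) f hcomm
  refine ⟨F, fun v => (hF _).trans ?_⟩
  rw [LinearMap.liftBaseChange_tmul, one_smul]

/-- The action of `S(V_ℂ)` on functions on `W`. -/
def symRep : Sym V →ₐ[ℂ] Module.End (ParamRing P) (FunRep P κ) := (exists_symRep b e).choose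

theorem symRep_vec (v : V) : symRep b e (vec v) = actV b e v := (exists_symRep b e).choose_spec v

theorem ι_tmul_eq_smul_vec (c : ℂ) (v : V) :
    SymmetricAlgebra.ι ℂ (ℂ ⊗[ℝ] V) (c ⊗ₜ v) = c • vec v := by
  rw [vec, ← map_smul, TensorProduct.smul_tmul', smul_eq_mul, mul_one]

/-- Divided differences obey the twisted Leibniz rule Δ(pp') = Δ(p) p' + s_α(p) Δ(p'), so the
relation passes from degree one to products. The quotient q is produced along the same induction. -/
theorem exists_symRep_cross {α : ι} (hα : α ∈ b.support) (p : Sym V) :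
    ∃ q, vec (P.root α) * q = p - symAct (P.reflection α) p ∧
      transl P κ (refl P α) * symRep b e p =
        symRep b e (symAct (P.reflection α) p) * transl P κ (refl P α) +
          k P α • symRep b e q := by
  have hadd : ∀ p p' : Sym V, (∃ q, vec (P.root α) * q = p - symAct (P.reflection α) p ∧
      transl P κ (refl P α) * symRep b e p =
        symRep b e (symAct (P.reflection α) p) * transl P κ (refl P α) +
          k P α • symRep b e q) → (∃ q, vec (P.root α) * q = p' - symAct (P.reflection α) p' ∧
      transl P κ (refl P α) * symRep b e p' =
        symRep b e (symAct (P.reflection α) p') * transl P κ (refl P α) +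
          k P α • symRep b e q) →
        ∃ q, vec (P.root α) * q = p + p' - symAct (P.reflection α) (p + p') ∧
      transl P κ (refl P α) * symRep b e (p + p') =
        symRep b e (symAct (P.reflection α) (p + p')) * transl P κ (refl P α) +
          k P α • symRep b e q := by
    rintro p p' ⟨q, hq, h⟩ ⟨q', hq', h'⟩
    refine ⟨q + q', ?_, ?_⟩
    · rw [mul_add, hq, hq', map_add]
      ring
    · rw [map_add, mul_add, h, h', map_add, map_add, map_add, add_mul, smul_add]
      abel
  have hscalar : ∀ c : ℂ, algebraMap ℂ (Module.End (ParamRing P) (FunRep P κ)) c =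
      c • (1 : Module.End (ParamRing P) (FunRep P κ)) := fun c => Algebra.algebraMap_eq_smul_one c
  induction p using SymmetricAlgebra.induction with
  | algebraMap c =>
    refine ⟨0, by simp, ?_⟩
    rw [AlgHom.commutes, AlgHom.commutes, AlgHom.commutes, map_zero, smul_zero, add_zero]
    exact (Algebra.commutes c _).symm
  | ι x =>
    induction x using TensorProduct.induction_on with
    | zero => exact ⟨0, by simp, by simp⟩
    | add x y hx hy =>
      rw [map_add]
      exact hadd _ _ hx hy
    | tmul c v =>
      rw [ι_tmul_eq_smul_vec]
      refine ⟨c • algebraMap ℂ (Sym V) (P.toLinearMap v (P.coroot α) : ℝ), ?_, ?_⟩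
      · rw [mul_smul_comm, vec_mul_algebraMap_pairing, map_smul, smul_sub]
      · rw [map_smul, map_smul, map_smul, map_smul, symAct_vec, symRep_vec, symRep_vec,
          mul_smul_comm, refl_mul_actV b e hα, smul_add, smul_mul_assoc, AlgHom.commutes, hscalar]
        congr 1
        rw [smul_comm (k P α) c, smul_comm (k P α)]
        congr 1
  | mul p p' hp hp' =>
    obtain ⟨q, hq, h⟩ := hp
    obtain ⟨q', hq', h'⟩ := hp'
    refine ⟨q * p' + symAct (P.reflection α) p * q', ?_, ?_⟩
    · rw [mul_add, ← mul_assoc, hq, mul_left_comm, hq', map_mul]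
      ring
    · rw [map_mul, ← mul_assoc, h, add_mul, mul_assoc, h', map_mul, map_mul, map_add, map_mul,
        map_mul, mul_add, smul_mul_assoc, mul_smul_comm, smul_add, mul_assoc]
      abel
  | add p p' hp hp' => exact hadd _ _ hp hp'

/-- The symmetric algebra is a domain and α ≠ 0 in it, because α^∨ takes the value 2 on α; hence q
is determined by α q = p − s_α(p) and is the one constructed above. -/
theorem symRep_cross {α : ι} (hα : α ∈ b.support) (p q : Sym V)
    (hq : vec (P.root α) * q = p - symAct (P.reflection α) p) :
    transl P κ (refl P α) * symRep b e p =
      symRep b e (symAct (P.reflection α) p) * transl P κ (refl P α) + k P α • symRep b e q := by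
  obtain ⟨q', hq', h⟩ := exists_symRep_cross b e hα p
  have hne : vec (P.root α) ≠ 0 := by
    intro h0
    let f : V →ₗ[ℝ] ℂ := (Algebra.linearMap ℝ ℂ) ∘ₗ P.toLinearMap.flip (P.coroot α)
    have h1 := congrArg (SymmetricAlgebra.lift (f.liftBaseChange ℂ)) h0
    simp [vec, f] at h1
  have : q = q' := mul_left_cancel₀ hne (hq.trans hq'.symm)
  rw [this, h]

/-- The representation of `H_A` on functions on `W`. -/
def heckeRep : Hecke b →ₐ[ParamRing P] Module.End (ParamRing P) (FunRep P κ) :=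
  RingQuot.liftAlgHom (ParamRing P) ⟨FreeAlgebra.lift (ParamRing P)
    (Sum.elim (fun p => symRep b e p) fun w => transl P κ w), by
      intro x y h
      induction h with
      | add p q => simp
      | mul p q => simp
      | scalar c =>
        simp only [FreeAlgebra.lift_ι_apply, Sum.elim_inl, AlgHom.commutes]
        refine LinearMap.ext fun f => funext fun w => ?_
        exact (algebraMap_smul (ParamRing P) c (f w)).symm
      | one => simp
      | group w u => simp
      | cross i hi p q hq =>
        simp only [map_mul, map_add, map_smul, FreeAlgebra.lift_ι_apply, Sum.elim_inl, Sum.elim_inr]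
        exact symRep_cross b e hi p q hq⟩

theorem heckeRep_mk (x : FreeAlgebra (ParamRing P) (Sym V ⊕ weyl P)) :
    heckeRep b e (Hecke.mk b x) = FreeAlgebra.lift (ParamRing P)
      (Sum.elim (fun p => symRep b e p) fun w => transl P κ w) x :=
  RingQuot.liftAlgHom_mkAlgHom_apply _ _ _ _

theorem heckeRep_ofV (v : V) : heckeRep b e (Hecke.ofV b v) = actV b e v := by
  rw [Hecke.ofV, heckeRep_mk, FreeAlgebra.lift_ι_apply, Sum.elim_inl, symRep_vec]

theorem heckeRep_ofW (w : weyl P) : heckeRep b e (Hecke.ofW b w) = transl P κ w :=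
  (heckeRep_mk b e _).trans (FreeAlgebra.lift_ι_apply _ _)

theorem exists_ofPoly : ∃ F : Poly P κ →ₐ[ParamRing P] Hecke b,
    ∀ i, F (MvPolynomial.X i) = Hecke.ofV b (e i) :=
  exists_algHom_mvPolynomial _ fun _ _ => Hecke.ofV_comm b _ _

/-- The homomorphism from the polynomial ring to `H_A`. -/
def ofPoly : Poly P κ →ₐ[ParamRing P] Hecke b := (exists_ofPoly b e).choose

theorem ofPoly_X (i : κ) : ofPoly b e (MvPolynomial.X i) = Hecke.ofV b (e i) :=
  (exists_ofPoly b e).choose_spec i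

theorem ofPoly_lin (v : V) : ofPoly b e (lin P e v) = Hecke.ofV b v := by
  have : ((ofPoly b e).toLinearMap.restrictScalars ℝ) ∘ₗ lin P e = Hecke.ofVₗ b := by
    refine e.ext fun i => ?_
    simp [lin_basis, ofPoly_X, Hecke.ofVₗ_apply]
  exact LinearMap.congr_fun this v

/-- In `actV` only the multiplication by w⁻¹(v) raises the degree. So on functions with constant
values a polynomial p of degree at most n acts at w as multiplication by w⁻¹(p), up to degree less
than n. -/
theorem heckeRep_ofPoly_sub_mem {f : FunRep P κ} (hf : ∀ w, f w ∈ degLT P κ 1) {n : ℕ}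
    {p : Poly P κ} (hp : p ∈ degLT P κ (n + 1)) (w : weyl P) :
    heckeRep b e (ofPoly b e p) f w - polyAct P e (w⁻¹ : weyl P).1 p * f w ∈ degLT P κ n := by
  classical
  suffices H : ∀ w : weyl P,
      heckeRep b e (ofPoly b e p) f w - polyAct P e (w⁻¹ : weyl P).1 p * f w ∈ degLT P κ n ∧
      polyAct P e (w⁻¹ : weyl P).1 p * f w ∈ degLT P κ (n + 1) from (H w).1
  refine degLT_induction P (motive := fun n p => ∀ w : weyl P,
      heckeRep b e (ofPoly b e p) f w - polyAct P e (w⁻¹ : weyl P).1 p * f w ∈ degLT P κ n ∧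
      polyAct P e (w⁻¹ : weyl P).1 p * f w ∈ degLT P κ (n + 1)) ?_ ?_ ?_ ?_ hp
  · intro a w
    have hC : (MvPolynomial.C a : Poly P κ) = algebraMap (ParamRing P) _ a := rfl
    rw [hC, AlgHom.commutes, AlgHom.commutes, AlgHom.commutes, Module.algebraMap_end_apply,
      Pi.smul_apply, ← Algebra.smul_def, sub_self]
    exact ⟨zero_mem _, Submodule.smul_mem _ _ (hf w)⟩
  · intro n i p ih w
    have hw := ih w
    have hX : polyAct P e (w⁻¹ : weyl P).1 (MvPolynomial.X i) =
        lin P e ((w⁻¹ : weyl P).1 (e i)) := by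
      rw [← lin_basis P e, polyAct_lin]
    have hall : ∀ u, heckeRep b e (ofPoly b e p) f u ∈ degLT P κ (n + 1) := by
      intro u
      have := add_mem (degLT_mono P n.le_succ (ih u).1) (ih u).2
      rwa [sub_add_cancel] at this
    rw [map_mul, map_mul, map_mul, hX, ofPoly_X, heckeRep_ofV, Module.End.mul_apply, actV_apply,
      mul_assoc]
    refine ⟨?_, lin_mul_mem_degLT P e _ hw.2⟩
    rw [add_sub_right_comm, ← mul_sub]
    refine add_mem (lin_mul_mem_degLT P e _ hw.1) (Submodule.sum_mem _ fun j _ => ?_)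
    split_ifs
    · rw [← algebraMap_smul (ParamRing P)]
      exact Submodule.smul_mem _ _ (Submodule.smul_mem _ _ (hall _))
    · exact zero_mem _
  · intro n p ih w
    exact ⟨degLT_mono P n.le_succ (ih w).1, degLT_mono P (n + 1).le_succ (ih w).2⟩
  · intro n p q hp hq w
    have h1 := add_mem (hp w).1 (hq w).1
    have h2 := add_mem (hp w).2 (hq w).2
    simp only [map_add, LinearMap.add_apply, Pi.add_apply, add_mul]
    rw [add_sub_add_comm]
    exact ⟨h1, h2⟩

variable [Fintype (weyl P)]

/-- The map `∑ w, p_w w` from families of polynomials to `H_A`. -/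
def pbw : (weyl P → Poly P κ) →ₗ[ParamRing P] Hecke b :=
  ∑ w, (LinearMap.mulRight (ParamRing P) (Hecke.ofW b w)) ∘ₗ (ofPoly b e).toLinearMap ∘ₗ
    LinearMap.proj w

theorem pbw_apply (p : weyl P → Poly P κ) :
    pbw b e p = ∑ w, ofPoly b e (p w) * Hecke.ofW b w := by
  simp [pbw]

theorem pbw_single [DecidableEq (weyl P)] (w : weyl P) (p : Poly P κ) :
    pbw b e (Pi.single w p) = ofPoly b e p * Hecke.ofW b w := by
  rw [pbw_apply, Finset.sum_eq_single w]
  · simp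
  · intro u _ hu
    simp [Pi.single_eq_of_ne hu]
  · simp

theorem transl_single [DecidableEq (weyl P)] (w : weyl P) (p : Poly P κ) :
    transl P κ w (Pi.single 1 p) = Pi.single w p := by
  funext u
  rw [transl_apply]
  by_cases h : u = w
  · subst h
    simp
  · rw [Pi.single_eq_of_ne h, Pi.single_eq_of_ne]
    intro h'
    exact h (inv_mul_eq_one.1 h').symm

/-- Applied to the delta function at 1, ∑ p_w w gives ∑ p_w δ_w, whose value at v has leading part
v⁻¹(p_v). If the element vanishes, a common degree bound on all the p_w can be lowered by one, down
to zero. -/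
theorem pbw_injective : Function.Injective (pbw b e) := by
  classical
  rw [← LinearMap.ker_eq_bot, LinearMap.ker_eq_bot']
  intro p hp
  have hone : (1 : Poly P κ) ∈ degLT P κ 1 := (mem_degLT P).2 fun m hm => by
    rw [MvPolynomial.homogeneousComponent_of_mem (MvPolynomial.isHomogeneous_one _ _),
      if_neg (by omega)]
  have hrep : ∀ v, ∑ w, heckeRep b e (ofPoly b e (p w)) (Pi.single w 1) v = 0 := by
    intro v
    have h := congrFun (congrArg (fun x => heckeRep b e x (Pi.single 1 1)) hp) v
    simpa [pbw_apply, heckeRep_ofW, transl_single] using h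
  have hstep : ∀ n, (∀ w, p w ∈ degLT P κ n) → p = 0 := by
    intro n
    induction n with
    | zero => exact fun h => funext fun w => eq_zero_of_mem_degLT_zero P (h w)
    | succ n ih =>
      intro h
      refine ih fun v => ?_
      have h1 : ∑ w, (heckeRep b e (ofPoly b e (p w)) (Pi.single w 1) v -
          polyAct P e (v⁻¹ : weyl P).1 (p w) * (Pi.single w 1 : FunRep P κ) v) ∈ degLT P κ n := by
        refine Submodule.sum_mem _ fun w _ => heckeRep_ofPoly_sub_mem b e ?_ (h w) v
        intro u
        by_cases hu : u = w
        · subst hu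
          simpa using hone
        · rw [Pi.single_eq_of_ne hu]
          exact zero_mem _
      rw [Finset.sum_sub_distrib, hrep, zero_sub, Finset.sum_eq_single v, Pi.single_eq_same,
        mul_one, Submodule.neg_mem_iff, polyAct_mem_degLT_iff] at h1
      · exact h1
      · intro w _ hw
        rw [Pi.single_eq_of_ne hw.symm, mul_zero]
      · simp
  choose N hN using fun w => exists_mem_degLT P (p w)
  exact hstep (∑ w, N w) fun w =>
    degLT_mono P (Finset.single_le_sum (fun _ _ => Nat.zero_le _) (Finset.mem_univ w)) (hN w)

end Representation

/-! ### The degree filtration of H_A and the PBW isomorphism -/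

section Filtration

variable {ι κ V V' : Type*} [AddCommGroup V] [Module ℝ V] [AddCommGroup V'] [Module ℝ V']
variable {P : RootPairing ι ℝ V V'} (b : P.Base) (e : Module.Basis κ ℝ V)

/-- The span of `1` and `V` in `H_A`. -/
def affineSpan : Submodule (ParamRing P) (Hecke b) :=
  Submodule.span _ (insert 1 (Set.range (Hecke.ofV b)))

/-- The image of the group algebra of `W` in `H_A`. -/
def groupSpan : Submodule (ParamRing P) (Hecke b) :=
  Submodule.span _ (Set.range (Hecke.ofW b))

/-- The filtration of `H_A` by the degree in `V`. -/
def filt (n : ℕ) : Submodule (ParamRing P) (Hecke b) := affineSpan b ^ n * groupSpan b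

theorem one_le_affineSpan : 1 ≤ affineSpan b := by
  rw [Submodule.one_le]
  exact Submodule.subset_span (Set.mem_insert _ _)

theorem ofV_mem_affineSpan (v : V) : Hecke.ofV b v ∈ affineSpan b :=
  Submodule.subset_span (Set.mem_insert_of_mem _ ⟨v, rfl⟩)

theorem ofW_mem_groupSpan (w : weyl P) : Hecke.ofW b w ∈ groupSpan b :=
  Submodule.subset_span ⟨w, rfl⟩

theorem one_mem_groupSpan : 1 ∈ groupSpan b := by
  simpa using ofW_mem_groupSpan b 1

theorem groupSpan_mul_groupSpan : groupSpan b * groupSpan b ≤ groupSpan b := by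
  unfold groupSpan
  rw [Submodule.span_mul_span, Submodule.span_le]
  rintro _ ⟨_, ⟨w, rfl⟩, _, ⟨u, rfl⟩, rfl⟩
  simp only [← map_mul]
  exact ofW_mem_groupSpan b _

theorem filt_mono {m n : ℕ} (h : m ≤ n) : filt b m ≤ filt b n :=
  mul_le_mul' (pow_right_mono₀ (one_le_affineSpan b) h) le_rfl

theorem groupSpan_le_filt (n : ℕ) : groupSpan b ≤ filt b n := by
  refine le_trans ?_ (filt_mono b n.zero_le)
  rw [filt, pow_zero, one_mul]

theorem filt_mul_groupSpan (n : ℕ) : filt b n * groupSpan b ≤ filt b n := by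
  rw [filt, mul_assoc]
  exact mul_le_mul' le_rfl (groupSpan_mul_groupSpan b)

theorem ofV_mul_mem_filt (v : V) {n : ℕ} {x : Hecke b} (hx : x ∈ filt b n) :
    Hecke.ofV b v * x ∈ filt b (n + 1) := by
  rw [filt, pow_succ', mul_assoc]
  exact Submodule.mul_mem_mul (ofV_mem_affineSpan b v) hx

theorem mul_ofW_mem_filt (w : weyl P) {n : ℕ} {x : Hecke b} (hx : x ∈ filt b n) :
    x * Hecke.ofW b w ∈ filt b n :=
  filt_mul_groupSpan b n (Submodule.mul_mem_mul hx (ofW_mem_groupSpan b w))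

variable [Fintype ι]

theorem T_mem_groupSpan (v : V) : Hecke.T b v ∈ groupSpan b := by
  rw [Hecke.T_eq, ← algebraMap_smul (ParamRing P)]
  refine Submodule.smul_mem _ _ (Submodule.sum_mem _ fun i _ => ?_)
  rw [← algebraMap_smul (ParamRing P)]
  exact Submodule.smul_mem _ _ (Submodule.smul_mem _ _ (ofW_mem_groupSpan b _))

variable [P.IsCrystallographic] [P.IsReduced]

theorem ofPoly_mem_affineSpan_pow {n : ℕ} {p : Poly P κ} (hp : p ∈ degLT P κ (n + 1)) :
    ofPoly b e p ∈ affineSpan b ^ n := by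
  refine degLT_induction P (motive := fun n p => ofPoly b e p ∈ affineSpan b ^ n) ?_ ?_ ?_ ?_ hp
  · intro a
    change ofPoly b e (algebraMap (ParamRing P) _ a) ∈ _
    rw [AlgHom.commutes, pow_zero]
    exact Submodule.algebraMap_mem a
  · intro n i p hp
    rw [map_mul, ofPoly_X, pow_succ']
    exact Submodule.mul_mem_mul (ofV_mem_affineSpan b _) hp
  · intro n p hp
    exact pow_right_mono₀ (one_le_affineSpan b) n.le_succ hp
  · intro n p q hp hq
    rw [map_add]
    exact add_mem hp hq

theorem ofPoly_mul_ofW_mem_filt {n : ℕ} {p : Poly P κ} (hp : p ∈ degLT P κ (n + 1))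
    (w : weyl P) : ofPoly b e p * Hecke.ofW b w ∈ filt b n :=
  Submodule.mul_mem_mul (ofPoly_mem_affineSpan_pow b e hp) (ofW_mem_groupSpan b w)

/-- Equivariance of v − T_v gives w v = w(v) w modulo the image of A[W] for every w at once. This is
what makes the filtration multiplicative. -/
theorem groupSpan_mul_affineSpan : groupSpan b * affineSpan b ≤ affineSpan b * groupSpan b := by
  have hW : groupSpan b ≤ affineSpan b * groupSpan b := by
    have := groupSpan_le_filt b 1
    rwa [filt, pow_one] at this
  conv_lhs => unfold groupSpan affineSpan
  rw [Submodule.span_mul_span, Submodule.span_le]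
  rintro _ ⟨_, ⟨w, rfl⟩, x, hx, rfl⟩
  rcases hx with rfl | ⟨v, rfl⟩
  · simp only [mul_one]
    exact hW (ofW_mem_groupSpan b w)
  · have h := Hecke.ofW_mul_tilde b w v
    unfold Hecke.tilde at h
    rw [mul_sub, sub_mul, sub_eq_iff_eq_add] at h
    change Hecke.ofW b w * Hecke.ofV b v ∈ _
    rw [h]
    refine add_mem (sub_mem ?_ (hW ?_)) (hW ?_)
    · exact Submodule.mul_mem_mul (ofV_mem_affineSpan b _) (ofW_mem_groupSpan b w)
    · exact groupSpan_mul_groupSpan b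
        (Submodule.mul_mem_mul (T_mem_groupSpan b _) (ofW_mem_groupSpan b w))
    · exact groupSpan_mul_groupSpan b
        (Submodule.mul_mem_mul (ofW_mem_groupSpan b w) (T_mem_groupSpan b _))

theorem groupSpan_mul_affineSpan_pow (n : ℕ) :
    groupSpan b * affineSpan b ^ n ≤ affineSpan b ^ n * groupSpan b := by
  induction n with
  | zero => rw [pow_zero, mul_one, one_mul]
  | succ n ih =>
    calc groupSpan b * affineSpan b ^ (n + 1)
        = (groupSpan b * affineSpan b ^ n) * affineSpan b := by rw [pow_succ, mul_assoc]
      _ ≤ affineSpan b ^ n * groupSpan b * affineSpan b := mul_le_mul' ih le_rfl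
      _ = affineSpan b ^ n * (groupSpan b * affineSpan b) := mul_assoc _ _ _
      _ ≤ affineSpan b ^ n * (affineSpan b * groupSpan b) :=
        mul_le_mul' le_rfl (groupSpan_mul_affineSpan b)
      _ = affineSpan b ^ (n + 1) * groupSpan b := by rw [pow_succ, mul_assoc]

theorem filt_mul_filt (m n : ℕ) : filt b m * filt b n ≤ filt b (m + n) :=
  calc filt b m * filt b n
      = affineSpan b ^ m * (groupSpan b * affineSpan b ^ n) * groupSpan b := by
        simp only [filt, mul_assoc]
    _ ≤ affineSpan b ^ m * (affineSpan b ^ n * groupSpan b) * groupSpan b :=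
      mul_le_mul' (mul_le_mul' le_rfl (groupSpan_mul_affineSpan_pow b n)) le_rfl
    _ = affineSpan b ^ (m + n) * (groupSpan b * groupSpan b) := by
        rw [pow_add]
        simp only [mul_assoc]
    _ ≤ filt b (m + n) := mul_le_mul' le_rfl (groupSpan_mul_groupSpan b)

theorem ofW_mul_mem_filt (w : weyl P) {n : ℕ} {x : Hecke b} (hx : x ∈ filt b n) :
    Hecke.ofW b w * x ∈ filt b n := by
  have := filt_mul_filt b 0 n
    (Submodule.mul_mem_mul (groupSpan_le_filt b 0 (ofW_mem_groupSpan b w)) hx)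
  rwa [zero_add] at this

theorem exists_mem_filt (x : Hecke b) : ∃ n, x ∈ filt b n := by
  have hadd : ∀ x y, (∃ n, x ∈ filt b n) → (∃ n, y ∈ filt b n) → ∃ n, x + y ∈ filt b n := by
    rintro x y ⟨m, hx⟩ ⟨n, hy⟩
    exact ⟨max m n, add_mem (filt_mono b (le_max_left _ _) hx) (filt_mono b (le_max_right _ _) hy)⟩
  have hmul : ∀ x y, (∃ n, x ∈ filt b n) → (∃ n, y ∈ filt b n) → ∃ n, x * y ∈ filt b n := by
    rintro x y ⟨m, hx⟩ ⟨n, hy⟩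
    exact ⟨m + n, filt_mul_filt b m n (Submodule.mul_mem_mul hx hy)⟩
  have hA : ∀ a, algebraMap (ParamRing P) (Hecke b) a ∈ filt b 0 := by
    intro a
    rw [Algebra.algebraMap_eq_smul_one]
    exact Submodule.smul_mem _ _ (groupSpan_le_filt b 0 (one_mem_groupSpan b))
  refine Hecke.induction b (p := fun x => ∃ n, x ∈ filt b n) (fun a => ⟨0, hA a⟩) ?_
    (fun w => ⟨0, groupSpan_le_filt b 0 (ofW_mem_groupSpan b w)⟩) hadd hmul x
  intro q
  induction q using SymmetricAlgebra.induction with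
  | algebraMap c =>
    rw [AlgHom.commutes, Hecke.algebraMap_complex]
    exact ⟨0, hA _⟩
  | ι y =>
    induction y using TensorProduct.induction_on with
    | zero => exact ⟨0, by rw [map_zero, map_zero]; exact zero_mem _⟩
    | add y y' hy hy' =>
      rw [map_add, map_add]
      exact hadd _ _ hy hy'
    | tmul c v =>
      rw [ι_tmul_eq_smul_vec, map_smul, Hecke.ofSym_vec, ← algebraMap_smul (ParamRing P)]
      refine ⟨1, Submodule.smul_mem _ _ ?_⟩
      have := ofV_mul_mem_filt b v (groupSpan_le_filt b 0 (one_mem_groupSpan b))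
      rwa [mul_one] at this
  | mul p q hp hq =>
    rw [map_mul]
    exact hmul _ _ hp hq
  | add p q hp hq =>
    rw [map_add]
    exact hadd _ _ hp hq

theorem affineSpan_pow_le (n : ℕ) :
    affineSpan b ^ n ≤ (degLT P κ (n + 1)).map (ofPoly b e).toLinearMap := by
  induction n with
  | zero =>
    rw [pow_zero, Submodule.one_le]
    refine ⟨1, (mem_degLT P).2 fun m hm => ?_, map_one (ofPoly b e)⟩
    rw [MvPolynomial.homogeneousComponent_of_mem (MvPolynomial.isHomogeneous_one _ _),
      if_neg (by omega)]
  | succ n ih =>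
    rw [pow_succ', Submodule.mul_le]
    intro u hu x hx
    obtain ⟨p, hp, rfl⟩ := ih hx
    induction hu using Submodule.span_induction with
    | mem u hu =>
      rcases hu with rfl | ⟨v, rfl⟩
      · rw [one_mul]
        exact ⟨p, degLT_mono P (n + 1).le_succ hp, rfl⟩
      · refine ⟨lin P e v * p, lin_mul_mem_degLT P e v hp, ?_⟩
        change ofPoly b e _ = _
        rw [map_mul, ofPoly_lin]
        rfl
    | zero =>
      rw [zero_mul]
      exact zero_mem _
    | add u u' _ _ hu hu' =>
      rw [add_mul]
      exact add_mem hu hu'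
    | smul a u _ hu =>
      rw [smul_mul_assoc]
      exact Submodule.smul_mem _ _ hu

variable [Fintype (weyl P)]

theorem filt_le_map_pbw (n : ℕ) :
    filt b n ≤ (Submodule.pi Set.univ fun _ : weyl P => degLT P κ (n + 1)).map (pbw b e) := by
  classical
  rw [filt, Submodule.mul_le]
  intro u hu x hx
  obtain ⟨p, hp, rfl⟩ := affineSpan_pow_le b e n hu
  induction hx using Submodule.span_induction with
  | mem x hx =>
    obtain ⟨w, rfl⟩ := hx
    refine ⟨Pi.single w p, ?_, pbw_single b e w p⟩
    intro u _
    by_cases h : u = w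
    · subst h
      simpa using hp
    · rw [Pi.single_eq_of_ne h]
      exact zero_mem _
  | zero =>
    rw [mul_zero]
    exact zero_mem _
  | add u u' _ _ hu hu' =>
    rw [mul_add]
    exact add_mem hu hu'
  | smul a u _ hu =>
    rw [mul_smul_comm]
    exact Submodule.smul_mem _ _ hu

theorem pbw_surjective : Function.Surjective (pbw b e) := fun x => by
  obtain ⟨n, hn⟩ := exists_mem_filt b x
  obtain ⟨p, -, hp⟩ := filt_le_map_pbw b e n hn
  exact ⟨p, hp⟩

/-- The Poincaré–Birkhoff–Witt isomorphism `A[W] ⊗ S(V) ≃ H_A`. -/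
def pbwEquiv : (weyl P → Poly P κ) ≃ₗ[ParamRing P] Hecke b :=
  LinearEquiv.ofBijective (pbw b e) ⟨pbw_injective b e, pbw_surjective b e⟩

/-- The coefficient of `w` in an element of `H_A`. -/
def coeffW (w : weyl P) : Hecke b →ₗ[ParamRing P] Poly P κ :=
  LinearMap.proj w ∘ₗ (pbwEquiv b e).symm.toLinearMap

theorem coeffW_pbw (w : weyl P) (p : weyl P → Poly P κ) : coeffW b e w (pbw b e p) = p w :=
  congrFun ((pbwEquiv b e).symm_apply_apply p) w

theorem coeffW_ofPoly_mul_ofW [DecidableEq (weyl P)] (w u : weyl P) (p : Poly P κ) :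
    coeffW b e w (ofPoly b e p * Hecke.ofW b u) = if w = u then p else 0 := by
  rw [← pbw_single, coeffW_pbw, Pi.single_apply]

theorem sum_coeffW (x : Hecke b) :
    ∑ w, ofPoly b e (coeffW b e w x) * Hecke.ofW b w = x := by
  rw [← pbw_apply]
  exact (pbwEquiv b e).apply_symm_apply x

theorem coeffW_mem_degLT (w : weyl P) {n : ℕ} {x : Hecke b} (hx : x ∈ filt b n) :
    coeffW b e w x ∈ degLT P κ (n + 1) := by
  obtain ⟨p, hp, rfl⟩ := filt_le_map_pbw b e n hx
  rw [coeffW_pbw]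
  exact hp w trivial

end Filtration

set_option linter.unusedSimpArgs false

/-! ### Exterior grading on the Clifford algebra -/

section Clifford

variable {V : Type*} [NormedAddCommGroup V] [InnerProductSpace ℝ V]

theorem cl_mul_cl_add_swap (u v : V) :
    cl V u * cl V v + cl V v * cl V u = algebraMap ℝ (Cliff V) (-2 * inner ℝ u v) := by
  rw [CliffordAlgebra.ι_mul_ι_add_swap]
  congr 1
  simp only [QuadraticMap.polar, negForm, neg_apply,
    LinearMap.BilinMap.toQuadraticMap_apply, innerₗ_apply_apply, inner_add_left, inner_add_right,
    real_inner_comm u v]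
  ring

variable (V) in
/-- Exterior multiplication on the Clifford algebra, `c ↦ (v c + ε(c) v) / 2`. -/
def extMul : V →ₗ[ℝ] Module.End ℝ (Cliff V) :=
  (1 / 2 : ℝ) • ((LinearMap.mul ℝ (Cliff V)) ∘ₗ cl V +
    (LinearMap.lcomp ℝ (Cliff V) (CliffordAlgebra.involute (Q := negForm V)).toLinearMap) ∘ₗ
      (LinearMap.mul ℝ (Cliff V)).flip ∘ₗ cl V)

variable (V) in
/-- Contraction on the Clifford algebra, `c ↦ -(v c - ε(c) v) / 2`. -/
def contr : V →ₗ[ℝ] Module.End ℝ (Cliff V) :=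
  (-1 / 2 : ℝ) • ((LinearMap.mul ℝ (Cliff V)) ∘ₗ cl V -
    (LinearMap.lcomp ℝ (Cliff V) (CliffordAlgebra.involute (Q := negForm V)).toLinearMap) ∘ₗ
      (LinearMap.mul ℝ (Cliff V)).flip ∘ₗ cl V)

theorem extMul_apply (v : V) (c : Cliff V) :
    extMul V v c = (1 / 2 : ℝ) • (cl V v * c + CliffordAlgebra.involute c * cl V v) := rfl

theorem contr_apply (v : V) (c : Cliff V) :
    contr V v c = (-1 / 2 : ℝ) • (cl V v * c - CliffordAlgebra.involute c * cl V v) := rfl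

theorem extMul_sub_contr (v : V) (c : Cliff V) : extMul V v c - contr V v c = cl V v * c := by
  rw [extMul_apply, contr_apply]
  module

theorem contr_one (v : V) : contr V v 1 = 0 := by
  simp [contr_apply]

theorem mul_cl_mul_cl (c : Cliff V) (u v : V) :
    c * cl V u * cl V v = -(c * cl V v * cl V u) + (-2 * inner ℝ u v : ℝ) • c := by
  have h := congrArg (c * ·) (cl_mul_cl_add_swap u v)
  simp only [mul_add, ← mul_assoc] at h
  rw [eq_sub_of_add_eq h, ← Algebra.commutes, ← Algebra.smul_def]
  abel

theorem cl_mul_cl_mul (c : Cliff V) (u v : V) :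
    cl V u * (cl V v * c) = -(cl V v * (cl V u * c)) + (-2 * inner ℝ u v : ℝ) • c := by
  have h := congrArg (· * c) (cl_mul_cl_add_swap u v)
  simp only [add_mul, mul_assoc] at h
  rw [eq_sub_of_add_eq h, ← Algebra.smul_def]
  abel

/-- With `contr_contr`, these are the canonical anticommutation relations: they let C(V) be graded
like the exterior algebra without leaving C(V). -/
theorem contr_extMul (u v : V) (c : Cliff V) :
    contr V u (extMul V v c) = (inner ℝ u v : ℝ) • c - extMul V v (contr V u c) := by
  simp only [contr_apply, extMul_apply, map_smul, map_add, map_sub, map_mul,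
    CliffordAlgebra.involute_ι, CliffordAlgebra.involute_involute, mul_add, mul_sub, add_mul,
    sub_mul, mul_smul_comm, smul_mul_assoc, neg_mul, mul_neg]
  rw [cl_mul_cl_mul c u v, mul_cl_mul_cl c v u, real_inner_comm u v]
  simp only [← mul_assoc]
  module

theorem contr_contr (u v : V) (c : Cliff V) :
    contr V u (contr V v c) = -contr V v (contr V u c) := by
  simp only [contr_apply, map_smul, map_add, map_sub, map_mul,
    CliffordAlgebra.involute_ι, CliffordAlgebra.involute_involute, mul_add, mul_sub, add_mul,
    sub_mul, mul_smul_comm, smul_mul_assoc, neg_mul, mul_neg]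
  rw [cl_mul_cl_mul c u v, mul_cl_mul_cl c v u, real_inner_comm u v]
  simp only [← mul_assoc]
  module

section Number

variable {κ : Type*} [Fintype κ] [DecidableEq κ]
variable (e e' : Module.Basis κ ℝ V)

/-- The operator whose eigenvalues are the exterior degrees. -/
def numOp : Module.End ℝ (Cliff V) := ∑ i, extMul V (e i) ∘ₗ contr V (e' i)

theorem numOp_apply (c : Cliff V) : numOp e e' c = ∑ i, extMul V (e i) (contr V (e' i) c) := by
  simp [numOp]

/-- The two bases are dual to each other for the inner product. -/
abbrev DualBases : Prop := ∀ i j, inner ℝ (e i) (e' j) = if i = j then (1 : ℝ) else 0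

variable {e e'}

theorem sum_inner_smul_left (hdual : DualBases e e') (v : V) :
    ∑ i, (inner ℝ v (e' i) : ℝ) • e i = v := by
  have : ∑ i, (innerₗ V (e' i)).smulRight (e i) = LinearMap.id := by
    refine e.ext fun j => ?_
    simp [LinearMap.sum_apply, real_inner_comm (e j), hdual j]
  simpa [LinearMap.sum_apply, real_inner_comm v] using LinearMap.congr_fun this v

theorem sum_inner_smul_right (hdual : DualBases e e') (v : V) :
    ∑ i, (inner ℝ v (e i) : ℝ) • e' i = v := by
  have : ∑ i, (innerₗ V (e i)).smulRight (e' i) = LinearMap.id := by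
    refine e'.ext fun j => ?_
    simp [LinearMap.sum_apply, hdual _ j]
  simpa [LinearMap.sum_apply, real_inner_comm] using LinearMap.congr_fun this v

/-- A number operator: the anticommutation relations reduce its commutator with exterior
multiplication by v to expanding v in the dual bases. -/
theorem numOp_extMul (hdual : DualBases e e') (v : V) (c : Cliff V) :
    numOp e e' (extMul V v c) = extMul V v c + extMul V v (numOp e e' c) := by
  have anti : ∀ (u v : V) (c : Cliff V),
      extMul V u (extMul V v c) = -extMul V v (extMul V u c) := by
    intro u v c
    simp only [extMul_apply, map_smul, map_add, map_sub, map_mul,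
      CliffordAlgebra.involute_ι, CliffordAlgebra.involute_involute, mul_add, mul_sub, add_mul,
      sub_mul, mul_smul_comm, smul_mul_assoc, neg_mul, mul_neg]
    rw [cl_mul_cl_mul c u v, mul_cl_mul_cl c v u, real_inner_comm u v]
    simp only [← mul_assoc]
    module
  simp only [numOp_apply, contr_extMul, map_sub, map_smul, Finset.sum_sub_distrib, map_sum]
  rw [Finset.sum_congr rfl fun i _ => anti (e i) v (contr V (e' i) c), Finset.sum_neg_distrib,
    sub_neg_eq_add]
  congr 1
  conv_rhs => rw [← sum_inner_smul_left hdual v]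
  simp [real_inner_comm, LinearMap.sum_apply]

theorem numOp_contr (hdual : DualBases e e') (v : V) (c : Cliff V) :
    numOp e e' (contr V v c) = contr V v (numOp e e' c) - contr V v c := by
  simp only [numOp_apply, map_sum, contr_extMul, Finset.sum_sub_distrib]
  have h : ∑ i, (inner ℝ v (e i) : ℝ) • contr V (e' i) c = contr V v c := by
    conv_rhs => rw [← sum_inner_smul_right hdual v]
    simp [LinearMap.sum_apply]
  rw [h, sub_sub_cancel_left, ← Finset.sum_neg_distrib]
  refine Finset.sum_congr rfl fun i _ => ?_
  rw [contr_contr, map_neg]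

theorem numOp_one : numOp e e' (1 : Cliff V) = 0 := by
  simp [numOp_apply, contr_one]

variable (V) in
/-- The span of the exterior products of `n` vectors. -/
def extPow : ℕ → Submodule ℝ (Cliff V)
  | 0 => Submodule.span ℝ {1}
  | n + 1 => ⨆ v : V, (extPow n).map (extMul V v)

theorem extMul_mem_extPow (v : V) {n : ℕ} {c : Cliff V} (hc : c ∈ extPow V n) :
    extMul V v c ∈ extPow V (n + 1) :=
  Submodule.mem_iSup_of_mem (p := fun v : V => (extPow V n).map (extMul V v)) v ⟨c, hc, rfl⟩

/-- The subtraction truncates at n = 0; the second clause, vanishing there, is what the induction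
needs to pass from degree 0 to degree 1. -/
theorem contr_mem_extPow (v : V) (n : ℕ) {c : Cliff V} (hc : c ∈ extPow V n) :
    contr V v c ∈ extPow V (n - 1) ∧ (n = 0 → contr V v c = 0) := by
  induction n generalizing c with
  | zero =>
    obtain ⟨r, rfl⟩ := Submodule.mem_span_singleton.1 hc
    rw [map_smul, contr_one, smul_zero]
    exact ⟨zero_mem _, fun _ => rfl⟩
  | succ n ih =>
    refine ⟨?_, fun h => absurd h n.succ_ne_zero⟩
    have : extPow V (n + 1) ≤ (extPow V n).comap (contr V v) := by
      refine iSup_le fun u => ?_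
      rintro _ ⟨x, hx, rfl⟩
      rw [Submodule.mem_comap, contr_extMul]
      refine sub_mem (Submodule.smul_mem _ _ hx) ?_
      obtain ⟨h1, h2⟩ := ih hx
      rcases n with _ | n
      · rw [h2 rfl, map_zero]
        exact zero_mem _
      · exact extMul_mem_extPow u h1
    exact this hc

/-- Left multiplication by v is exterior multiplication minus contraction, so the sum of the graded
pieces is a left ideal, and it contains 1. -/
theorem iSup_extPow : ⨆ n, extPow V n = ⊤ := by
  rw [eq_top_iff]
  have key : ∀ c : Cliff V, ∀ x ∈ ⨆ n, extPow V n, c * x ∈ ⨆ n, extPow V n := by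
    intro c
    induction c using CliffordAlgebra.induction with
    | algebraMap r =>
      intro x hx
      rw [← Algebra.smul_def]
      exact Submodule.smul_mem _ _ hx
    | ι v =>
      intro x hx
      have : ⨆ n, extPow V n ≤ (⨆ n, extPow V n).comap (LinearMap.mulLeft ℝ (cl V v)) := by
        refine iSup_le fun n x hx => ?_
        rw [Submodule.mem_comap, LinearMap.mulLeft_apply, ← extMul_sub_contr]
        exact sub_mem (Submodule.mem_iSup_of_mem (n + 1) (extMul_mem_extPow v hx))
          (Submodule.mem_iSup_of_mem (n - 1) (contr_mem_extPow v n hx).1)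
      exact this hx
    | mul a c ha hc =>
      intro x hx
      rw [mul_assoc]
      exact ha _ (hc x hx)
    | add a c ha hc =>
      intro x hx
      rw [add_mul]
      exact add_mem (ha x hx) (hc x hx)
  intro c _
  have := key c 1 (Submodule.mem_iSup_of_mem 0 (Submodule.mem_span_singleton_self 1))
  rwa [mul_one] at this

theorem extPow_le_eigenspace (hdual : DualBases e e') (n : ℕ) :
    extPow V n ≤ (numOp e e').eigenspace (n : ℝ) := by
  induction n with
  | zero =>
    refine (Submodule.span_singleton_le_iff_mem _ _).2 ?_
    rw [Module.End.mem_eigenspace_iff, numOp_one]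
    simp
  | succ n ih =>
    refine iSup_le fun v => ?_
    rintro _ ⟨x, hx, rfl⟩
    have := Module.End.mem_eigenspace_iff.1 (ih hx)
    rw [Module.End.mem_eigenspace_iff, numOp_extMul hdual, this, map_smul]
    push_cast
    module

/-- The pieces of positive degree lie in eigenspaces with nonzero eigenvalue, which are independent
of the kernel. Besides the Koszul complex, this also determines the kernel of W̃ → W. -/
theorem ker_numOp (hdual : DualBases e e') {c : Cliff V} (hc : numOp e e' c = 0) :
    ∃ r : ℝ, c = r • 1 := by
  have htop : extPow V 0 ⊔ ⨆ n, extPow V (n + 1) = ⊤ := by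
    rw [sup_iSup_nat_succ, iSup_extPow]
  obtain ⟨x, hx, y, hy, hxy⟩ := Submodule.mem_sup.1 (htop ▸ Submodule.mem_top : c ∈ _)
  obtain ⟨r, rfl⟩ := Submodule.mem_span_singleton.1 hx
  have hy0 : y ∈ (numOp e e').eigenspace 0 := by
    rw [Module.End.mem_eigenspace_iff, zero_smul, eq_sub_of_add_eq' hxy, map_sub, map_smul,
      numOp_one, hc]
    simp
  have hy1 : y ∈ ⨆ (μ : ℝ) (_ : μ ≠ 0), (numOp e e').eigenspace μ := by
    refine (iSup_le fun n => ?_ : ⨆ n, extPow V (n + 1) ≤ _) hy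
    refine (extPow_le_eigenspace hdual (n + 1)).trans ?_
    refine le_iSup₂_of_le ((n + 1 : ℕ) : ℝ) ?_ le_rfl
    positivity
  have hy2 : y = 0 :=
    Submodule.disjoint_def.1 ((numOp e e').eigenspaces_iSupIndep 0) y hy0 hy1
  exact ⟨r, by rw [← hxy, hy2, add_zero]⟩

/-- The number operator is diagonalizable with eigenvalues in ℕ, so adding n + 1 leaves only
positive eigenvalues. -/
theorem add_numOp_bijective (hdual : DualBases e e') (n : ℕ) :
    Function.Bijective (((n + 1 : ℕ) : ℝ) • (1 : Module.End ℝ (Cliff V)) + numOp e e') := by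
  constructor
  · rw [← LinearMap.ker_eq_bot, LinearMap.ker_eq_bot']
    intro c hc
    have h0 : c ∈ (numOp e e').eigenspace (-((n + 1 : ℕ) : ℝ)) := by
      rw [Module.End.mem_eigenspace_iff, neg_smul]
      exact eq_neg_of_add_eq_zero_right hc
    have h1 : c ∈ ⨆ (μ : ℝ) (_ : μ ≠ -((n + 1 : ℕ) : ℝ)), (numOp e e').eigenspace μ := by
      refine (iSup_le fun m => ?_ : ⨆ m, extPow V m ≤ _) (iSup_extPow (V := V) ▸ Submodule.mem_top)
      refine (extPow_le_eigenspace hdual m).trans ?_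
      refine le_iSup₂_of_le (m : ℝ) ?_ le_rfl
      have : (0 : ℝ) ≤ m := m.cast_nonneg
      have : (0 : ℝ) < (n + 1 : ℕ) := by positivity
      linarith
    exact Submodule.disjoint_def.1 ((numOp e e').eigenspaces_iSupIndep _) c h0 h1
  · rw [← LinearMap.range_eq_top, eq_top_iff, ← iSup_extPow]
    refine iSup_le fun m c hc => ?_
    have h := Module.End.mem_eigenspace_iff.1 (extPow_le_eigenspace hdual m hc)
    refine ⟨(((n + 1 : ℕ) : ℝ) + m)⁻¹ • c, ?_⟩
    have : ((n + 1 : ℕ) : ℝ) + m ≠ 0 := by positivity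
    rw [map_smul, LinearMap.add_apply, h, LinearMap.smul_apply, Module.End.one_apply, ← add_smul,
      inv_smul_smul₀ this]

end Number
end Clifford

/-! ### Exactness of the Koszul complex -/

section Koszul

variable {V κ R : Type*} [NormedAddCommGroup V] [InnerProductSpace ℝ V]
variable [CommRing R] [Algebra ℝ R]

variable (V κ R) in
/-- The projection of `R[x] ⊗ C(V)` on its part of polynomial degree `n`. -/
def homComp (n : ℕ) :
    MvPolynomial κ R ⊗[ℝ] Cliff V →ₗ[ℝ] MvPolynomial κ R ⊗[ℝ] Cliff V :=
  ((MvPolynomial.homogeneousComponent n).restrictScalars ℝ).rTensor (Cliff V)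

theorem homComp_tmul (n : ℕ) (p : MvPolynomial κ R) (c : Cliff V) :
    homComp V κ R n (p ⊗ₜ c) = MvPolynomial.homogeneousComponent n p ⊗ₜ c := rfl

theorem homComp_homComp (m n : ℕ) (y : MvPolynomial κ R ⊗[ℝ] Cliff V) :
    homComp V κ R m (homComp V κ R n y) = if m = n then homComp V κ R n y else 0 := by
  induction y using TensorProduct.induction_on with
  | zero => simp
  | add y y' hy hy' =>
    simp only [map_add, hy, hy']
    split_ifs <;> simp
  | tmul p c =>
    simp only [homComp_tmul]
    rw [MvPolynomial.homogeneousComponent_of_mem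
      (MvPolynomial.homogeneousComponent_isHomogeneous n p)]
    split_ifs with h
    · rfl
    · rw [TensorProduct.zero_tmul]

theorem exists_sum_homComp (y : MvPolynomial κ R ⊗[ℝ] Cliff V) :
    ∃ N, ∀ n ≥ N, ∑ m ∈ Finset.range n, homComp V κ R m y = y := by
  induction y using TensorProduct.induction_on with
  | zero => exact ⟨0, by simp⟩
  | add y y' hy hy' =>
    obtain ⟨N, hN⟩ := hy
    obtain ⟨N', hN'⟩ := hy'
    refine ⟨max N N', fun n hn => ?_⟩
    simp only [map_add, Finset.sum_add_distrib]
    rw [hN n (le_of_max_le_left hn), hN' n (le_of_max_le_right hn)]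
  | tmul p c =>
    refine ⟨p.totalDegree + 1, fun n hn => ?_⟩
    simp only [homComp_tmul, ← TensorProduct.sum_tmul]
    congr 1
    conv_rhs => rw [← MvPolynomial.sum_homogeneousComponent p]
    symm
    refine Finset.sum_subset (Finset.range_mono hn) fun m _ hm => ?_
    rw [Finset.mem_range, not_lt] at hm
    exact MvPolynomial.homogeneousComponent_eq_zero _ _ hm

variable [Fintype κ] [DecidableEq κ] (e e' : Module.Basis κ ℝ V)

variable (R) in
/-- The Koszul differential `∑ x_i ⊗ δ_{e'_i}`. -/
def koszul : MvPolynomial κ R ⊗[ℝ] Cliff V →ₗ[ℝ] MvPolynomial κ R ⊗[ℝ] Cliff V :=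
  ∑ i, TensorProduct.map (LinearMap.mulLeft ℝ (MvPolynomial.X i)) (contr V (e' i))

variable (R) in
/-- The Koszul homotopy `∑ ∂_i ⊗ λ_{e_i}`. -/
def koszulHtpy : MvPolynomial κ R ⊗[ℝ] Cliff V →ₗ[ℝ] MvPolynomial κ R ⊗[ℝ] Cliff V :=
  ∑ i, TensorProduct.map ((MvPolynomial.pderiv (R := R) i).toLinearMap.restrictScalars ℝ)
    (extMul V (e i))

theorem koszul_tmul (p : MvPolynomial κ R) (c : Cliff V) :
    koszul R e' (p ⊗ₜ c) = ∑ i, (MvPolynomial.X i * p) ⊗ₜ contr V (e' i) c := by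
  simp [koszul, LinearMap.sum_apply]

theorem koszulHtpy_tmul (p : MvPolynomial κ R) (c : Cliff V) :
    koszulHtpy R e (p ⊗ₜ c) = ∑ i, MvPolynomial.pderiv i p ⊗ₜ extMul V (e i) c := by
  simp [koszulHtpy, LinearMap.sum_apply]

theorem homComp_koszul (n : ℕ) (y : MvPolynomial κ R ⊗[ℝ] Cliff V) :
    homComp V κ R (n + 1) (koszul R e' y) = koszul R e' (homComp V κ R n y) := by
  induction y using TensorProduct.induction_on with
  | zero => simp
  | add y y' hy hy' => simp only [map_add, hy, hy']
  | tmul p c =>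
    simp only [koszul_tmul, homComp_tmul, map_sum]
    refine Finset.sum_congr rfl fun i _ => ?_
    rw [homogeneousComponent_mul_of_isHomogeneous_one (MvPolynomial.isHomogeneous_X R i)]

variable {e e'}

/-- Euler's identity on the polynomial factor and the anticommutation relations on the Clifford
factor make the Laplacian equal to polynomial degree plus exterior degree. -/
theorem koszul_homotopy (hdual : DualBases e e') (n : ℕ) (y : MvPolynomial κ R ⊗[ℝ] Cliff V) :
    koszul R e' (koszulHtpy R e (homComp V κ R n y)) +
      koszulHtpy R e (koszul R e' (homComp V κ R n y)) =
      ((n : ℝ) • (1 : Module.End ℝ (Cliff V)) + numOp e e').lTensor (MvPolynomial κ R)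
        (homComp V κ R n y) := by
  induction y using TensorProduct.induction_on with
  | zero => simp
  | add y y' hy hy' =>
    simp only [map_add]
    rw [← hy, ← hy']
    abel
  | tmul p c =>
    rw [homComp_tmul]
    set q := MvPolynomial.homogeneousComponent n p with hq
    have hEuler : ∑ i, MvPolynomial.X i * MvPolynomial.pderiv i q = n • q :=
      (MvPolynomial.homogeneousComponent_isHomogeneous n p).sum_X_mul_pderiv
    have hleft : ∀ i j, MvPolynomial.pderiv j (MvPolynomial.X i * q) =
        (if i = j then q else 0) + MvPolynomial.X i * MvPolynomial.pderiv j q := by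
      intro i j
      rw [Derivation.leibniz, MvPolynomial.pderiv_X, smul_eq_mul, smul_eq_mul, add_comm]
      congr 1
      by_cases h : i = j
      · subst h
        simp
      · simp [h]
    have hce : ∀ i j, contr V (e' i) (extMul V (e j) c) =
        (if j = i then c else 0) - extMul V (e j) (contr V (e' i) c) := by
      intro i j
      rw [contr_extMul, real_inner_comm, hdual]
      split_ifs <;> simp
    rw [koszulHtpy_tmul, koszul_tmul, map_sum, map_sum, LinearMap.lTensor_tmul,
      LinearMap.add_apply, TensorProduct.tmul_add, numOp_apply]
    simp only [koszul_tmul, koszulHtpy_tmul, hleft, hce, TensorProduct.add_tmul,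
      TensorProduct.tmul_sub, Finset.sum_add_distrib, Finset.sum_sub_distrib]
    rw [Finset.sum_comm (f := fun i j => (MvPolynomial.X i * MvPolynomial.pderiv j q) ⊗ₜ[ℝ]
      (extMul V (e j)) ((contr V (e' i)) c))]
    have h1 : ∑ x, ∑ x_1, (MvPolynomial.X x_1 * MvPolynomial.pderiv x q) ⊗ₜ[ℝ]
        (if x = x_1 then c else 0) = q ⊗ₜ[ℝ] ((n : ℝ) • (1 : Module.End ℝ (Cliff V))) c := by
      have : ∀ x, ∑ x_1, (MvPolynomial.X x_1 * MvPolynomial.pderiv x q) ⊗ₜ[ℝ]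
          (if x = x_1 then c else 0) = (MvPolynomial.X x * MvPolynomial.pderiv x q) ⊗ₜ[ℝ] c := by
        intro x
        rw [Finset.sum_eq_single x]
        · simp
        · intro y _ hy
          simp [hy.symm]
        · simp
      simp only [this]
      rw [← TensorProduct.sum_tmul, hEuler, ← Nat.cast_smul_eq_nsmul ℝ, TensorProduct.smul_tmul]
      rfl
    have h2 : ∑ x, ∑ x_1, (if x = x_1 then q else 0) ⊗ₜ[ℝ]
        (extMul V (e x_1)) ((contr V (e' x)) c) =
        q ⊗ₜ[ℝ] ∑ i, (extMul V (e i)) ((contr V (e' i)) c) := by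
      rw [TensorProduct.tmul_sum]
      refine Finset.sum_congr rfl fun x _ => ?_
      rw [Finset.sum_eq_single x]
      · simp
      · intro y _ hy
        simp [hy.symm]
      · simp
    rw [h1, h2]
    abel

theorem koszul_exact (hdual : DualBases e e') (n : ℕ) {y : MvPolynomial κ R ⊗[ℝ] Cliff V}
    (hy : koszul R e' (homComp V κ R (n + 1) y) = 0) :
    ∃ a, homComp V κ R n a = a ∧ koszul R e' a = homComp V κ R (n + 1) y := by
  let N : ℕ → Module.End ℝ (Cliff V) := fun n =>
    ((n + 1 : ℕ) : ℝ) • (1 : Module.End ℝ (Cliff V)) + numOp e e'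
  let G : ℕ → (Cliff V ≃ₗ[ℝ] Cliff V) := fun n =>
    (LinearEquiv.ofBijective (N n) (add_numOp_bijective hdual n)).symm
  have hGN : ∀ n c, G n (N n c) = c := fun n c =>
    (LinearEquiv.ofBijective (N n) (add_numOp_bijective hdual n)).symm_apply_apply c
  have hNG : ∀ n c, N n (G n c) = c := fun n c =>
    (LinearEquiv.ofBijective (N n) (add_numOp_bijective hdual n)).apply_symm_apply c
  -- Contraction lowers the exterior degree by one, so it intertwines the inverse of n + 1 + N with
  -- that of n + 2 + N. Hence the inverse of the Laplacian preserves Koszul cycles, and composing it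
  -- with the homotopy yields a primitive.
  have hshift : ∀ v c, contr V v (G n c) = G (n + 1) (contr V v c) := by
    intro v c
    have h : contr V v (N n (G n c)) = N (n + 1) (contr V v (G n c)) := by
      simp only [N, LinearMap.add_apply, LinearMap.smul_apply, Module.End.one_apply, map_add,
        map_smul, numOp_contr hdual]
      push_cast
      module
    rw [← hGN (n + 1) (contr V v (G n c)), ← h, hNG]
  have hkG : ∀ y, koszul R e' ((G n).toLinearMap.lTensor (MvPolynomial κ R) y) =
      (G (n + 1)).toLinearMap.lTensor (MvPolynomial κ R) (koszul R e' y) := by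
    intro y
    induction y using TensorProduct.induction_on with
    | zero => simp
    | add y y' hy hy' => simp only [map_add, hy, hy']
    | tmul p c =>
      simp only [LinearMap.lTensor_tmul, koszul_tmul, map_sum, LinearEquiv.coe_coe, hshift]
  have hhG : ∀ y, homComp V κ R (n + 1) ((G n).toLinearMap.lTensor (MvPolynomial κ R) y) =
      (G n).toLinearMap.lTensor (MvPolynomial κ R) (homComp V κ R (n + 1) y) := by
    intro y
    induction y using TensorProduct.induction_on with
    | zero => simp
    | add y y' hy hy' => simp only [map_add, hy, hy']
    | tmul p c => rfl
  have hNGt : ∀ y, (N n).lTensor (MvPolynomial κ R)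
      ((G n).toLinearMap.lTensor (MvPolynomial κ R) y) = y := by
    intro y
    induction y using TensorProduct.induction_on with
    | zero => simp
    | add y y' hy hy' => simp only [map_add, hy, hy']
    | tmul p c =>
      rw [LinearMap.lTensor_tmul, LinearMap.lTensor_tmul, LinearEquiv.coe_coe, hNG]
  have h := koszul_homotopy hdual (n + 1) ((G n).toLinearMap.lTensor (MvPolynomial κ R) y)
  rw [hhG, hkG, hy, map_zero, map_zero, add_zero, hNGt] at h
  refine ⟨homComp V κ R n (koszulHtpy R e
    ((G n).toLinearMap.lTensor (MvPolynomial κ R) (homComp V κ R (n + 1) y))), ?_, ?_⟩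
  · rw [homComp_homComp, if_pos rfl]
  · rw [← homComp_koszul, h, homComp_homComp, if_pos rfl]

theorem koszul_exact_zero (hdual : DualBases e e') {y : MvPolynomial κ R ⊗[ℝ] Cliff V}
    (hy : koszul R e' (homComp V κ R 0 y) = 0) :
    ∃ r : R, homComp V κ R 0 y = MvPolynomial.C r ⊗ₜ 1 := by
  -- In polynomial degree 0 the Laplacian is N itself, which is not invertible. A linear G with N G
  -- N = N serves instead: c − G N c lies in the kernel of N, hence is a scalar.
  obtain ⟨g, hg⟩ := (numOp e e').rangeRestrict.exists_rightInverse_of_surjective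
    (LinearMap.range_rangeRestrict _)
  obtain ⟨G, hG⟩ := LinearMap.exists_extend g
  have hGN : ∀ c, numOp e e' (G (numOp e e' c)) = numOp e e' c := by
    intro c
    have h1 := LinearMap.congr_fun hG ((numOp e e').rangeRestrict c)
    have h2 := congrArg Subtype.val (LinearMap.congr_fun hg ((numOp e e').rangeRestrict c))
    change G (numOp e e' c) = _ at h1
    rw [h1]
    exact h2
  have hproj : ∀ c, ∃ r : ℝ, c - G (numOp e e' c) = r • 1 := fun c =>
    ker_numOp hdual (by rw [map_sub, hGN, sub_self])
  have hzero : koszulHtpy R e (homComp V κ R 0 y) = 0 := by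
    clear hy
    induction y using TensorProduct.induction_on with
    | zero => simp
    | add y y' hy hy' => rw [map_add, map_add, hy, hy', add_zero]
    | tmul p c => simp [homComp_tmul, koszulHtpy_tmul, MvPolynomial.homogeneousComponent_zero]
  have h := koszul_homotopy hdual 0 y
  rw [hzero, hy, map_zero, map_zero, add_zero, Nat.cast_zero, zero_smul, zero_add] at h
  have hkey : ∀ y, ∃ r : R, homComp V κ R 0 y - G.lTensor (MvPolynomial κ R)
      ((numOp e e').lTensor (MvPolynomial κ R) (homComp V κ R 0 y)) = MvPolynomial.C r ⊗ₜ 1 := by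
    intro y
    induction y using TensorProduct.induction_on with
    | zero => exact ⟨0, by simp⟩
    | add y y' hy hy' =>
      obtain ⟨r, hr⟩ := hy
      obtain ⟨r', hr'⟩ := hy'
      refine ⟨r + r', ?_⟩
      simp only [map_add]
      rw [add_sub_add_comm, hr, hr', TensorProduct.add_tmul]
    | tmul p c =>
      obtain ⟨r, hr⟩ := hproj c
      refine ⟨r • MvPolynomial.coeff 0 p, ?_⟩
      rw [homComp_tmul, LinearMap.lTensor_tmul, LinearMap.lTensor_tmul, ← TensorProduct.tmul_sub,
        hr, MvPolynomial.homogeneousComponent_zero, ← TensorProduct.smul_tmul]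
      congr 1
      exact MvPolynomial.smul_monomial r
  obtain ⟨r, hr⟩ := hkey y
  rw [← h, map_zero, sub_zero] at hr
  exact ⟨r, hr⟩

end Koszul

/-! ### The pin cover: lifts of reflections and the kernel of the projection -/

section PinCover

variable {ι κ V V' : Type*} [NormedAddCommGroup V] [InnerProductSpace ℝ V]
  [AddCommGroup V'] [Module ℝ V']
variable {P : RootPairing ι ℝ V V'}

variable (P) in
/-- The inner product is invariant under the Weyl group. -/
abbrev InvariantInner : Prop :=
  ∀ w ∈ weyl P, ∀ x y : V, inner ℝ (w x) (w y) = (inner ℝ x y : ℝ)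

theorem pairing_mul_inner_self (hinv : InvariantInner P) (i : ι) (v : V) :
    P.toLinearMap v (P.coroot i) * inner ℝ (P.root i) (P.root i) = 2 * inner ℝ v (P.root i) := by
  have h := hinv _ (refl P i).2 v (P.root i)
  rw [show (refl P i).1 (P.root i) = -P.root i from P.reflection_apply_self i, refl_apply,
    inner_neg_right, inner_sub_left, real_inner_smul_left] at h
  linarith

theorem proj_spec (a : pinCover P) : Covers P a.1 (proj P a) := a.2.2.choose_spec

theorem involute_mul_cl (a : pinCover P) (v : V) :
    CliffordAlgebra.involute (a.1 : Cliff V) * cl V v =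
      cl V ((proj P a).1 v) * (a.1 : Cliff V) := by
  rw [← proj_spec a v, mul_assoc, Units.inv_mul, mul_one]

theorem proj_eq_of_covers {a : pinCover P} {w : weyl P} (h : Covers P a.1 w) : proj P a = w :=
  Covers.unique P (proj_spec a) h

theorem cl_mul_self (v : V) : cl V v * cl V v = algebraMap ℝ (Cliff V) (-inner ℝ v v) := by
  rw [CliffordAlgebra.ι_sq_scalar]
  rfl

/-- A unit vector, as a unit of the Clifford algebra. -/
def unitOfVec (v : V) (hv : inner ℝ v v = (1 : ℝ)) : (Cliff V)ˣ where
  val := cl V v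
  inv := -cl V v
  val_inv := by rw [mul_neg, cl_mul_self, hv, map_neg, map_one, neg_neg]
  inv_val := by rw [neg_mul, cl_mul_self, hv, map_neg, map_one, neg_neg]

theorem inner_unit_root (i : ι) :
    inner ℝ (‖P.root i‖⁻¹ • P.root i) (‖P.root i‖⁻¹ • P.root i) = (1 : ℝ) := by
  rw [real_inner_self_eq_norm_sq, norm_smul, norm_inv, norm_norm,
    inv_mul_cancel₀ (norm_ne_zero_iff.2 (P.ne_zero i)), one_pow]

theorem covers_unit_root (hinv : InvariantInner P) (i : ι) :
    Covers P (unitOfVec _ (inner_unit_root (P := P) i)) (refl P i) := by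
  intro v
  have hne : ‖P.root i‖ ≠ 0 := norm_ne_zero_iff.2 (P.ne_zero i)
  set u := ‖P.root i‖⁻¹ • P.root i with hu
  change CliffordAlgebra.involute (cl V u) * cl V v * (-cl V u) = _
  rw [CliffordAlgebra.involute_ι, neg_mul, neg_mul_neg, eq_sub_of_add_eq (cl_mul_cl_add_swap u v),
    sub_mul, mul_assoc, cl_mul_self, inner_unit_root, ← Algebra.commutes, ← Algebra.smul_def,
    ← Algebra.smul_def, ← map_smul, ← map_smul, ← map_sub, refl_apply]
  congr 1
  have h := pairing_mul_inner_self hinv i v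
  rw [real_inner_self_eq_norm_sq] at h
  have h2 : P.toLinearMap v (P.coroot i) =
      2 * inner ℝ v (P.root i) * (‖P.root i‖⁻¹ * ‖P.root i‖⁻¹) := by
    rw [← h]
    field_simp
  rw [h2, hu, real_inner_smul_left, real_inner_comm]
  module

/-- The lift of a reflection to the pin cover given by the normalized root. -/
def reflLift (hinv : InvariantInner P) (i : ι) : pinCover P :=
  ⟨unitOfVec _ (inner_unit_root (P := P) i), by
    refine ⟨Units.ext ?_, refl P i, covers_unit_root hinv i⟩
    change star (cl V _) = -cl V _
    rw [CliffordAlgebra.star_ι]⟩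

theorem reflLift_coe (hinv : InvariantInner P) (i : ι) :
    ((reflLift hinv i).1 : Cliff V) = cl V (‖P.root i‖⁻¹ • P.root i) := rfl

theorem proj_reflLift (hinv : InvariantInner P) (i : ι) : proj P (reflLift hinv i) = refl P i :=
  proj_eq_of_covers (covers_unit_root hinv i)

theorem proj_surjective (hinv : InvariantInner P) : Function.Surjective (proj P) := by
  rintro ⟨g, hg⟩
  have : weyl P ≤ (proj P).range.map (weyl P).subtype := by
    refine (Subgroup.closure_le _).2 ?_
    rintro _ ⟨i, rfl⟩
    exact ⟨refl P i, ⟨reflLift hinv i, proj_reflLift hinv i⟩, rfl⟩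
  obtain ⟨w, ⟨a, ha⟩, hw⟩ := this hg
  exact ⟨a, ha.trans (Subtype.ext hw)⟩

variable [Fintype κ] [DecidableEq κ] {e e' : Module.Basis κ ℝ V}

theorem coe_negOne_mul (a : pinCover P) : ((negOne P * a).1 : Cliff V) = -(a.1 : Cliff V) := by
  change ((-1 : (Cliff V)ˣ) * a.1 : (Cliff V)ˣ).1 = _
  simp

theorem proj_negOne : proj P (negOne P) = 1 := proj_eq_of_covers (Covers.neg_one P)

theorem negOne_mul_self : negOne P * negOne P = 1 := by
  refine Subtype.ext (Units.ext ?_)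
  rw [coe_negOne_mul]
  change -((-1 : (Cliff V)ˣ) : Cliff V) = 1
  simp

theorem pinCover_ext {a c : pinCover P} (h : (a.1 : Cliff V) = c.1) : a = c :=
  Subtype.ext (Units.ext h)

/-- If p(a) = 1 then ε(a) v = v a, so every contraction of a vanishes and a is a real scalar; aᵗ =
a⁻¹ then forces its square to be 1. -/
theorem eq_one_or_negOne (hdual : DualBases e e') {a : pinCover P} (ha : proj P a = 1) :
    a = 1 ∨ a = negOne P := by
  have h0 : ∀ v, contr V v (a.1 : Cliff V) = 0 := by
    intro v
    rw [contr_apply, involute_mul_cl, ha]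
    change (-1 / 2 : ℝ) • (cl V v * (a.1 : Cliff V) - cl V v * a.1) = 0
    rw [sub_self, smul_zero]
  obtain ⟨r, hr⟩ := ker_numOp hdual (c := (a.1 : Cliff V)) (by simp [numOp_apply, h0])
  have hstar : star (a.1 : Cliff V) * (a.1 : Cliff V) = 1 := by
    have := congrArg Units.val a.2.1
    rw [Units.coe_star] at this
    rw [this, Units.inv_mul]
  rw [hr, CliffordAlgebra.star_smul, star_one, smul_mul_smul_comm, one_mul] at hstar
  have hinj : Function.Injective (algebraMap ℝ (Cliff V)) :=
    (algebraMap ℝ (Cliff V)).injective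
  have hrr : r * r = 1 := hinj (by rw [map_one, Algebra.algebraMap_eq_smul_one, hstar])
  rcases mul_self_eq_one_iff.1 hrr with h | h
  · left
    refine pinCover_ext ?_
    rw [hr, h, one_smul]
    rfl
  · right
    refine pinCover_ext ?_
    rw [hr, h, neg_smul, one_smul]
    change _ = ((-1 : (Cliff V)ˣ) : Cliff V)
    simp

theorem eq_or_eq_negOne_mul (hdual : DualBases e e') {a c : pinCover P}
    (h : proj P a = proj P c) : a = c ∨ a = negOne P * c := by
  have h1 : proj P (a * c⁻¹) = 1 := by rw [map_mul, map_inv, h, mul_inv_cancel]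
  rcases eq_one_or_negOne hdual h1 with h2 | h2
  · left
    exact mul_inv_eq_one.1 h2
  · right
    exact mul_inv_eq_iff_eq_mul.1 h2

theorem negOne_mul_ne (a : pinCover P) : negOne P * a ≠ a := by
  intro h
  have h1 := congrArg (fun a : pinCover P => (a.1 : Cliff V)) h
  simp only [coe_negOne_mul] at h1
  have h2 : (2 : ℝ) • (a.1 : Cliff V) = 0 := by
    rw [two_smul]
    nth_rewrite 1 [← h1]
    exact neg_add_cancel _
  rcases smul_eq_zero.1 h2 with h3 | h3
  · norm_num at h3
  · exact a.1.ne_zero h3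

theorem finite_pinCover (hdual : DualBases e e') [Finite (weyl P)] : Finite (pinCover P) := by
  refine Set.finite_univ_iff.1 <|
    Set.Finite.of_finite_fibers (proj P) (Set.toFinite _) fun w _ => ?_
  by_cases hw : ∃ a, proj P a = w
  · obtain ⟨a, rfl⟩ := hw
    refine Set.Finite.subset (Set.toFinite {a, negOne P * a}) fun c hc => ?_
    exact eq_or_eq_negOne_mul hdual hc.2
  · refine Set.Finite.subset Set.finite_empty fun c hc => ?_
    exact hw ⟨c, hc.2⟩

end PinCover

/-- Since D is odd, d² x is the commutator of D² with x. This is the case of even x; the next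
identity is the odd case. -/
theorem sub_sub_mul_eq_zero {E : Type*} [Ring E] {D x : E} (h : D * D * x = x * (D * D)) :
    D * (D * x - x * D) - (-D * x - x * -D) * D = 0 := by
  have : D * (D * x - x * D) - (-D * x - x * -D) * D = D * D * x - x * (D * D) := by noncomm_ring
  rw [this, h, sub_self]

theorem sub_neg_sub_mul_eq_zero {E : Type*} [Ring E] {D x : E} (h : D * D * x = x * (D * D)) :
    D * (D * x - -x * D) - (-D * -x - - -x * -D) * D = 0 := by
  have : D * (D * x - -x * D) - (-D * -x - - -x * -D) * D = D * D * x - x * (D * D) := by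
    noncomm_ring
  rw [this, h, sub_self]

/-! ### The Dirac element, its square, and the invariant complex -/

section Dirac

variable {ι κ V V' : Type*} [NormedAddCommGroup V] [InnerProductSpace ℝ V]
  [AddCommGroup V'] [Module ℝ V']
variable {P : RootPairing ι ℝ V V'} (b : P.Base)

theorem heckeCliff_neg_mul (x y : HeckeCliff b) : -x * y = -(x * y) := neg_mul x y

theorem heckeCliff_mul_neg (x y : HeckeCliff b) : x * -y = -(x * y) := mul_neg x y

/-- The parity automorphism of `H_A ⊗ C(V)`. -/
def par : HeckeCliff b →ₐ[ℝ] HeckeCliff b :=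
  Algebra.TensorProduct.map (AlgHom.id ℝ (Hecke b)) CliffordAlgebra.involute

theorem par_tmul (h : Hecke b) (c : Cliff V) :
    par b (h ⊗ₜ c) = h ⊗ₜ CliffordAlgebra.involute c := rfl

theorem par_par (x : HeckeCliff b) : par b (par b x) = x := by
  induction x using TensorProduct.induction_on with
  | zero => simp
  | add x y hx hy => rw [map_add, map_add, hx, hy]
  | tmul h c => rw [par_tmul, par_tmul, CliffordAlgebra.involute_involute]

theorem par_smul (a : ParamRing P) (x : HeckeCliff b) : par b (a • x) = a • par b x := by
  induction x using TensorProduct.induction_on with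
  | zero => simp
  | add x y hx hy => rw [smul_add, map_add, map_add, hx, hy, smul_add]
  | tmul h c => rw [TensorProduct.smul_tmul', par_tmul, par_tmul, TensorProduct.smul_tmul']

/-- The image of an element of the pin cover under the diagonal homomorphism. -/
def grp : pinCover P →* HeckeCliff b where
  toFun a := Hecke.ofW b (proj P a) ⊗ₜ[ℝ] (a.1 : Cliff V)
  map_one' := by simp [Algebra.TensorProduct.one_def]
  map_mul' a c := by simp

theorem grp_apply (a : pinCover P) :
    grp b a = Hecke.ofW b (proj P a) ⊗ₜ[ℝ] (a.1 : Cliff V) := rfl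

theorem rho_single (a : pinCover P) (r : ParamRing P) :
    rho b (MonoidAlgebra.single a r) = r • grp b a :=
  MonoidAlgebra.lift_single _ _ _

theorem rho_of (a : pinCover P) : rho b (MonoidAlgebra.of _ _ a) = grp b a :=
  MonoidAlgebra.lift_of _ _

theorem grp_negOne : grp b (negOne P) = -1 := by
  rw [grp_apply, proj_negOne, map_one]
  change (1 : Hecke b) ⊗ₜ[ℝ] ((-1 : (Cliff V)ˣ) : Cliff V) = _
  rw [Units.val_neg, Units.val_one, TensorProduct.tmul_neg, Algebra.TensorProduct.one_def]

theorem grp_mul_grp_inv (a : pinCover P) : grp b a * grp b a⁻¹ = 1 := by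
  rw [← map_mul, mul_inv_cancel, map_one]

theorem grp_inv_mul_grp (a : pinCover P) : grp b a⁻¹ * grp b a = 1 := by
  rw [← map_mul, inv_mul_cancel, map_one]

section Dual

variable [Fintype κ] [DecidableEq κ] {e e' : Module.Basis κ ℝ V}

/-- The canonical tensor `∑ e_i ⊗ e'_i` is invariant. -/
theorem sum_dual_invariant (hdual : DualBases e e') (hinv : InvariantInner P) (w : weyl P)
    {M : Type*} [AddCommGroup M] [Module ℝ M] (B : V →ₗ[ℝ] V →ₗ[ℝ] M) :
    ∑ i, B (w.1 (e i)) (w.1 (e' i)) = ∑ i, B (e i) (e' i) := by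
  have h1 : ∀ i, B (w.1 (e i)) (w.1 (e' i)) =
      ∑ j, (inner ℝ (w.1 (e i)) (e' j) : ℝ) • B (e j) (w.1 (e' i)) := by
    intro i
    conv_lhs => rw [← sum_inner_smul_left hdual (w.1 (e i))]
    simp [LinearMap.sum_apply]
  simp only [h1]
  rw [Finset.sum_comm]
  refine Finset.sum_congr rfl fun j _ => ?_
  simp only [← map_smul, ← map_sum]
  congr 1
  have h2 : ∀ i, (inner ℝ (w.1 (e i)) (e' j) : ℝ) = inner ℝ ((w⁻¹ : weyl P).1 (e' j)) (e i) := by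
    intro i
    have := hinv _ w.2 (e i) ((w⁻¹ : weyl P).1 (e' j))
    rw [show w.1 ((w⁻¹ : weyl P).1 (e' j)) = e' j from w.1.apply_symm_apply _] at this
    rw [this, real_inner_comm]
  simp only [h2]
  rw [sum_inner_smul_right hdual]
  exact w.1.apply_symm_apply _

/-- The element ε(a) again lies in the pin cover, above the same element of W, so it is a or −a. -/
theorem par_grp_eq_or (hdual : DualBases e e') (a : pinCover P) :
    par b (grp b a) = grp b a ∨ par b (grp b a) = -grp b a := by
  have hcov : Covers P (Units.map (CliffordAlgebra.involute (Q := negForm V)) a.1) (proj P a) := by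
    intro v
    have h := congrArg (CliffordAlgebra.involute (Q := negForm V)) (proj_spec a v)
    simp only [map_mul, CliffordAlgebra.involute_ι, mul_neg, neg_mul, neg_inj] at h
    exact h
  let c : pinCover P := ⟨Units.map (CliffordAlgebra.involute (Q := negForm V)) a.1, by
    refine ⟨?_, _, hcov⟩
    ext
    have h := congrArg (fun u : (Cliff V)ˣ => CliffordAlgebra.involute (u : Cliff V)) a.2.1
    simp only [Units.coe_star, CliffordAlgebra.star_def] at h
    change star (CliffordAlgebra.involute (a.1 : Cliff V)) =
      CliffordAlgebra.involute ((a.1⁻¹ : (Cliff V)ˣ) : Cliff V)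
    rw [CliffordAlgebra.star_def, ← h, CliffordAlgebra.reverse_involute]⟩
  have hc : proj P c = proj P a := proj_eq_of_covers hcov
  rcases eq_or_eq_negOne_mul hdual hc with h | h
  · left
    rw [grp_apply, par_tmul]
    exact congrArg (fun u : pinCover P => Hecke.ofW b (proj P a) ⊗ₜ[ℝ] (u.1 : Cliff V)) h
  · right
    rw [grp_apply, par_tmul, ← TensorProduct.tmul_neg]
    have := congrArg (fun u : pinCover P => (u.1 : Cliff V)) h
    rw [coe_negOne_mul] at this
    exact congrArg (fun u => Hecke.ofW b (proj P a) ⊗ₜ[ℝ] u) this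

theorem par_grp_inv_of_eq {a : pinCover P} (h : par b (grp b a) = grp b a) :
    par b (grp b a⁻¹) = grp b a⁻¹ := by
  have h1 := congrArg (par b) (grp_mul_grp_inv b a)
  rw [map_mul, h, map_one] at h1
  rw [← one_mul (par b _), ← grp_inv_mul_grp b a, mul_assoc, h1, mul_one]

theorem par_grp_inv_of_eq_neg {a : pinCover P} (h : par b (grp b a) = -grp b a) :
    par b (grp b a⁻¹) = -grp b a⁻¹ := by
  have h1 := congrArg (par b) (grp_mul_grp_inv b a)
  rw [map_mul, h, map_one, heckeCliff_neg_mul, neg_eq_iff_eq_neg] at h1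
  rw [← one_mul (par b _), ← grp_inv_mul_grp b a, mul_assoc, h1, heckeCliff_mul_neg, mul_one]

end Dual

variable [Fintype ι] [Fintype κ]

/-- The polynomial part `∑ ξ_i ⊗ ξ^i` of the Dirac element. -/
def diracPoly (e e' : κ → V) : HeckeCliff b := ∑ i, Hecke.ofV b (e i) ⊗ₜ[ℝ] cl V (e' i)

/-- The part of the Dirac element coming from the group algebra, up to sign. -/
def diracGrp (hinv : InvariantInner P) : HeckeCliff b :=
  ∑ i ∈ posRoots b, ‖P.root i‖⁻¹ • k P i • grp b (reflLift hinv i)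

theorem par_dirac (e e' : κ → V) : par b (dirac b e e') = -dirac b e e' := by
  simp only [dirac, map_sum, par_tmul, CliffordAlgebra.involute_ι, TensorProduct.tmul_neg,
    Finset.sum_neg_distrib]

theorem par_grp_reflLift (hinv : InvariantInner P) (i : ι) :
    par b (grp b (reflLift hinv i)) = -grp b (reflLift hinv i) := by
  rw [grp_apply, par_tmul, reflLift_coe, CliffordAlgebra.involute_ι, TensorProduct.tmul_neg]

/-- The differential `x ↦ D x - ε(x) D`. -/
def diff (D : HeckeCliff b) : HeckeCliff b →ₗ[ℝ] HeckeCliff b :=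
  LinearMap.mulLeft ℝ D - LinearMap.mulRight ℝ D ∘ₗ (par b).toLinearMap

theorem diff_apply (D x : HeckeCliff b) : diff b D x = D * x - par b x * D := rfl

section Square

variable [P.IsCrystallographic] [P.IsReduced] [DecidableEq κ] {e e' : Module.Basis κ ℝ V}

/-- D may be written with the dual bases translated by p(a). Then p(a) passes ξ − T_ξ by
equivariance, and ε(a) passes each vector by the definition of the cover. -/
theorem par_grp_mul_dirac (hdual : DualBases e e') (hinv : InvariantInner P) (a : pinCover P) :
    par b (grp b a) * dirac b e e' = dirac b e e' * grp b a := by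
  have hD : dirac b e e' = ∑ i, Hecke.tilde b ((proj P a).1 (e i)) ⊗ₜ[ℝ]
      cl V ((proj P a).1 (e' i)) := by
    let B : V →ₗ[ℝ] V →ₗ[ℝ] HeckeCliff b :=
      (TensorProduct.mk ℝ (Hecke b) (Cliff V)).compl₁₂ (Hecke.tildeₗ b) (cl V)
    have hB : ∀ x y, B x y = Hecke.tilde b x ⊗ₜ[ℝ] cl V y := by
      intro x y
      simp [B, Hecke.tildeₗ_apply]
    have := sum_dual_invariant hdual hinv (proj P a) B
    simp only [hB] at this
    exact this.symm
  conv_rhs => rw [hD]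
  rw [dirac, Finset.mul_sum, Finset.sum_mul]
  refine Finset.sum_congr rfl fun i _ => ?_
  rw [grp_apply, par_tmul, Algebra.TensorProduct.tmul_mul_tmul,
    Algebra.TensorProduct.tmul_mul_tmul, Hecke.ofW_mul_tilde, involute_mul_cl]

theorem dirac_mul_par_grp (hdual : DualBases e e') (hinv : InvariantInner P) (a : pinCover P) :
    dirac b e e' * par b (grp b a) = grp b a * dirac b e e' := by
  have := congrArg (fun x => -par b x) (par_grp_mul_dirac b hdual hinv a)
  simp only [map_mul, par_par, par_dirac, heckeCliff_mul_neg, heckeCliff_neg_mul, neg_neg] at this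
  exact this.symm

theorem diff_mul_grp (hdual : DualBases e e') (hinv : InvariantInner P) (x : HeckeCliff b)
    (a : pinCover P) :
    diff b (dirac b e e') (x * grp b a) = diff b (dirac b e e') x * grp b a := by
  rw [diff_apply, diff_apply, map_mul, mul_assoc (par b x), par_grp_mul_dirac b hdual hinv,
    sub_mul, mul_assoc, mul_assoc]

/-- Contracting the dual bases turns ½ ∑ (ξ_j, β^∨) ξ^j into β/|β|², which is |β|⁻¹ times the unit
vector lifting s_β. So the T part of D is the image of an element of A[W̃]. -/
theorem dirac_eq (hdual : DualBases e e') (hinv : InvariantInner P) :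
    dirac b e e' = diracPoly b e e' - diracGrp b hinv := by
  have hT : ∑ i, Hecke.T b (e i) ⊗ₜ[ℝ] cl V (e' i) = diracGrp b hinv := by
    have hβ : ∀ i, ∑ j, P.toLinearMap (e j) (P.coroot i) • cl V (e' j) =
        (2 : ℝ) • ‖P.root i‖⁻¹ • cl V (‖P.root i‖⁻¹ • P.root i) := by
      intro i
      have hne : ‖P.root i‖ ≠ 0 := norm_ne_zero_iff.2 (P.ne_zero i)
      have hp : ∀ j, P.toLinearMap (e j) (P.coroot i) =
          (2 * (‖P.root i‖⁻¹ * ‖P.root i‖⁻¹)) * inner ℝ (P.root i) (e j) := by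
        intro j
        have h := pairing_mul_inner_self hinv i (e j)
        rw [real_inner_self_eq_norm_sq] at h
        rw [real_inner_comm, mul_right_comm, ← h]
        field_simp
      simp only [hp, mul_smul (2 * (‖P.root i‖⁻¹ * ‖P.root i‖⁻¹)), ← Finset.smul_sum, ← map_smul,
        ← map_sum]
      rw [sum_inner_smul_right hdual]
      simp only [mul_smul]
    have hTi : ∀ i, Hecke.T b (e i) ⊗ₜ[ℝ] cl V (e' i) = (1 / 2 : ℝ) • ∑ j ∈ posRoots b,
        (k P j • Hecke.ofW b (refl P j)) ⊗ₜ[ℝ]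
          (P.toLinearMap (e i) (P.coroot j) • cl V (e' i)) := by
      intro i
      rw [Hecke.T_eq, ← TensorProduct.smul_tmul', TensorProduct.sum_tmul]
      simp only [TensorProduct.tmul_smul, TensorProduct.smul_tmul']
    simp only [hTi]
    rw [← Finset.smul_sum, Finset.sum_comm, diracGrp, Finset.smul_sum]
    refine Finset.sum_congr rfl fun i _ => ?_
    rw [← TensorProduct.tmul_sum, hβ, TensorProduct.tmul_smul, TensorProduct.tmul_smul, smul_smul,
      grp_apply, proj_reflLift, reflLift_coe, TensorProduct.smul_tmul' (k P i),
      show (1 / 2 * 2 : ℝ) = 1 by norm_num, one_smul]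
  rw [← hT, diracPoly, ← Finset.sum_sub_distrib, dirac]
  refine Finset.sum_congr rfl fun i _ => ?_
  rw [Hecke.tilde, TensorProduct.sub_tmul]

theorem dirac_mul_diracGrp (hdual : DualBases e e') (hinv : InvariantInner P) :
    dirac b e e' * diracGrp b hinv = -(diracGrp b hinv * dirac b e e') := by
  rw [diracGrp, Finset.mul_sum, Finset.sum_mul, ← Finset.sum_neg_distrib]
  refine Finset.sum_congr rfl fun i _ => ?_
  rw [mul_smul_comm, mul_smul_comm, ← par_grp_mul_dirac b hdual hinv, par_grp_reflLift,
    smul_mul_assoc, smul_mul_assoc, heckeCliff_neg_mul, smul_neg, smul_neg]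

/-- Vectors commute in H_A, so the square may be symmetrized in the Clifford factor. What remains is
−∑ ξ_i ξ^i ⊗ 1, whose first factor is a W-invariant polynomial and therefore central. -/
theorem commute_diracPoly_sq (hdual : DualBases e e') (hinv : InvariantInner P)
    (x : HeckeCliff b) : Commute (diracPoly b e e' * diracPoly b e e') x := by
  set Ω : Hecke b := Hecke.ofSym b (∑ i, vec (e i) * vec (e' i)) with hΩ
  have hcentral : ∀ h, Commute Ω h := by
    refine Hecke.commute_ofSym b fun i _ => ?_
    rw [map_sum]
    simp only [map_mul, symAct_vec]
    have := sum_dual_invariant hdual hinv (refl P i)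
      ((LinearMap.mul ℝ (Sym V)).compl₁₂ (vecₗ V) (vecₗ V))
    simp only [LinearMap.compl₁₂_apply, vecₗ_apply, LinearMap.mul_apply'] at this
    exact this
  have hsq : diracPoly b e e' * diracPoly b e e' = -(Ω ⊗ₜ 1) := by
    have h1 : diracPoly b e e' * diracPoly b e e' = ∑ i, ∑ j,
        (Hecke.ofV b (e i) * Hecke.ofV b (e j)) ⊗ₜ[ℝ] (cl V (e' i) * cl V (e' j)) := by
      rw [diracPoly, Finset.sum_mul_sum]
      simp only [Algebra.TensorProduct.tmul_mul_tmul]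
    have h2 : diracPoly b e e' * diracPoly b e e' = ∑ i, ∑ j,
        (Hecke.ofV b (e i) * Hecke.ofV b (e j)) ⊗ₜ[ℝ] (cl V (e' j) * cl V (e' i)) := by
      rw [h1, Finset.sum_comm]
      refine Finset.sum_congr rfl fun i _ => Finset.sum_congr rfl fun j _ => ?_
      rw [Hecke.ofV_comm]
    have h3 : (2 : ℝ) • (diracPoly b e e' * diracPoly b e e') = (2 : ℝ) • -(Ω ⊗ₜ 1) := by
      rw [two_smul]
      nth_rewrite 1 [h1]
      rw [h2, ← Finset.sum_add_distrib]
      simp only [← Finset.sum_add_distrib, ← TensorProduct.tmul_add, cl_mul_cl_add_swap]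
      rw [hΩ, map_sum, TensorProduct.sum_tmul, ← Finset.sum_neg_distrib, Finset.smul_sum]
      refine Finset.sum_congr rfl fun i _ => ?_
      rw [map_mul, Hecke.ofSym_vec, Hecke.ofSym_vec]
      conv_rhs => rw [← sum_inner_smul_left hdual (e' i)]
      rw [← Hecke.ofVₗ_apply b (∑ j, _), map_sum, Finset.mul_sum, TensorProduct.sum_tmul,
        ← Finset.sum_neg_distrib, Finset.smul_sum]
      refine Finset.sum_congr rfl fun j _ => ?_
      rw [map_smul, Hecke.ofVₗ_apply, mul_smul_comm, Algebra.algebraMap_eq_smul_one,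
        TensorProduct.tmul_smul, ← TensorProduct.smul_tmul']
      module
    exact smul_right_injective _ (two_ne_zero' ℝ) h3
  rw [hsq]
  rw [commute_iff_eq, heckeCliff_neg_mul, heckeCliff_mul_neg, neg_inj]
  induction x using TensorProduct.induction_on with
  | zero => rw [mul_zero, zero_mul]
  | add x y hx hy => rw [mul_add, add_mul, hx, hy]
  | tmul h c =>
    rw [Algebra.TensorProduct.tmul_mul_tmul, Algebra.TensorProduct.tmul_mul_tmul,
      (hcentral h).eq, one_mul, mul_one]

theorem dirac_sq (hdual : DualBases e e') (hinv : InvariantInner P) :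
    dirac b e e' * dirac b e e' =
      diracPoly b e e' * diracPoly b e e' - diracGrp b hinv * diracGrp b hinv := by
  have h : diracPoly b e e' = dirac b e e' + diracGrp b hinv := by
    rw [dirac_eq b hdual hinv, sub_add_cancel]
  rw [h, mul_add, add_mul, add_mul, dirac_mul_diracGrp b hdual hinv]
  abel

end Square

/-- The even invariants. -/
def evenInv : Submodule ℝ (HeckeCliff b) where
  carrier := {x | par b x = x ∧ ∀ a, grp b a * x = x * grp b a}
  zero_mem' := by simp
  add_mem' := by
    rintro x y ⟨hx, hx'⟩ ⟨hy, hy'⟩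
    exact ⟨by rw [map_add, hx, hy], fun a => by rw [mul_add, add_mul, hx', hy']⟩
  smul_mem' := by
    rintro r x ⟨hx, hx'⟩
    exact ⟨by rw [map_smul, hx], fun a => by rw [mul_smul_comm, smul_mul_assoc, hx']⟩

/-- The odd elements that are invariant up to the sign character. -/
def oddInv : Submodule ℝ (HeckeCliff b) where
  carrier := {x | par b x = -x ∧ ∀ a, par b (grp b a) * x = x * grp b a}
  zero_mem' := by simp
  add_mem' := by
    rintro x y ⟨hx, hx'⟩ ⟨hy, hy'⟩
    exact ⟨by rw [map_add, hx, hy, neg_add], fun a => by rw [mul_add, add_mul, hx', hy']⟩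
  smul_mem' := by
    rintro r x ⟨hx, hx'⟩
    exact ⟨by rw [map_smul, hx, smul_neg], fun a => by rw [mul_smul_comm, smul_mul_assoc, hx']⟩

section Complex

variable [P.IsCrystallographic] [P.IsReduced] [DecidableEq κ] {e e' : Module.Basis κ ℝ V}

theorem diff_diff_of_mem_evenInv (hdual : DualBases e e') (hinv : InvariantInner P)
    {x : HeckeCliff b} (hx : x ∈ evenInv b) :
    diff b (dirac b e e') (diff b (dirac b e e') x) = 0 := by
  have hθ : diracGrp b hinv * x = x * diracGrp b hinv := by
    rw [diracGrp, Finset.sum_mul, Finset.mul_sum]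
    refine Finset.sum_congr rfl fun i _ => ?_
    rw [smul_mul_assoc, smul_mul_assoc, hx.2, mul_smul_comm, mul_smul_comm]
  have hsq : dirac b e e' * dirac b e e' * x = x * (dirac b e e' * dirac b e e') := by
    rw [dirac_sq b hdual hinv, sub_mul, mul_sub, (commute_diracPoly_sq b hdual hinv x).eq,
      mul_assoc (diracGrp b hinv), hθ, ← mul_assoc (diracGrp b hinv), hθ, mul_assoc x]
  rw [diff_apply b _ x, hx.1, diff_apply, map_sub, map_mul, map_mul, par_dirac, hx.1]
  exact sub_sub_mul_eq_zero hsq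

/-- Here G anticommutes with x, where on even invariants it commutes; in both cases G², hence D²,
commutes with x. -/
theorem diff_diff_of_mem_oddInv (hdual : DualBases e e') (hinv : InvariantInner P)
    {x : HeckeCliff b} (hx : x ∈ oddInv b) :
    diff b (dirac b e e') (diff b (dirac b e e') x) = 0 := by
  have hθ : diracGrp b hinv * x = -(x * diracGrp b hinv) := by
    rw [diracGrp, Finset.sum_mul, Finset.mul_sum, ← Finset.sum_neg_distrib]
    refine Finset.sum_congr rfl fun i _ => ?_
    have := hx.2 (reflLift hinv i)
    rw [par_grp_reflLift, heckeCliff_neg_mul] at this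
    rw [smul_mul_assoc, smul_mul_assoc, mul_smul_comm, mul_smul_comm, ← this, smul_neg, smul_neg,
      neg_neg]
  have hsq : dirac b e e' * dirac b e e' * x = x * (dirac b e e' * dirac b e e') := by
    rw [dirac_sq b hdual hinv, sub_mul, mul_sub, (commute_diracPoly_sq b hdual hinv x).eq,
      mul_assoc (diracGrp b hinv), hθ, heckeCliff_mul_neg, ← mul_assoc (diracGrp b hinv), hθ,
      heckeCliff_neg_mul, neg_neg, mul_assoc x]
  rw [diff_apply b _ x, hx.1, diff_apply, map_sub, map_mul, map_mul, par_dirac, map_neg, hx.1]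
  exact sub_neg_sub_mul_eq_zero hsq

variable [Fintype (pinCover P)]

/-- The projection on the even invariants. -/
def evenAvg : HeckeCliff b →ₗ[ℝ] HeckeCliff b :=
  (Fintype.card (pinCover P) : ℝ)⁻¹ • ∑ a : pinCover P,
    LinearMap.mulLeft ℝ (grp b a) ∘ₗ LinearMap.mulRight ℝ (grp b a⁻¹) ∘ₗ
      ((1 / 2 : ℝ) • (LinearMap.id + (par b).toLinearMap))

/-- The projection on the odd elements that are invariant up to sign. -/
def oddAvg : HeckeCliff b →ₗ[ℝ] HeckeCliff b :=
  (Fintype.card (pinCover P) : ℝ)⁻¹ • ∑ a : pinCover P,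
    LinearMap.mulLeft ℝ (par b (grp b a)) ∘ₗ LinearMap.mulRight ℝ (grp b a⁻¹) ∘ₗ
      ((1 / 2 : ℝ) • (LinearMap.id - (par b).toLinearMap))

theorem evenAvg_apply (x : HeckeCliff b) :
    evenAvg b x = (Fintype.card (pinCover P) : ℝ)⁻¹ • ∑ a : pinCover P,
      grp b a * (((1 / 2 : ℝ) • (x + par b x)) * grp b a⁻¹) := by
  simp [evenAvg, LinearMap.sum_apply]

theorem oddAvg_apply (x : HeckeCliff b) :
    oddAvg b x = (Fintype.card (pinCover P) : ℝ)⁻¹ • ∑ a : pinCover P,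
      par b (grp b a) * (((1 / 2 : ℝ) • (x - par b x)) * grp b a⁻¹) := by
  rw [oddAvg, LinearMap.smul_apply, LinearMap.sum_apply]
  rfl

theorem card_inv_smul_sum_const (x : HeckeCliff b) :
    (Fintype.card (pinCover P) : ℝ)⁻¹ • ∑ _a : pinCover P, x = x := by
  rw [Finset.sum_const, Finset.card_univ, ← Nat.cast_smul_eq_nsmul ℝ, inv_smul_smul₀]
  exact Nat.cast_ne_zero.2 Fintype.card_ne_zero

theorem evenAvg_of_mem {x : HeckeCliff b} (hx : x ∈ evenInv b) : evenAvg b x = x := by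
  have h : (1 / 2 : ℝ) • (x + x) = x := by module
  rw [evenAvg_apply, hx.1, h]
  simp only [← mul_assoc, hx.2, mul_assoc x, grp_mul_grp_inv, mul_one]
  exact card_inv_smul_sum_const b x

theorem oddAvg_of_mem {x : HeckeCliff b} (hx : x ∈ oddInv b) : oddAvg b x = x := by
  have h : (1 / 2 : ℝ) • (x - -x) = x := by module
  rw [oddAvg_apply, hx.1, h]
  simp only [← mul_assoc, hx.2, mul_assoc x, grp_mul_grp_inv, mul_one]
  exact card_inv_smul_sum_const b x

theorem oddAvg_mem (hdual : DualBases e e') (x : HeckeCliff b) : oddAvg b x ∈ oddInv b := by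
  set y : HeckeCliff b := (1 / 2 : ℝ) • (x - par b x) with hy
  have hpar : par b y = -y := by
    rw [hy, map_smul, map_sub, par_par, ← smul_neg, neg_sub]
  rw [oddAvg_apply, ← hy]
  refine Submodule.smul_mem _ _ ⟨?_, fun c => ?_⟩
  · rw [map_sum, ← Finset.sum_neg_distrib]
    refine Finset.sum_congr rfl fun a _ => ?_
    rw [map_mul, map_mul, hpar, par_par]
    rcases par_grp_eq_or b hdual a with h | h
    · rw [h, par_grp_inv_of_eq b h, heckeCliff_neg_mul, heckeCliff_mul_neg]
    · rw [h, par_grp_inv_of_eq_neg b h]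
      simp only [heckeCliff_mul_neg, heckeCliff_neg_mul, neg_neg]
  · rw [Finset.mul_sum, Finset.sum_mul]
    refine Fintype.sum_equiv (Equiv.mulLeft c) _ _ fun a => ?_
    rw [Equiv.coe_mulLeft, map_mul (grp b), map_mul (par b), mul_inv_rev, map_mul (grp b)]
    simp only [mul_assoc, grp_inv_mul_grp, mul_one]

theorem evenAvg_mem (hdual : DualBases e e') (x : HeckeCliff b) : evenAvg b x ∈ evenInv b := by
  set y : HeckeCliff b := (1 / 2 : ℝ) • (x + par b x) with hy
  have hpar : par b y = y := by
    rw [hy, map_smul, map_add, par_par, add_comm]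
  rw [evenAvg_apply, ← hy]
  refine Submodule.smul_mem _ _ ⟨?_, fun c => ?_⟩
  · rw [map_sum]
    refine Finset.sum_congr rfl fun a _ => ?_
    rcases par_grp_eq_or b hdual a with h | h
    · rw [map_mul, map_mul, hpar, h, par_grp_inv_of_eq b h]
    · rw [map_mul, map_mul, hpar, h, par_grp_inv_of_eq_neg b h, heckeCliff_mul_neg,
        heckeCliff_mul_neg, heckeCliff_neg_mul, neg_neg]
  · rw [Finset.mul_sum, Finset.sum_mul]
    refine Fintype.sum_equiv (Equiv.mulLeft c) _ _ fun a => ?_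
    rw [Equiv.coe_mulLeft, map_mul (grp b), mul_inv_rev, map_mul (grp b)]
    simp only [mul_assoc, grp_inv_mul_grp, mul_one]

/-- D passes each ρ(a) at the cost of ε, which exchanges twisted and untwisted conjugation. With
`diff_evenAvg` this allows any primitive to be replaced by an invariant one. -/
theorem diff_oddAvg (hdual : DualBases e e') (hinv : InvariantInner P) (x : HeckeCliff b) :
    diff b (dirac b e e') (oddAvg b x) = evenAvg b (diff b (dirac b e e') x) := by
  set D := dirac b e e' with hD
  set y : HeckeCliff b := (1 / 2 : ℝ) • (x - par b x) with hy
  have hpar : par b y = -y := by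
    rw [hy, map_smul, map_sub, par_par, ← smul_neg, neg_sub]
  have hsym : (1 / 2 : ℝ) • (diff b D x + par b (diff b D x)) = D * y + y * D := by
    rw [diff_apply, map_sub, map_mul, map_mul, par_par, hD, par_dirac, heckeCliff_neg_mul,
      heckeCliff_mul_neg, hy, mul_smul_comm, smul_mul_assoc, mul_sub, sub_mul, ← smul_add]
    congr 1
    abel
  rw [oddAvg_apply, evenAvg_apply, ← hy, hsym, map_smul, map_sum]
  congr 1
  refine Finset.sum_congr rfl fun a _ => ?_
  rw [diff_apply, map_mul, map_mul, hpar, par_par, ← mul_assoc D, hD,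
    dirac_mul_par_grp b hdual hinv,
    mul_assoc (grp b a) (-y * _), mul_assoc (-y), par_grp_mul_dirac b hdual hinv]
  rw [heckeCliff_neg_mul, heckeCliff_mul_neg, sub_neg_eq_add, add_mul, mul_add]
  simp only [mul_assoc]


theorem diff_evenAvg (hdual : DualBases e e') (hinv : InvariantInner P) (x : HeckeCliff b) :
    diff b (dirac b e e') (evenAvg b x) = oddAvg b (diff b (dirac b e e') x) := by
  set D := dirac b e e' with hD
  set y : HeckeCliff b := (1 / 2 : ℝ) • (x + par b x) with hy
  have hpar : par b y = y := by
    rw [hy, map_smul, map_add, par_par, add_comm]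
  have hsym : (1 / 2 : ℝ) • (diff b D x - par b (diff b D x)) = D * y - y * D := by
    rw [diff_apply, map_sub, map_mul, map_mul, par_par, hD, par_dirac, heckeCliff_neg_mul,
      heckeCliff_mul_neg, hy, mul_smul_comm, smul_mul_assoc, mul_add, add_mul, ← smul_sub]
    congr 1
    abel
  rw [oddAvg_apply, evenAvg_apply, ← hy, hsym, map_smul, map_sum]
  congr 1
  refine Finset.sum_congr rfl fun a _ => ?_
  rw [diff_apply, map_mul, map_mul, hpar, ← mul_assoc D, hD, ← par_grp_mul_dirac b hdual hinv a,
    mul_assoc (par b (grp b a)) (y * _), mul_assoc y, par_grp_mul_dirac b hdual hinv a⁻¹, sub_mul,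
    mul_sub]
  simp only [mul_assoc]

end Complex
end Dirac

/-! ### The filtration of H_A ⊗ C(V) -/

section CliffordFiltration

variable {ι κ V V' : Type*} [NormedAddCommGroup V] [InnerProductSpace ℝ V]
  [AddCommGroup V'] [Module ℝ V']
variable {P : RootPairing ι ℝ V V'} (b : P.Base)

/-- The filtration of `H_A ⊗ C(V)` by the degree in `V` of the first factor. -/
def cliffFilt (n : ℕ) : Submodule ℝ (HeckeCliff b) :=
  Submodule.map₂ (TensorProduct.mk ℝ (Hecke b) (Cliff V)) ((filt b n).restrictScalars ℝ) ⊤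

variable {b} in
theorem tmul_mem_cliffFilt {n : ℕ} {h : Hecke b} (hh : h ∈ filt b n) (c : Cliff V) :
    h ⊗ₜ[ℝ] c ∈ cliffFilt b n :=
  Submodule.apply_mem_map₂ _ hh trivial

variable {b} in
theorem map_mem_of_mem_cliffFilt {M : Type*} [AddCommGroup M] [Module ℝ M]
    (f : HeckeCliff b →ₗ[ℝ] M) {S : Submodule ℝ M} {n : ℕ}
    (hf : ∀ h ∈ filt b n, ∀ c, f (h ⊗ₜ c) ∈ S) {x : HeckeCliff b} (hx : x ∈ cliffFilt b n) :
    f x ∈ S :=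
  (Submodule.map₂_le.2 fun h hh c _ => hf h hh c : cliffFilt b n ≤ S.comap f) hx

theorem cliffFilt_mono {m n : ℕ} (h : m ≤ n) : cliffFilt b m ≤ cliffFilt b n :=
  Submodule.map₂_le_map₂_left (filt_mono b h)

theorem par_mem_cliffFilt {n : ℕ} {x : HeckeCliff b} (hx : x ∈ cliffFilt b n) :
    par b x ∈ cliffFilt b n :=
  map_mem_of_mem_cliffFilt (par b).toLinearMap (fun _ hh _ => tmul_mem_cliffFilt hh _) hx

theorem smul_mem_cliffFilt (r : ParamRing P) {n : ℕ} {x : HeckeCliff b} (hx : x ∈ cliffFilt b n) :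
    r • x ∈ cliffFilt b n := by
  let f : HeckeCliff b →ₗ[ℝ] HeckeCliff b :=
    { toFun := fun x => r • x
      map_add' := smul_add r
      map_smul' := fun t x => smul_comm r t x }
  refine map_mem_of_mem_cliffFilt f (fun h hh c => ?_) hx
  change r • (h ⊗ₜ[ℝ] c) ∈ _
  rw [TensorProduct.smul_tmul']
  exact tmul_mem_cliffFilt (Submodule.smul_mem _ r hh) c

theorem mul_grp_mem_cliffFilt (a : pinCover P) {n : ℕ} {x : HeckeCliff b}
    (hx : x ∈ cliffFilt b n) : x * grp b a ∈ cliffFilt b n := by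
  refine map_mem_of_mem_cliffFilt (LinearMap.mulRight ℝ (grp b a)) (fun h hh c => ?_) hx
  rw [LinearMap.mulRight_apply, grp_apply, Algebra.TensorProduct.tmul_mul_tmul]
  exact tmul_mem_cliffFilt (mul_ofW_mem_filt b _ hh) _

theorem grp_mem_cliffFilt (a : pinCover P) (n : ℕ) : grp b a ∈ cliffFilt b n :=
  tmul_mem_cliffFilt (groupSpan_le_filt b n (ofW_mem_groupSpan b _)) _

variable [Fintype ι] [P.IsCrystallographic] [P.IsReduced]

theorem exists_mem_cliffFilt (x : HeckeCliff b) : ∃ n, x ∈ cliffFilt b n := by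
  induction x using TensorProduct.induction_on with
  | zero => exact ⟨0, zero_mem _⟩
  | add x y hx hy =>
    obtain ⟨m, hm⟩ := hx
    obtain ⟨n, hn⟩ := hy
    exact ⟨max m n, add_mem (cliffFilt_mono b (le_max_left _ _) hm)
      (cliffFilt_mono b (le_max_right _ _) hn)⟩
  | tmul h c =>
    obtain ⟨n, hn⟩ := exists_mem_filt b h
    exact ⟨n, tmul_mem_cliffFilt hn c⟩

theorem grp_mul_mem_cliffFilt (a : pinCover P) {n : ℕ} {x : HeckeCliff b}
    (hx : x ∈ cliffFilt b n) : grp b a * x ∈ cliffFilt b n := by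
  refine map_mem_of_mem_cliffFilt (LinearMap.mulLeft ℝ (grp b a)) (fun h hh c => ?_) hx
  rw [LinearMap.mulLeft_apply, grp_apply, Algebra.TensorProduct.tmul_mul_tmul]
  exact tmul_mem_cliffFilt (ofW_mul_mem_filt b _ hh) _

theorem diff_diracGrp_mem_cliffFilt (hinv : InvariantInner P) {n : ℕ} {x : HeckeCliff b}
    (hx : x ∈ cliffFilt b n) : diff b (diracGrp b hinv) x ∈ cliffFilt b n := by
  rw [diff_apply, diracGrp, Finset.sum_mul, Finset.mul_sum]
  refine sub_mem (Submodule.sum_mem _ fun i _ => ?_) (Submodule.sum_mem _ fun i _ => ?_)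
  · rw [smul_mul_assoc, smul_mul_assoc]
    exact Submodule.smul_mem _ _ (smul_mem_cliffFilt b _ (grp_mul_mem_cliffFilt b _ hx))
  · rw [mul_smul_comm, mul_smul_comm]
    exact Submodule.smul_mem _ _
      (smul_mem_cliffFilt b _ (mul_grp_mem_cliffFilt b _ (par_mem_cliffFilt b hx)))

theorem evenAvg_mem_cliffFilt [Fintype (pinCover P)] {n : ℕ} {x : HeckeCliff b}
    (hx : x ∈ cliffFilt b n) : evenAvg b x ∈ cliffFilt b n := by
  rw [evenAvg_apply]
  refine Submodule.smul_mem _ _ (Submodule.sum_mem _ fun a _ => ?_)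
  exact grp_mul_mem_cliffFilt b _ (mul_grp_mem_cliffFilt b _
    (Submodule.smul_mem _ _ (add_mem hx (par_mem_cliffFilt b hx))))

theorem oddAvg_mem_cliffFilt [Fintype (pinCover P)] {n : ℕ} {x : HeckeCliff b}
    (hx : x ∈ cliffFilt b n) : oddAvg b x ∈ cliffFilt b n := by
  rw [oddAvg_apply]
  refine Submodule.smul_mem _ _ (Submodule.sum_mem _ fun a _ => ?_)
  rw [← par_par b (((1 / 2 : ℝ) • (x - par b x)) * _), ← map_mul]
  exact par_mem_cliffFilt b (grp_mul_mem_cliffFilt b _ (par_mem_cliffFilt b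
    (mul_grp_mem_cliffFilt b _ (Submodule.smul_mem _ _ (sub_mem hx (par_mem_cliffFilt b hx))))))

end CliffordFiltration

/-! ### The symbol of d is the Koszul differential -/

section Symbol

variable {ι κ V V' : Type*} [NormedAddCommGroup V] [InnerProductSpace ℝ V]
  [AddCommGroup V'] [Module ℝ V']
variable {P : RootPairing ι ℝ V V'} (b : P.Base) (e : Module.Basis κ ℝ V)

variable [Fintype ι] [P.IsCrystallographic] [P.IsReduced]

/-- The map `S(V) ⊗ C(V) → H_A ⊗ C(V)`. -/
def ofPolyCliff : Poly P κ ⊗[ℝ] Cliff V →ₗ[ℝ] HeckeCliff b :=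
  ((ofPoly b e).toLinearMap.restrictScalars ℝ).rTensor (Cliff V)

theorem ofPolyCliff_tmul (p : Poly P κ) (c : Cliff V) :
    ofPolyCliff b e (p ⊗ₜ c) = ofPoly b e p ⊗ₜ c := rfl

theorem ofPolyCliff_homComp_mul_grp_mem (m : ℕ) (y : Poly P κ ⊗[ℝ] Cliff V) (a : pinCover P) :
    ofPolyCliff b e (homComp V κ (ParamRing P) m y) * grp b a ∈ cliffFilt b m := by
  induction y using TensorProduct.induction_on with
  | zero => simp
  | add y y' hy hy' =>
    rw [map_add, map_add, add_mul]
    exact add_mem hy hy'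
  | tmul p c =>
    rw [homComp_tmul, ofPolyCliff_tmul, grp_apply, Algebra.TensorProduct.tmul_mul_tmul]
    refine tmul_mem_cliffFilt (ofPoly_mul_ofW_mem_filt b e ((mem_degLT P).2 fun l hl => ?_) _) _
    rw [MvPolynomial.homogeneousComponent_of_mem
      (MvPolynomial.homogeneousComponent_isHomogeneous m p), if_neg (by omega)]

theorem ofPolyCliff_mul_grp_mem {n : ℕ} {y : Poly P κ ⊗[ℝ] Cliff V}
    (hy : ∀ m > n, homComp V κ (ParamRing P) m y = 0) (a : pinCover P) :
    ofPolyCliff b e y * grp b a ∈ cliffFilt b n := by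
  obtain ⟨N, hN⟩ := exists_sum_homComp y
  rw [← hN N le_rfl, map_sum, Finset.sum_mul]
  refine Submodule.sum_mem _ fun m _ => ?_
  by_cases hm : m ≤ n
  · exact cliffFilt_mono b hm (ofPolyCliff_homComp_mul_grp_mem b e m y a)
  · rw [hy m (not_le.1 hm), map_zero, zero_mul]
    exact zero_mem _

variable {e} {e' : Module.Basis κ ℝ V} [Fintype κ] [DecidableEq κ]

/-- Polynomials commute with the first factors of P, so only v c − ε(c) v = −2 δ_v(c) is left in the
Clifford factor. No lower-order terms appear. -/
theorem diff_diracPoly_ofPolyCliff (y : Poly P κ ⊗[ℝ] Cliff V) :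
    diff b (diracPoly b e e') (ofPolyCliff b e y) =
      -((2 : ℝ) • ofPolyCliff b e (koszul (ParamRing P) e' y)) := by
  induction y using TensorProduct.induction_on with
  | zero => simp
  | add y y' hy hy' => rw [map_add, map_add, hy, hy', map_add, map_add, smul_add, neg_add]
  | tmul p c =>
    rw [koszul_tmul, ofPolyCliff_tmul, map_sum, diff_apply, par_tmul, diracPoly, Finset.sum_mul,
      Finset.mul_sum, ← Finset.sum_sub_distrib, Finset.smul_sum, ← Finset.sum_neg_distrib]
    refine Finset.sum_congr rfl fun i _ => ?_
    rw [ofPolyCliff_tmul, Algebra.TensorProduct.tmul_mul_tmul,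
      Algebra.TensorProduct.tmul_mul_tmul, ← ofPoly_X b e i, ← map_mul, ← map_mul,
      mul_comm p, ← TensorProduct.tmul_sub, ← TensorProduct.tmul_smul, ← TensorProduct.tmul_neg,
      contr_apply]
    congr 1
    module

/-- By right linearity over the pin cover the group element plays no role, and the G part of D does
not raise the degree. So d agrees with −2 times the Koszul differential up to filtration degree n.
-/
theorem diff_ofPolyCliff_mul_grp (hdual : DualBases e e') (hinv : InvariantInner P) {n : ℕ}
    {y : Poly P κ ⊗[ℝ] Cliff V} (hy : ∀ m > n, homComp V κ (ParamRing P) m y = 0)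
    (a : pinCover P) :
    diff b (dirac b e e') (ofPolyCliff b e y * grp b a) +
      (2 : ℝ) • (ofPolyCliff b e (koszul (ParamRing P) e' y) * grp b a) ∈ cliffFilt b n := by
  have h1 : ofPolyCliff b e y ∈ cliffFilt b n := by
    simpa using ofPolyCliff_mul_grp_mem b e hy 1
  have h2 : diff b (dirac b e e') (ofPolyCliff b e y) =
      -((2 : ℝ) • ofPolyCliff b e (koszul (ParamRing P) e' y)) -
        diff b (diracGrp b hinv) (ofPolyCliff b e y) := by
    rw [← diff_diracPoly_ofPolyCliff, diff_apply, diff_apply, diff_apply, dirac_eq b hdual hinv,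
      sub_mul, mul_sub]
    abel
  rw [diff_mul_grp b hdual hinv, ← smul_mul_assoc, ← add_mul, h2]
  refine mul_grp_mem_cliffFilt b a ?_
  convert neg_mem (diff_diracGrp_mem_cliffFilt b hinv h1) using 1
  abel

variable [Fintype (weyl P)] (e) (s : weyl P → pinCover P)

/-- The coordinate at `w` of an element of `H_A ⊗ C(V)`, with respect to a lift of `w` to the
pin cover. -/
def coord (w : weyl P) : HeckeCliff b →ₗ[ℝ] Poly P κ ⊗[ℝ] Cliff V :=
  TensorProduct.map ((coeffW b e w).restrictScalars ℝ)
    (LinearMap.mulRight ℝ (((s w)⁻¹ : pinCover P).1 : Cliff V))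

theorem coord_tmul (w : weyl P) (h : Hecke b) (c : Cliff V) :
    coord b e s w (h ⊗ₜ c) =
      coeffW b e w h ⊗ₜ (c * (((s w)⁻¹ : pinCover P).1 : Cliff V)) := rfl

variable {s}

/-- Expanding in ρ(s w), rather than in w ⊗ 1, is what makes the symbol of d act separately on each
coordinate. -/
theorem sum_coord (hs : ∀ w, proj P (s w) = w) (x : HeckeCliff b) :
    ∑ w, ofPolyCliff b e (coord b e s w x) * grp b (s w) = x := by
  induction x using TensorProduct.induction_on with
  | zero => simp
  | add x y hx hy =>
    simp only [map_add, add_mul, Finset.sum_add_distrib]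
    rw [hx, hy]
  | tmul h c =>
    conv_rhs => rw [← sum_coeffW b e h, TensorProduct.sum_tmul]
    refine Finset.sum_congr rfl fun w _ => ?_
    rw [coord_tmul, ofPolyCliff_tmul, grp_apply, hs, Algebra.TensorProduct.tmul_mul_tmul, mul_assoc]
    congr 1
    change c * ((((s w).1)⁻¹ : (Cliff V)ˣ) * ((s w).1 : (Cliff V)ˣ) : Cliff V) = c
    rw [Units.inv_mul, mul_one]

theorem coord_ofPolyCliff_mul_grp [DecidableEq (weyl P)] (hs : ∀ w, proj P (s w) = w)
    (w u : weyl P) (y : Poly P κ ⊗[ℝ] Cliff V) :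
    coord b e s w (ofPolyCliff b e y * grp b (s u)) = if w = u then y else 0 := by
  induction y using TensorProduct.induction_on with
  | zero => simp
  | add y y' hy hy' =>
    rw [map_add, add_mul, map_add, hy, hy']
    split_ifs <;> simp
  | tmul p c =>
    rw [ofPolyCliff_tmul, grp_apply, hs, Algebra.TensorProduct.tmul_mul_tmul, coord_tmul,
      coeffW_ofPoly_mul_ofW]
    split_ifs with h
    · subst h
      congr 1
      rw [mul_assoc]
      change c * (((s w).1 : (Cliff V)ˣ) * (((s w).1)⁻¹ : (Cliff V)ˣ) : Cliff V) = c
      rw [Units.mul_inv, mul_one]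
    · rw [TensorProduct.zero_tmul]

theorem coord_sum (hs : ∀ w, proj P (s w) = w) (w : weyl P)
    (y : weyl P → Poly P κ ⊗[ℝ] Cliff V) :
    coord b e s w (∑ u, ofPolyCliff b e (y u) * grp b (s u)) = y w := by
  classical
  rw [map_sum]
  simp only [coord_ofPolyCliff_mul_grp b e hs]
  simp

theorem homComp_coord_eq_zero (w : weyl P) {m n : ℕ} (hmn : n < m) {x : HeckeCliff b}
    (hx : x ∈ cliffFilt b n) : homComp V κ (ParamRing P) m (coord b e s w x) = 0 := by
  have := map_mem_of_mem_cliffFilt (homComp V κ (ParamRing P) m ∘ₗ coord b e s w) (S := ⊥)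
    (fun h hh c => ?_) hx
  · simpa using this
  · rw [LinearMap.comp_apply, coord_tmul, homComp_tmul,
      (mem_degLT P).1 (coeffW_mem_degLT b e w hh) m hmn, TensorProduct.zero_tmul]
    exact zero_mem _

variable {e}

/-- In general d raises the filtration degree by one, through the Koszul differential of the top
components. If d(x) stays in degree n, these top components must be Koszul cycles. -/
theorem koszul_homComp_coord_eq_zero (hdual : DualBases e e') (hinv : InvariantInner P)
    (hs : ∀ w, proj P (s w) = w) {n : ℕ} {x : HeckeCliff b} (hx : x ∈ cliffFilt b n)
    (hdx : diff b (dirac b e e') x ∈ cliffFilt b n) (w : weyl P) :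
    koszul (ParamRing P) e' (homComp V κ (ParamRing P) n (coord b e s w x)) = 0 := by
  have h1 : ∑ u, (diff b (dirac b e e') (ofPolyCliff b e (coord b e s u x) * grp b (s u)) +
      (2 : ℝ) • (ofPolyCliff b e (koszul (ParamRing P) e' (coord b e s u x)) * grp b (s u))) ∈
      cliffFilt b n :=
    Submodule.sum_mem _ fun u _ => diff_ofPolyCliff_mul_grp b hdual hinv
      (fun m hm => homComp_coord_eq_zero b e u hm hx) (s u)
  rw [Finset.sum_add_distrib, ← map_sum, sum_coord b e hs, Submodule.add_mem_iff_right _ hdx,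
    ← Finset.smul_sum, Submodule.smul_mem_iff _ (two_ne_zero' ℝ)] at h1
  have h2 := homComp_coord_eq_zero b e (s := s) w (Nat.lt_succ_self n) h1
  rw [coord_sum b e hs] at h2
  rw [← homComp_koszul]
  exact h2

/-- A cocycle modulo lower degree is a coboundary modulo lower degree. -/
theorem exists_sub_diff_mem_cliffFilt (hdual : DualBases e e') (hinv : InvariantInner P) {n : ℕ}
    {x : HeckeCliff b} (hx : x ∈ cliffFilt b (n + 1))
    (hdx : diff b (dirac b e e') x ∈ cliffFilt b (n + 1)) :
    ∃ a ∈ cliffFilt b n, x - diff b (dirac b e e') a ∈ cliffFilt b n := by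
  obtain ⟨s, hs⟩ : ∃ s : weyl P → pinCover P, ∀ w, proj P (s w) = w :=
    ⟨Function.surjInv (proj_surjective hinv), Function.surjInv_eq _⟩
  choose y hy hky using fun w => koszul_exact hdual n
    (koszul_homComp_coord_eq_zero b hdual hinv hs hx hdx w)
  have hy' : ∀ w, ∀ m > n, homComp V κ (ParamRing P) m (y w) = 0 := by
    intro w m hm
    rw [← hy, homComp_homComp, if_neg (by omega)]
  -- The factor −1/2 inverts the −2 in the symbol of d.
  refine ⟨(-1 / 2 : ℝ) • ∑ w, ofPolyCliff b e (y w) * grp b (s w), Submodule.smul_mem _ _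
    (Submodule.sum_mem _ fun w _ => ofPolyCliff_mul_grp_mem b e (hy' w) _), ?_⟩
  have h1 : ∑ w, (diff b (dirac b e e') (ofPolyCliff b e (y w) * grp b (s w)) +
      (2 : ℝ) • (ofPolyCliff b e (koszul (ParamRing P) e' (y w)) * grp b (s w))) ∈
      cliffFilt b n :=
    Submodule.sum_mem _ fun u _ => diff_ofPolyCliff_mul_grp b hdual hinv (hy' u) (s u)
  have h2 : ∑ w, ofPolyCliff b e (coord b e s w x -
      homComp V κ (ParamRing P) (n + 1) (coord b e s w x)) * grp b (s w) ∈ cliffFilt b n := by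
    refine Submodule.sum_mem _ fun w _ => ofPolyCliff_mul_grp_mem b e (fun m hm => ?_) _
    rw [map_sub, homComp_homComp]
    split_ifs with h
    · rw [h, sub_self]
    · rw [homComp_coord_eq_zero b e w (by omega) hx, sub_zero]
  simp only [map_sub, sub_mul] at h2
  rw [Finset.sum_sub_distrib, sum_coord b e hs] at h2
  rw [Finset.sum_add_distrib, ← map_sum, ← Finset.smul_sum] at h1
  simp only [hky] at h1
  convert add_mem h2 (Submodule.smul_mem _ (1 / 2 : ℝ) h1) using 1
  rw [map_smul]
  module

/-- The cocycles of degree zero come from the group algebra of the pin cover. -/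
theorem exists_eq_rho (hdual : DualBases e e') (hinv : InvariantInner P)
    {x : HeckeCliff b} (hx : x ∈ cliffFilt b 0) (hdx : diff b (dirac b e e') x ∈ cliffFilt b 0) :
    ∃ c, x = rho b c := by
  obtain ⟨s, hs⟩ : ∃ s : weyl P → pinCover P, ∀ w, proj P (s w) = w :=
    ⟨Function.surjInv (proj_surjective hinv), Function.surjInv_eq _⟩
  choose r hr using fun w => koszul_exact_zero hdual
    (koszul_homComp_coord_eq_zero b hdual hinv hs hx hdx w)
  have hc : ∀ w, coord b e s w x = MvPolynomial.C (r w) ⊗ₜ 1 := by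
    intro w
    rw [← hr]
    obtain ⟨N, hN⟩ := exists_sum_homComp (coord b e s w x)
    -- Summing up to N + 1 guarantees that a term of degree 0 can be split off; all others vanish
    -- because x has filtration degree 0.
    rw [← hN (N + 1) (by omega), Finset.sum_range_succ', Finset.sum_eq_zero, zero_add]
    · rw [homComp_homComp, if_pos rfl]
    · intro m _
      exact homComp_coord_eq_zero b e w m.succ_pos hx
  refine ⟨∑ w, MonoidAlgebra.single (s w) (r w), ?_⟩
  conv_lhs => rw [← sum_coord b e hs x]
  rw [map_sum]
  refine Finset.sum_congr rfl fun w _ => ?_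
  rw [hc, rho_single, ofPolyCliff_tmul]
  change ofPoly b e (algebraMap (ParamRing P) _ (r w)) ⊗ₜ[ℝ] 1 * _ = _
  rw [AlgHom.commutes, Algebra.algebraMap_eq_smul_one, ← TensorProduct.smul_tmul',
    smul_mul_assoc, ← Algebra.TensorProduct.one_def, one_mul]

end Symbol

/-! ### The kernel of ρ and the cohomology of the invariant complex -/

section Kernel

variable {ι κ V V' : Type*} [NormedAddCommGroup V] [InnerProductSpace ℝ V]
  [AddCommGroup V'] [Module ℝ V']
variable {P : RootPairing ι ℝ V V'} (b : P.Base)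

theorem involute_sub_mem_odd (c : Cliff V) :
    c - CliffordAlgebra.involute c ∈ CliffordAlgebra.evenOdd (negForm V) 1 := by
  obtain ⟨c₀, h₀, c₁, h₁, rfl⟩ := Submodule.mem_sup.1
    ((CliffordAlgebra.evenOdd_isCompl (negForm V)).sup_eq_top ▸ (Submodule.mem_top : c ∈ ⊤))
  rw [map_add, CliffordAlgebra.involute_eq_of_mem_even h₀,
    CliffordAlgebra.involute_eq_of_mem_odd h₁]
  convert add_mem h₁ h₁ using 1
  abel

theorem mem_oddPart_iff {x : HeckeCliff b} : x ∈ oddPart b ↔ par b x = -x := by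
  constructor
  · rintro ⟨y, rfl⟩
    induction y using TensorProduct.induction_on with
    | zero => simp
    | add x y hx hy => rw [map_add, map_add, hx, hy, neg_add]
    | tmul h c =>
      rw [LinearMap.lTensor_tmul, par_tmul, Submodule.subtype_apply,
        CliffordAlgebra.involute_eq_of_mem_odd c.2, TensorProduct.tmul_neg]
  · intro hx
    have h : ∀ y, y - par b y ∈ oddPart b := by
      intro y
      induction y using TensorProduct.induction_on with
      | zero => simp
      | add x y hx hy =>
        rw [map_add, add_sub_add_comm]
        exact add_mem hx hy
      | tmul h c =>
        rw [par_tmul, ← TensorProduct.tmul_sub]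
        exact ⟨h ⊗ₜ ⟨_, involute_sub_mem_odd c⟩, rfl⟩
    have h2 : x = (1 / 2 : ℝ) • (x - par b x) := by
      rw [hx]
      module
    rw [h2]
    exact Submodule.smul_mem _ _ (h x)

theorem rho_negOne_mul (c : MonoidAlgebra (ParamRing P) (pinCover P)) :
    rho b (MonoidAlgebra.of _ _ (negOne P) * c) = -rho b c := by
  rw [map_mul, rho_of, grp_negOne, heckeCliff_neg_mul, one_mul]

theorem rho_apply_eq_sum [Fintype (pinCover P)]
    (c : MonoidAlgebra (ParamRing P) (pinCover P)) : rho b c = ∑ a, c.coeff a • grp b a := by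
  have h : rho b c = c.coeff.sum fun a r => r • grp b a := MonoidAlgebra.lift_apply _ _
  rw [h]
  exact Finsupp.sum_fintype _ _ fun a => zero_smul _ _

variable [Fintype ι] [Fintype κ] [DecidableEq κ] [P.IsCrystallographic] [P.IsReduced]
variable {e e' : Module.Basis κ ℝ V}

theorem diff_smul (D : HeckeCliff b) (r : ParamRing P) (x : HeckeCliff b) :
    diff b D (r • x) = r • diff b D x := by
  rw [diff_apply, diff_apply, par_smul, mul_smul_comm, smul_mul_assoc, smul_sub]

/-- Only a and −a lie above p(a), and ρ(−a) = −ρ(a). The PBW coordinate of ρ(c) at p(a), taken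
relative to the lift a, is therefore the coefficient of a minus that of −a. -/
theorem negOne_mul_eq_of_rho_eq_zero [Fintype (weyl P)] [Fintype (pinCover P)]
    (hdual : DualBases e e') {c : MonoidAlgebra (ParamRing P) (pinCover P)} (hc : rho b c = 0) :
    MonoidAlgebra.of _ _ (negOne P) * c = c := by
  classical
  refine MonoidAlgebra.ext (Finsupp.ext fun a => ?_)
  have hz : (MonoidAlgebra.of (ParamRing P) _ (negOne P) * c).coeff a =
      c.coeff (negOne P * a) := by
    rw [MonoidAlgebra.of_apply, MonoidAlgebra.coeff_single_mul_apply, one_mul,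
      inv_eq_of_mul_eq_one_left negOne_mul_self]
  refine hz.trans ?_
  have hL : ∀ a', coord b e (fun _ => a) (proj P a) (c.coeff a' • grp b a') =
      (if a' = a then MvPolynomial.C (c.coeff a) ⊗ₜ[ℝ] (1 : Cliff V) else 0) +
      (if a' = negOne P * a then (-MvPolynomial.C (c.coeff (negOne P * a))) ⊗ₜ[ℝ] (1 : Cliff V)
        else 0) := by
    intro a'
    have h1 : coord b e (fun _ => a) (proj P a) (c.coeff a' • grp b a') =
        (if proj P a = proj P a' then MvPolynomial.C (c.coeff a') else 0) ⊗ₜ[ℝ]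
          ((a'.1 : Cliff V) * ((a⁻¹ : pinCover P).1 : Cliff V)) := by
      have h2 := coeffW_ofPoly_mul_ofW b e (proj P a) (proj P a') (MvPolynomial.C (c.coeff a'))
      change coeffW b e _ (ofPoly b e (algebraMap (ParamRing P) _ (c.coeff a')) * _) = _ at h2
      rw [AlgHom.commutes, ← Algebra.smul_def] at h2
      rw [grp_apply, TensorProduct.smul_tmul', coord_tmul, h2]
    have hinv1 : (a.1 : Cliff V) * ((a⁻¹ : pinCover P).1 : Cliff V) = 1 := Units.mul_inv a.1
    rw [h1]
    by_cases hp : proj P a = proj P a'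
    · rcases eq_or_eq_negOne_mul hdual hp.symm with h | h
      · subst h
        rw [if_pos rfl, if_pos rfl, if_neg (negOne_mul_ne _).symm, add_zero, hinv1]
      · subst h
        rw [if_pos hp, if_neg (negOne_mul_ne _), if_pos rfl, zero_add, coe_negOne_mul, neg_mul,
          hinv1, TensorProduct.tmul_neg, TensorProduct.neg_tmul]
    · rw [if_neg hp, if_neg, if_neg, TensorProduct.zero_tmul, add_zero]
      · rintro rfl
        exact hp (by rw [map_mul, proj_negOne, one_mul])
      · rintro rfl
        exact hp rfl
  have h0 := congrArg (coord b e (fun _ => a) (proj P a)) hc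
  rw [rho_apply_eq_sum, map_sum, map_zero] at h0
  simp only [hL, Finset.sum_add_distrib, Finset.sum_ite_eq', Finset.mem_univ, if_true] at h0
  have hinj : Function.Injective
      (Algebra.TensorProduct.includeLeft : Poly P κ →ₐ[ℝ] Poly P κ ⊗[ℝ] Cliff V) :=
    Algebra.TensorProduct.includeLeft_injective (algebraMap ℝ (Cliff V)).injective
  rw [← TensorProduct.add_tmul] at h0
  have h1 := (map_eq_zero_iff _ hinj).1 h0
  exact (MvPolynomial.C_injective _ _ (add_neg_eq_zero.1 h1)).symm

theorem diff_rho (hdual : DualBases e e') (hinv : InvariantInner P)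
    (c : MonoidAlgebra (ParamRing P) (pinCover P)) : diff b (dirac b e e') (rho b c) = 0 := by
  induction c using MonoidAlgebra.induction_on with
  | of a =>
    rw [rho_of, ← one_mul (grp b a), diff_mul_grp b hdual hinv, diff_apply, map_one, mul_one,
      one_mul, sub_self, zero_mul]
  | add x y hx hy => rw [map_add, map_add, hx, hy, add_zero]
  | smul r x hx => rw [map_smul, diff_smul, hx, smul_zero]

theorem rho_mem_cliffFilt (c : MonoidAlgebra (ParamRing P) (pinCover P)) :
    rho b c ∈ cliffFilt b 0 := by
  induction c using MonoidAlgebra.induction_on with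
  | of a =>
    rw [rho_of]
    exact grp_mem_cliffFilt b a 0
  | add x y hx hy =>
    rw [map_add]
    exact add_mem hx hy
  | smul r x hx =>
    rw [map_smul]
    exact smul_mem_cliffFilt b r hx

theorem diff_mem_evenInv (hdual : DualBases e e') (hinv : InvariantInner P) {a : HeckeCliff b}
    (ha : a ∈ oddInv b) : diff b (dirac b e e') a ∈ evenInv b := by
  refine ⟨?_, fun g => ?_⟩
  · rw [diff_apply, map_sub, map_mul, map_mul, par_par, ha.1, par_dirac]
    simp only [heckeCliff_neg_mul, heckeCliff_mul_neg, neg_neg, sub_neg_eq_add]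
  · rw [← diff_mul_grp b hdual hinv, ← ha.2, diff_apply, diff_apply, map_mul, par_par, mul_sub,
      ← mul_assoc (dirac b e e'), dirac_mul_par_grp b hdual hinv]
    simp only [mul_assoc]

theorem par_diff_of_odd {a : HeckeCliff b} (ha : par b a = -a) :
    par b (diff b (dirac b e e') a) = diff b (dirac b e e') a := by
  rw [diff_apply, map_sub, map_mul, map_mul, par_par, ha, par_dirac]
  simp only [heckeCliff_neg_mul, heckeCliff_mul_neg, neg_neg, sub_neg_eq_add]

theorem diff_mem_oddInv (hdual : DualBases e e') (hinv : InvariantInner P) {a : HeckeCliff b}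
    (ha : a ∈ evenInv b) : diff b (dirac b e e') a ∈ oddInv b := by
  refine ⟨?_, fun g => ?_⟩
  · rw [diff_apply, map_sub, map_mul, map_mul, par_par, ha.1, par_dirac]
    simp only [heckeCliff_neg_mul, heckeCliff_mul_neg]
    abel
  · have hp : par b (grp b g) * a = a * par b (grp b g) := by
      have := congrArg (par b) (ha.2 g)
      rwa [map_mul, map_mul, ha.1] at this
    rw [← diff_mul_grp b hdual hinv, ← ha.2, diff_apply, diff_apply, map_mul, ha.1, mul_sub,
      ← mul_assoc, par_grp_mul_dirac b hdual hinv]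
    simp only [mul_assoc]

variable [Fintype (weyl P)] [Fintype (pinCover P)]

/-- An invariant even cocycle is cohomologous to an element of the group algebra. -/
theorem exists_eq_rho_add_diff (hdual : DualBases e e') (hinv : InvariantInner P) (n : ℕ) :
    ∀ x ∈ evenInv b, x ∈ cliffFilt b n → diff b (dirac b e e') x = 0 →
      ∃ a ∈ oddInv b, ∃ c, x = rho b c + diff b (dirac b e e') a := by
  induction n with
  | zero =>
    intro x _ hx hdx
    obtain ⟨c, hc⟩ := exists_eq_rho b hdual hinv hx (hdx ▸ zero_mem _)
    exact ⟨0, zero_mem _, c, by rw [map_zero, add_zero, hc]⟩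
  | succ n ih =>
    intro x hxi hx hdx
    obtain ⟨a, -, ha⟩ := exists_sub_diff_mem_cliffFilt b hdual hinv hx (hdx ▸ zero_mem _)
    -- The primitive from the symbol calculus need not be invariant. Averaging it keeps x − d(a) in
    -- the lower filtration step, because x is already invariant and averaging preserves degree.
    have hodd := oddAvg_mem b hdual a
    have h1 : x - diff b (dirac b e e') (oddAvg b a) =
        evenAvg b (x - diff b (dirac b e e') a) := by
      rw [map_sub, evenAvg_of_mem b hxi, diff_oddAvg b hdual hinv]
    obtain ⟨a', ha', c, hc⟩ := ih (x - diff b (dirac b e e') (oddAvg b a))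
      (sub_mem hxi (diff_mem_evenInv b hdual hinv hodd))
      (h1 ▸ evenAvg_mem_cliffFilt b ha)
      (by rw [map_sub, hdx, diff_diff_of_mem_oddInv b hdual hinv hodd, sub_zero])
    refine ⟨a' + oddAvg b a, add_mem ha' hodd, c, ?_⟩
    rw [map_add, ← add_assoc, ← hc, sub_add_cancel]

/-- While a has positive degree, its top part is a Koszul cycle, so a can be lowered by subtracting
d of an even invariant; d(a) is unchanged since d² = 0. In degree zero a lies in the image of ρ,
which d kills. -/
theorem diff_eq_zero_of_mem_cliffFilt_zero (hdual : DualBases e e') (hinv : InvariantInner P)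
    (n : ℕ) : ∀ a ∈ oddInv b, a ∈ cliffFilt b n → diff b (dirac b e e') a ∈ cliffFilt b 0 →
      diff b (dirac b e e') a = 0 := by
  induction n with
  | zero =>
    intro a _ ha hda
    obtain ⟨c, hc⟩ := exists_eq_rho b hdual hinv ha hda
    rw [hc, diff_rho b hdual hinv]
  | succ n ih =>
    intro a hai ha hda
    obtain ⟨a', -, ha'⟩ := exists_sub_diff_mem_cliffFilt b hdual hinv ha
      (cliffFilt_mono b (Nat.zero_le _) hda)
    have heven := evenAvg_mem b hdual a'
    have h1 : a - diff b (dirac b e e') (evenAvg b a') =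
        oddAvg b (a - diff b (dirac b e e') a') := by
      rw [map_sub, oddAvg_of_mem b hai, diff_evenAvg b hdual hinv]
    have h2 : diff b (dirac b e e') (a - diff b (dirac b e e') (evenAvg b a')) =
        diff b (dirac b e e') a := by
      rw [map_sub, diff_diff_of_mem_evenInv b hdual hinv heven, sub_zero]
    rw [← h2]
    exact ih _ (sub_mem hai (diff_mem_oddInv b hdual hinv heven))
      (h1 ▸ oddAvg_mem_cliffFilt b ha') (h2 ▸ hda)

/-- Invariance of ρ(c) allows the primitive a to be averaged. The preceding descent then applies,
because ρ(c) has filtration degree zero. -/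
theorem rho_eq_zero_of_eq_diff (hdual : DualBases e e') (hinv : InvariantInner P)
    {c : MonoidAlgebra (ParamRing P) (pinCover P)} (hc : ∀ g, grp b g * rho b c = rho b c * grp b g)
    {a : HeckeCliff b} (ha : par b a = -a) (h : rho b c = diff b (dirac b e e') a) :
    rho b c = 0 := by
  have heven : rho b c ∈ evenInv b := ⟨by rw [h, par_diff_of_odd b ha], hc⟩
  have h1 : diff b (dirac b e e') (oddAvg b a) = rho b c := by
    rw [diff_oddAvg b hdual hinv, ← h, evenAvg_of_mem b heven]
  obtain ⟨n, hn⟩ := exists_mem_cliffFilt b (oddAvg b a)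
  rw [← h1]
  refine diff_eq_zero_of_mem_cliffFilt_zero b hdual hinv n _ (oddAvg_mem b hdual a) hn ?_
  rw [h1]
  exact rho_mem_cliffFilt b c

end Kernel

/-! ### Construction of ζ and its multiplicativity -/

section Zeta

variable {ι κ V V' : Type*} [NormedAddCommGroup V] [InnerProductSpace ℝ V]
  [AddCommGroup V'] [Module ℝ V']
variable {P : RootPairing ι ℝ V V'} (b : P.Base)

theorem pinAlg_neg_mul (c d : MonoidAlgebra (ParamRing P) (pinCover P)) :
    -c * d = -(c * d) := by
  refine eq_neg_of_add_eq_zero_left ?_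
  rw [← add_mul, neg_add_cancel, zero_mul]

theorem pinAlg_mul_neg (c d : MonoidAlgebra (ParamRing P) (pinCover P)) :
    c * -d = -(c * d) := by
  refine eq_neg_of_add_eq_zero_left ?_
  rw [← mul_add, neg_add_cancel, mul_zero]

variable (P) in
/-- The element `-1` of the pin cover, in the group algebra. -/
def negOneElt : MonoidAlgebra (ParamRing P) (pinCover P) := MonoidAlgebra.of _ _ (negOne P)

variable (P) in
/-- The scalar `1 / 2`. -/
def half : ParamRing P := MvPolynomial.C (1 / 2)

theorem half_add_half : half P + half P = 1 := by
  rw [half, ← map_add, add_halves, map_one]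

theorem half_smul_add_self {M : Type*} [AddCommGroup M] [Module (ParamRing P) M] (x : M) :
    half P • (x + x) = x := by
  rw [smul_add, ← add_smul, half_add_half, one_smul]

theorem negOneElt_mul_self : negOneElt P * negOneElt P = 1 := by
  rw [negOneElt, ← map_mul, negOne_mul_self, map_one]

theorem negOne_mul_comm (g : pinCover P) : negOne P * g = g * negOne P := by
  refine Subtype.ext (Units.ext ?_)
  rw [coe_negOne_mul]
  change _ = (g.1 : Cliff V) * ((-1 : (Cliff V)ˣ) : Cliff V)
  simp

theorem commute_of_forall_of {c : MonoidAlgebra (ParamRing P) (pinCover P)}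
    (hc : ∀ g, MonoidAlgebra.of _ _ g * c = c * MonoidAlgebra.of _ _ g)
    (d : MonoidAlgebra (ParamRing P) (pinCover P)) : d * c = c * d := by
  induction d using MonoidAlgebra.induction_on with
  | of g => exact hc g
  | add x y hx hy => rw [add_mul, mul_add, hx, hy]
  | smul r x hx => rw [smul_mul_assoc, mul_smul_comm, hx]

theorem negOneElt_mul_comm (c : MonoidAlgebra (ParamRing P) (pinCover P)) :
    c * negOneElt P = negOneElt P * c :=
  commute_of_forall_of (fun g => by rw [negOneElt, ← map_mul, ← map_mul, negOne_mul_comm]) c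

theorem eq_zero_of_negOneElt_mul {c : MonoidAlgebra (ParamRing P) (pinCover P)}
    (h : negOneElt P * c = c) (h' : negOneElt P * c = -c) : c = 0 := by
  have : c + c = 0 := by
    nth_rewrite 1 [← h]
    rw [h', neg_add_cancel]
  rw [← half_smul_add_self (P := P) c, this, smul_zero]

variable (P) in
/-- The idempotent `(1 + z) / 2`. -/
def evenIdem : MonoidAlgebra (ParamRing P) (pinCover P) := half P • (1 + negOneElt P)

theorem negOneElt_mul_evenIdem : negOneElt P * evenIdem P = evenIdem P := by
  rw [evenIdem, mul_smul_comm, mul_add, negOneElt_mul_self, mul_one, add_comm]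

theorem evenIdem_add_self : evenIdem P + evenIdem P = 1 + negOneElt P := by
  rw [evenIdem, ← smul_add, half_smul_add_self]

theorem evenIdem_mul (c : MonoidAlgebra (ParamRing P) (pinCover P)) :
    evenIdem P * c = half P • (c + negOneElt P * c) := by
  rw [evenIdem, smul_mul_assoc, add_mul, one_mul]

theorem mul_evenIdem (c : MonoidAlgebra (ParamRing P) (pinCover P)) :
    c * evenIdem P = evenIdem P * c := by
  rw [evenIdem_mul, evenIdem, mul_smul_comm, mul_add, mul_one, negOneElt_mul_comm]

theorem evenIdem_mul_self : evenIdem P * evenIdem P = evenIdem P := by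
  rw [evenIdem_mul, negOneElt_mul_evenIdem, half_smul_add_self]

theorem evenIdem_mul_of_eq_neg {c : MonoidAlgebra (ParamRing P) (pinCover P)}
    (hc : negOneElt P * c = -c) : evenIdem P * c = 0 := by
  rw [evenIdem_mul, hc, add_neg_cancel, smul_zero]

theorem rho_evenIdem : rho b (evenIdem P) = 0 := by
  rw [evenIdem, map_smul, map_add, ← mul_one (negOneElt P), negOneElt, rho_negOne_mul, map_one,
    add_neg_cancel, smul_zero]

theorem grp_mul_rho {c : MonoidAlgebra (ParamRing P) (pinCover P)}
    (hc : ∀ g, MonoidAlgebra.of _ _ g * c = c * MonoidAlgebra.of _ _ g) (g : pinCover P) :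
    grp b g * rho b c = rho b c * grp b g := by
  rw [← rho_of, ← map_mul, hc, map_mul]

theorem tmul_one_mul_comm {z : Hecke b} (hz : z ∈ Subalgebra.center (ParamRing P) (Hecke b))
    (x : HeckeCliff b) : z ⊗ₜ[ℝ] (1 : Cliff V) * x = x * z ⊗ₜ[ℝ] (1 : Cliff V) := by
  induction x using TensorProduct.induction_on with
  | zero => rw [mul_zero, zero_mul]
  | add x y hx hy => rw [mul_add, add_mul, hx, hy]
  | tmul h c =>
    rw [Algebra.TensorProduct.tmul_mul_tmul, Algebra.TensorProduct.tmul_mul_tmul, one_mul, mul_one,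
      Subalgebra.mem_center_iff.1 hz]

theorem par_tmul_one (z : Hecke b) : par b (z ⊗ₜ[ℝ] (1 : Cliff V)) = z ⊗ₜ[ℝ] (1 : Cliff V) := by
  rw [par_tmul, map_one]

variable [Fintype ι] [Fintype κ] [DecidableEq κ]

/-- `c` is a central element of the group algebra of the pin cover on which `-1` acts by `-1`,
and whose image in `H_A ⊗ C(V)` is cohomologous to `z ⊗ 1`. -/
structure IsDiracImage (e e' : κ → V) (z : Hecke b)
    (c : MonoidAlgebra (ParamRing P) (pinCover P)) : Prop where
  comm : ∀ g, MonoidAlgebra.of _ _ g * c = c * MonoidAlgebra.of _ _ g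
  negOneElt_mul : negOneElt P * c = -c
  exists_eq : ∃ a, par b a = -a ∧ z ⊗ₜ[ℝ] (1 : Cliff V) = rho b c + diff b (dirac b e e') a

namespace IsDiracImage

variable {b} {e e' : κ → V} {z z' : Hecke b} {c c' : MonoidAlgebra (ParamRing P) (pinCover P)}

theorem add (h : IsDiracImage b e e' z c) (h' : IsDiracImage b e e' z' c') :
    IsDiracImage b e e' (z + z') (c + c') := by
  obtain ⟨a, ha, hz⟩ := h.exists_eq
  obtain ⟨a', ha', hz'⟩ := h'.exists_eq
  refine ⟨fun g => by rw [mul_add, add_mul, h.comm, h'.comm],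
    by rw [mul_add, h.negOneElt_mul, h'.negOneElt_mul, neg_add],
    a + a', by rw [map_add, ha, ha', neg_add], ?_⟩
  rw [TensorProduct.add_tmul, hz, hz', map_add, map_add]
  abel

/-- The unit of the summand on which −1 acts by −1 is the complementary idempotent; ρ sends it to 1.
-/
theorem one : IsDiracImage b e e' 1 (1 - evenIdem P) := by
  refine ⟨fun g => by rw [mul_sub, sub_mul, mul_evenIdem, mul_one, one_mul], ?_, 0, by simp, ?_⟩
  · rw [mul_sub, mul_one, negOneElt_mul_evenIdem, neg_sub, sub_eq_sub_iff_add_eq_add,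
      evenIdem_add_self, add_comm]
  · rw [map_sub, map_one, rho_evenIdem, sub_zero, map_zero, add_zero,
      Algebra.TensorProduct.one_def]

theorem par_rho (h : IsDiracImage b e e' z c) : par b (rho b c) = rho b c := by
  obtain ⟨a, ha, hz⟩ := h.exists_eq
  rw [eq_sub_of_add_eq hz.symm, map_sub, par_tmul_one]
  congr 1
  rw [diff_apply, map_sub, map_mul, map_mul, par_par, ha, par_dirac]
  simp only [heckeCliff_neg_mul, heckeCliff_mul_neg, neg_neg, sub_neg_eq_add]

variable [P.IsCrystallographic] [P.IsReduced]

theorem smul (r : ParamRing P) (h : IsDiracImage b e e' z c) :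
    IsDiracImage b e e' (r • z) (r • c) := by
  obtain ⟨a, ha, hz⟩ := h.exists_eq
  refine ⟨fun g => by rw [mul_smul_comm, smul_mul_assoc, h.comm],
    by rw [mul_smul_comm, h.negOneElt_mul, smul_neg],
    r • a, by rw [par_smul, ha, smul_neg], ?_⟩
  rw [← TensorProduct.smul_tmul', hz, map_smul, diff_smul, smul_add]

variable {e e' : Module.Basis κ ℝ V}

/-- Since ρ(c) is even and commutes with D, d is left linear over it; since z' ⊗ 1 is even and
central, d is right linear over it. Expanding z z' = (ρ(c) + d(a)) z' and then ρ(c) z' gives the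
primitive ρ(c) a' + a (z' ⊗ 1). -/
theorem mul (hdual : DualBases e e') (hinv : InvariantInner P)
    (hz : z' ∈ Subalgebra.center (ParamRing P) (Hecke b)) (h : IsDiracImage b e e' z c)
    (h' : IsDiracImage b e e' z' c') : IsDiracImage b e e' (z * z') (c * c') := by
  obtain ⟨a, ha, hza⟩ := h.exists_eq
  obtain ⟨a', ha', hza'⟩ := h'.exists_eq
  refine ⟨fun g => by rw [← mul_assoc, h.comm, mul_assoc, h'.comm, mul_assoc],
    by rw [← mul_assoc, h.negOneElt_mul, pinAlg_neg_mul],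
    rho b c * a' + a * z' ⊗ₜ 1, ?_, ?_⟩
  · rw [map_add, map_mul, map_mul, par_tmul_one, h.par_rho, ha, ha', heckeCliff_mul_neg,
      heckeCliff_neg_mul, neg_add]
  · have hD : dirac b e e' * rho b c = rho b c * dirac b e e' := by
      have := diff_rho b hdual hinv c
      rwa [diff_apply, h.par_rho, sub_eq_zero] at this
    have h1 : diff b (dirac b e e') (rho b c * a') = rho b c * diff b (dirac b e e') a' := by
      rw [diff_apply, diff_apply, map_mul, h.par_rho, ← mul_assoc, hD, mul_sub, mul_assoc,
        mul_assoc]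
    have h2 : diff b (dirac b e e') (a * z' ⊗ₜ 1) =
        diff b (dirac b e e') a * z' ⊗ₜ[ℝ] (1 : Cliff V) := by
      rw [diff_apply, diff_apply, map_mul, par_tmul_one, mul_assoc (par b a),
        tmul_one_mul_comm b hz, sub_mul, mul_assoc, mul_assoc]
    rw [map_add, h1, h2, map_mul, ← add_assoc, ← mul_add, ← hza', ← add_mul, ← hza,
      Algebra.TensorProduct.tmul_mul_tmul, one_mul]

variable [Fintype (weyl P)] [Fintype (pinCover P)]

/-- The difference has ρ-image zero, so −1 fixes it, while −1 also acts on it by −1; hence it is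
zero. -/
theorem unique (hdual : DualBases e e') (hinv : InvariantInner P) (h : IsDiracImage b e e' z c)
    (h' : IsDiracImage b e e' z c') : c = c' := by
  obtain ⟨a, ha, hz⟩ := h.exists_eq
  obtain ⟨a', ha', hz'⟩ := h'.exists_eq
  have hcomm : ∀ g, MonoidAlgebra.of _ _ g * (c - c') = (c - c') * MonoidAlgebra.of _ _ g :=
    fun g => by rw [mul_sub, sub_mul, h.comm, h'.comm]
  have hrho : rho b (c - c') = diff b (dirac b e e') (a' - a) := by
    rw [map_sub, map_sub, sub_eq_sub_iff_add_eq_add, ← hz, hz', add_comm]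
  have h0 := rho_eq_zero_of_eq_diff b hdual hinv (grp_mul_rho b hcomm)
    (by rw [map_sub, ha, ha', neg_sub_neg, neg_sub]) hrho
  refine sub_eq_zero.1 (eq_zero_of_negOneElt_mul (negOne_mul_eq_of_rho_eq_zero b hdual h0) ?_)
  rw [mul_sub, h.negOneElt_mul, h'.negOneElt_mul, neg_sub_neg, neg_sub]

theorem exists_of_mem_center (hdual : DualBases e e') (hinv : InvariantInner P)
    (hz : z ∈ Subalgebra.center (ParamRing P) (Hecke b)) : ∃ c, IsDiracImage b e e' z c := by
  have hx : z ⊗ₜ[ℝ] (1 : Cliff V) ∈ evenInv b :=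
    ⟨par_tmul_one b z, fun g => (tmul_one_mul_comm b hz _).symm⟩
  obtain ⟨n, hn⟩ := exists_mem_cliffFilt b (z ⊗ₜ[ℝ] (1 : Cliff V))
  obtain ⟨a, ha, c, hc⟩ := exists_eq_rho_add_diff b hdual hinv n _ hx hn
    (by rw [diff_apply, par_tmul_one, tmul_one_mul_comm b hz, sub_self])
  have hcinv : rho b c ∈ evenInv b := by
    rw [eq_sub_of_add_eq hc.symm]
    exact sub_mem hx (diff_mem_evenInv b hdual hinv ha)
  -- Projection to the summand where −1 acts by −1; it does not change ρ(c), since ρ(−1) = −1. As ρ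
  -- is injective on that summand, centrality of d follows from invariance of ρ(c).
  set d := half P • (c - negOneElt P * c) with hd
  have hneg : negOneElt P * d = -d := by
    rw [hd, mul_smul_comm, mul_sub, ← mul_assoc, negOneElt_mul_self, one_mul, ← smul_neg, neg_sub]
  have hrho : rho b d = rho b c := by
    rw [hd, map_smul, map_sub, negOneElt, rho_negOne_mul, sub_neg_eq_add, half_smul_add_self]
  refine ⟨d, fun g => ?_, hneg, a, ha.1, by rw [hrho, hc]⟩
  refine sub_eq_zero.1 (eq_zero_of_negOneElt_mul (negOne_mul_eq_of_rho_eq_zero b hdual ?_) ?_)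
  · rw [map_sub, map_mul, map_mul, rho_of, hrho, hcinv.2, sub_self]
  · rw [mul_sub, ← mul_assoc, ← negOneElt_mul_comm, mul_assoc, hneg, ← mul_assoc, hneg, neg_sub,
      pinAlg_neg_mul, pinAlg_mul_neg, neg_sub_neg]

end IsDiracImage

/-! ### The homomorphism ζ and its uniqueness modulo the ideal generated by 1 + z -/

section Main

variable [P.IsCrystallographic] [P.IsReduced] [P.IsRootSystem] [Fintype (weyl P)]
  [Fintype (pinCover P)] {e e' : Module.Basis κ ℝ V}

/-- The component of `ζ` on which `-1` acts by `-1`. -/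
def zetaOdd (hdual : DualBases e e') (hinv : InvariantInner P)
    (z : Subalgebra.center (ParamRing P) (Hecke b)) :
    MonoidAlgebra (ParamRing P) (pinCover P) :=
  (IsDiracImage.exists_of_mem_center hdual hinv z.2).choose

theorem zetaOdd_spec (hdual : DualBases e e') (hinv : InvariantInner P)
    (z : Subalgebra.center (ParamRing P) (Hecke b)) :
    IsDiracImage b e e' z.1 (zetaOdd b hdual hinv z) :=
  (IsDiracImage.exists_of_mem_center hdual hinv z.2).choose_spec

/-- The homomorphism `ζ`, with values in the group algebra. On the summand where `-1` acts by `1`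
it is given by the trivial character. -/
def zetaHom (hdual : DualBases e e') (hinv : InvariantInner P) :
    Subalgebra.center (ParamRing P) (Hecke b) →ₐ[ParamRing P]
      MonoidAlgebra (ParamRing P) (pinCover P) :=
  -- The two summands annihilate each other, so the sum of the two maps is multiplicative, and their
  -- idempotents add up to 1. The second term lies in ker ρ, so any other A-algebra homomorphism
  -- from the centre to A could replace the trivial character.
  AlgHom.ofLinearMap
    { toFun := fun z => zetaOdd b hdual hinv z + trivialCharacter b z.1 • evenIdem P
      map_add' := fun z z' => by
        have h := (zetaOdd_spec b hdual hinv (z + z')).unique hdual hinv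
          ((zetaOdd_spec b hdual hinv z).add (zetaOdd_spec b hdual hinv z'))
        rw [h, AddMemClass.coe_add, map_add, add_smul]
        abel
      map_smul' := fun r z => by
        have h := (zetaOdd_spec b hdual hinv (r • z)).unique hdual hinv
          ((zetaOdd_spec b hdual hinv z).smul r)
        rw [h, Subalgebra.coe_smul, map_smul, smul_assoc, RingHom.id_apply, smul_add] }
    (by
      have h := (zetaOdd_spec b hdual hinv 1).unique hdual hinv IsDiracImage.one
      change zetaOdd b hdual hinv 1 + trivialCharacter b (1 : Hecke b) • evenIdem P = 1
      rw [h, map_one, one_smul, sub_add_cancel])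
    (fun z z' => by
      have h := (zetaOdd_spec b hdual hinv (z * z')).unique hdual hinv
        ((zetaOdd_spec b hdual hinv z).mul hdual hinv z'.2 (zetaOdd_spec b hdual hinv z'))
      change zetaOdd b hdual hinv (z * z') + trivialCharacter b (z.1 * z'.1) • evenIdem P =
        (zetaOdd b hdual hinv z + trivialCharacter b z.1 • evenIdem P) *
          (zetaOdd b hdual hinv z' + trivialCharacter b z'.1 • evenIdem P)
      rw [h, add_mul, mul_add, mul_add, mul_smul_comm, mul_smul_comm, smul_mul_assoc,
        smul_mul_assoc, evenIdem_mul_self, mul_evenIdem,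
        evenIdem_mul_of_eq_neg (zetaOdd_spec b hdual hinv z).negOneElt_mul,
        evenIdem_mul_of_eq_neg (zetaOdd_spec b hdual hinv z').negOneElt_mul, smul_zero, smul_zero,
        add_zero, zero_add, smul_smul, map_mul, mul_comm (trivialCharacter b z.1)])

theorem zetaHom_apply (hdual : DualBases e e') (hinv : InvariantInner P)
    (z : Subalgebra.center (ParamRing P) (Hecke b)) : zetaHom b hdual hinv z =
      zetaOdd b hdual hinv z + trivialCharacter b z.1 • evenIdem P := rfl

theorem zetaHom_comm (hdual : DualBases e e') (hinv : InvariantInner P)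
    (z : Subalgebra.center (ParamRing P) (Hecke b)) (g : pinCover P) :
    MonoidAlgebra.of _ _ g * zetaHom b hdual hinv z =
      zetaHom b hdual hinv z * MonoidAlgebra.of _ _ g := by
  rw [zetaHom_apply, mul_add, add_mul, (zetaOdd_spec b hdual hinv z).comm, mul_smul_comm,
    smul_mul_assoc, mul_evenIdem]

theorem zetaHom_mem_center (hdual : DualBases e e') (hinv : InvariantInner P)
    (z : Subalgebra.center (ParamRing P) (Hecke b)) : zetaHom b hdual hinv z ∈
      Subalgebra.center (ParamRing P) (MonoidAlgebra (ParamRing P) (pinCover P)) :=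
  Subalgebra.mem_center_iff.2 (commute_of_forall_of (zetaHom_comm b hdual hinv z))

theorem exists_eq_rho_zetaHom (hdual : DualBases e e') (hinv : InvariantInner P)
    (z : Subalgebra.center (ParamRing P) (Hecke b)) :
    ∃ a, par b a = -a ∧ z.1 ⊗ₜ[ℝ] (1 : Cliff V) =
      rho b (zetaHom b hdual hinv z) + diff b (dirac b e e') a := by
  obtain ⟨a, ha, h⟩ := (zetaOdd_spec b hdual hinv z).exists_eq
  refine ⟨a, ha, ?_⟩
  rw [zetaHom_apply, map_add, map_smul, rho_evenIdem, smul_zero, add_zero, h]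

theorem diff_of_odd {D a : HeckeCliff b} (ha : par b a = -a) : diff b D a = D * a + a * D := by
  rw [diff_apply, ha, heckeCliff_neg_mul, sub_neg_eq_add]

theorem exists_sub_zetaHom_eq (hdual : DualBases e e') (hinv : InvariantInner P)
    (z : Subalgebra.center (ParamRing P) (Hecke b))
    {c : MonoidAlgebra (ParamRing P) (pinCover P)}
    (hc : c ∈ Subalgebra.center (ParamRing P) (MonoidAlgebra (ParamRing P) (pinCover P)))
    {a : HeckeCliff b} (ha : par b a = -a)
    (h : z.1 ⊗ₜ[ℝ] (1 : Cliff V) = rho b c + diff b (dirac b e e') a) :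
    ∃ d, c - zetaHom b hdual hinv z = (1 + MonoidAlgebra.of (ParamRing P) _ (negOne P)) * d := by
  obtain ⟨a', ha', h'⟩ := exists_eq_rho_zetaHom b hdual hinv z
  have hcomm : ∀ g, MonoidAlgebra.of _ _ g * (c - zetaHom b hdual hinv z) =
      (c - zetaHom b hdual hinv z) * MonoidAlgebra.of _ _ g :=
    fun g => by rw [mul_sub, sub_mul, zetaHom_comm, Subalgebra.mem_center_iff.1 hc]
  have hrho : rho b (c - zetaHom b hdual hinv z) = diff b (dirac b e e') (a' - a) := by
    rw [map_sub, map_sub, sub_eq_sub_iff_add_eq_add, ← h, h', add_comm]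
  have h0 := negOne_mul_eq_of_rho_eq_zero b hdual (rho_eq_zero_of_eq_diff b hdual hinv
    (grp_mul_rho b hcomm) (by rw [map_sub, ha, ha', neg_sub_neg, neg_sub]) hrho)
  -- The difference x is fixed by −1, so (1 + z) acts on it as 2 and x = (1 + z)(x/2), with z the
  -- element −1 of the pin cover.
  refine ⟨half P • (c - zetaHom b hdual hinv z), ?_⟩
  rw [mul_smul_comm, add_mul, one_mul, h0, half_smul_add_self]

end Main

end Zeta

end GradedHecke

end

theorem mainTheorem4 {ι V V' κ : Type*} [Fintype ι] [Fintype κ] [DecidableEq κ]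
    [NormedAddCommGroup V] [InnerProductSpace ℝ V] [AddCommGroup V'] [Module ℝ V']
    (P : RootPairing ι ℝ V V') [P.IsRootSystem] [P.IsCrystallographic] [P.IsReduced]
    (b : P.Base)
    (hinv : ∀ w ∈ GradedHecke.weyl P, ∀ x y : V, inner ℝ (w x) (w y) = inner ℝ x y)
    (e e' : Module.Basis κ ℝ V)
    (hdual : ∀ i j, inner ℝ (e i) (e' j) = if i = j then 1 else 0) :
    ∃ ζ : Subalgebra.center (GradedHecke.ParamRing P) (GradedHecke.Hecke b)
        →ₐ[GradedHecke.ParamRing P]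
        Subalgebra.center (GradedHecke.ParamRing P)
          (MonoidAlgebra (GradedHecke.ParamRing P) (GradedHecke.pinCover P)),
      (∀ z : Subalgebra.center (GradedHecke.ParamRing P) (GradedHecke.Hecke b),
        ∃ a ∈ GradedHecke.oddPart b,
        (z : GradedHecke.Hecke b) ⊗ₜ[ℝ] (1 : GradedHecke.Cliff V) =
          GradedHecke.rho b (ζ z) + GradedHecke.dirac b e e' * a + a * GradedHecke.dirac b e e') ∧
      (∀ z : Subalgebra.center (GradedHecke.ParamRing P) (GradedHecke.Hecke b),
        ∀ c ∈ Subalgebra.center (GradedHecke.ParamRing P)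
          (MonoidAlgebra (GradedHecke.ParamRing P) (GradedHecke.pinCover P)),
        (∃ a ∈ GradedHecke.oddPart b,
          (z : GradedHecke.Hecke b) ⊗ₜ[ℝ] (1 : GradedHecke.Cliff V) =
            GradedHecke.rho b c + GradedHecke.dirac b e e' * a + a * GradedHecke.dirac b e e') →
        ∃ d, c - ζ z =
          (1 + MonoidAlgebra.of (GradedHecke.ParamRing P) _ (GradedHecke.negOne P)) * d) := by
  classical
  have : Finite (GradedHecke.weyl P) := GradedHecke.finite_weyl b
  have : Finite (GradedHecke.pinCover P) := GradedHecke.finite_pinCover (P := P) hdual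
  have : Fintype (GradedHecke.weyl P) := Fintype.ofFinite _
  have : Fintype (GradedHecke.pinCover P) := Fintype.ofFinite _
  refine ⟨(GradedHecke.zetaHom b hdual hinv).codRestrict _
    (GradedHecke.zetaHom_mem_center b hdual hinv), fun z => ?_, fun z c hc h => ?_⟩
  · obtain ⟨a, ha, h⟩ := GradedHecke.exists_eq_rho_zetaHom b hdual hinv z
    refine ⟨a, (GradedHecke.mem_oddPart_iff b).2 ha, ?_⟩
    rw [GradedHecke.diff_of_odd b ha, ← add_assoc] at h
    exact h
  · obtain ⟨a, ha, h⟩ := h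
    have ha' := (GradedHecke.mem_oddPart_iff b).1 ha
    rw [add_assoc, ← GradedHecke.diff_of_odd b ha'] at h
    exact GradedHecke.exists_sub_zetaHom_eq b hdual hinv z hc ha' h
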